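/- **Setting.** Let $\mathcal S,\mathcal A$ be measurable spaces, $\mathsf P(\cdot|s,a)$ a transition kernel, $r(s,a,s')\in[0,r_{\max}]$ a measurable reward, $\gamma\in[0,1]$, and let $\pi,\pi_b$ be policies such that $\pi(\cdot|s)$ has the density $\rho(s,\cdot)$ with respect to $\pi_b(\cdot|s)$ (for discrete actions $\rho(s,a)=\pi(a|s)/\pi_b(a|s)$). Let $\mu=\mu^{\pi_b}$ be a stationary distribution of the state process under $\pi_b$. Let $V_\theta:\mathcal S\to\mathbb R$, $\theta\in\mathbb R^N$, be measurable in $s$ and $C^2$ in $\theta$, and put $\phi_\theta(s)=\nabla V_\theta(s)$, $\delta_{s,a,s'}(\theta)=r(s,a,s')+\gamma V_\theta(s')-V_\theta(s)$. With $S\sim\mu$, $A\sim\pi_b(\cdot|S)$, $S'\sim\mathsf P(\cdot|S,A)$, let $$A_\theta=\mathbb E[\phi_\theta(S)\phi_\theta(S)^\top],\qquad J(\theta)=\mathbb E[\rho(S,A)\,\delta_{S,A,S'}(\theta)\,\phi_\theta(S)]^\top A_\theta^{-1}\,\mathbb E[\rho(S,A)\,\delta_{S,A,S'}(\theta)\,\phi_\theta(S)].$$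 Assume that for all $s,a,\theta,\theta'$: $|V_\theta(s)|\le C_v$, $\|\phi_\theta(s)\|\le C_\phi$, $\|\nabla^2V_\theta(s)\|\le D_v$, $\|\nabla^2V_\theta(s)-\nabla^2V_{\theta'}(s)\|\le L_V\|\theta-\theta'\|$, $\lambda_{\min}(A_\theta)\ge\lambda_v$, and $\rho(s,a)\le\rho_{\max}$, where $r_{\max}\ge0$ and $C_v,C_\phi,D_v,L_V,\lambda_v,\rho_{\max}>0$; call these seven numbers the problem constants. **Algorithm (non-linear TDC).** Let $R_\omega=\frac{\rho_{\max}C_\phi}{\lambda_v}(r_{\max}+(1+\gamma)C_v)$ and let $\Pi_{R_\omega}$ be the projection onto $\{\|w\|\le R_\omega\}$. From deterministic $\theta_0,\omega_0\in\mathbb R^N$ and samples $(s_t,a_t,s_t')$, with $\rho_t=\rho(s_t,a_t)$ and $\delta_t=\delta_{s_t,a_t,s'_t}(\theta_t)$, set $$\omega_{t+1}=\Pi_{R_\omega}\big(\omega_t+\beta(-\phi_{\theta_t}(s_t)\phi_{\theta_t}(s_t)^\top\omega_t+\rho_t\delta_t\phi_{\theta_t}(s_t))\big),$$ $$\theta_{t+1}=\theta_t+\alpha\big(\rho_t\delta_t\phi_{\theta_t}(s_t)-\gamma\rho_t\phi_{\theta_t}(s'_t)\phi_{\theta_t}(s_t)^\top\omega_t-(\rho_t\delta_t-\phi_{\theta_t}(s_t)^\top\omega_t)\nabla^2V_{\theta_t}(s_t)\omega_t\big).$$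 The output is $\theta_W$, where $W$ is uniform on $\{0,\dots,T-1\}$ and independent of the samples. In the *i.i.d. setting* the samples are i.i.d. copies of $(S,A,S')$. In the *Markovian setting* they come from one trajectory under $\pi_b$ with arbitrary initial distribution ($a_t\sim\pi_b(\cdot|s_t)$, $s'_t=s_{t+1}\sim\mathsf P(\cdot|s_t,a_t)$), and it is assumed in addition that, for some $m>0$, $\kappa\in(0,1)$, $\sup_s d_{TV}(\mathbb P(s_t=\cdot\,|\,s_0=s,\pi_b),\mu)\le m\kappa^t$ for all $t>0$. **Statement (step-sizes of order $1/\sqrt T$).** There is $c_0>0$, depending only on the problem constants, such that the following holds for all $0<c_1\le c_2$ and $R_0\ge0$. Let the step-sizes satisfy $\frac{c_1}{\sqrt T}\le\alpha,\beta\le\frac{c_2}{\sqrt T}$ and $\frac{\alpha}{\beta}\le c_0$, and let $\|\omega_0\|\le R_0$. Then $J$ is differentiable, $\|\nabla J(\theta_W)\|^2$ is integrable, and: 1. in the i.i.d. setting, $\mathbb E\|\nabla J(\theta_W)\|^2\le C/\sqrt T$ for all $T\ge1$, where $C$ depends only on the problem constants and $c_1,c_2,R_0$; 2. in the Markovian setting,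 $\mathbb E\|\nabla J(\theta_W)\|^2\le C\log T/\sqrt T$ for all $T\ge2$, where $C$ depends only on the problem constants and $c_1,c_2,R_0,m,\kappa$. -/

import Mathlib

open MeasureTheory ProbabilityTheory
open scoped RealInnerProductSpace

noncomputable section

namespace NonlinearTDC

/-- The parameter space `ℝ^N` with the Euclidean norm. -/
abbrev Param (N : ℕ) := EuclideanSpace ℝ (Fin N)

/-- The total-variation distance between two probability measures. -/
def tvDist {X : Type*} [MeasurableSpace X] (μ ν : Measure X) : ℝ :=
  ⨆ B : {B : Set X // MeasurableSet B}, |μ.real B.1 - ν.real B.1|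

/-- The projection onto the closed ball of radius `R` about the origin. -/
def projBall {N : ℕ} (R : ℝ) (v : Param N) : Param N :=
  if ‖v‖ ≤ R then v else (R / ‖v‖) • v

theorem norm_projBall_le {N : ℕ} {R : ℝ} (hR : 0 ≤ R) (v : Param N) : ‖projBall R v‖ ≤ R := by
  unfold projBall
  split_ifs with h
  · exact h
  · have hv : 0 < ‖v‖ := lt_of_le_of_lt hR (not_le.mp h)
    rw [norm_smul, Real.norm_of_nonneg (div_nonneg hR hv.le), div_mul_cancel₀ _ hv.ne']

/-- `projBall R v` is a point of the ball that is nearest to `v`. -/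
theorem norm_sub_projBall_le {N : ℕ} {R : ℝ} (hR : 0 ≤ R) (v w : Param N) (hw : ‖w‖ ≤ R) :
    ‖v - projBall R v‖ ≤ ‖v - w‖ := by
  unfold projBall
  split_ifs with h
  · simp
  · have hv : 0 < ‖v‖ := lt_of_le_of_lt hR (not_le.mp h)
    have h1 : v - (R / ‖v‖) • v = (1 - R / ‖v‖) • v := by rw [sub_smul, one_smul]
    have h2 : 0 ≤ 1 - R / ‖v‖ := by
      rw [sub_nonneg, div_le_one hv]; exact (not_le.mp h).le
    rw [h1, norm_smul, Real.norm_of_nonneg h2, sub_mul, one_mul, div_mul_cancel₀ _ hv.ne']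
    have := norm_sub_norm_le v w
    linarith

/-- An off-policy evaluation problem: a Markov decision process, a target policy, a behavior
policy with a stationary distribution, and a parameterized family of value functions. State and
action spaces are arbitrary measurable spaces. -/
structure Problem (S A : Type*) [MeasurableSpace S] [MeasurableSpace A] (N : ℕ) where
  /-- the transition kernel `P(· | s, a)` -/
  trans : Kernel (S × A) S
  /-- the reward `r(s, a, s')` -/
  reward : S → A → S → ℝ
  /-- the discount factor -/
  γ : ℝ
  /-- the target policy -/
  target : Kernel S A
  /-- the behavior policy -/
  behavior : Kernel S A
  /-- the importance sampling ratio -/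
  ρ : S → A → ℝ
  /-- a stationary distribution of the state process under the behavior policy -/
  μ : Measure S
  /-- the value functions `V_θ(s)` -/
  V : Param N → S → ℝ
  markov_trans : IsMarkovKernel trans
  markov_target : IsMarkovKernel target
  markov_behavior : IsMarkovKernel behavior
  prob_μ : IsProbabilityMeasure μ
  measurable_reward : Measurable fun o : S × A × S => reward o.1 o.2.1 o.2.2
  γ_nonneg : 0 ≤ γ
  γ_le_one : γ ≤ 1
  measurable_ρ : Measurable fun x : S × A => ρ x.1 x.2
  ρ_nonneg : ∀ s a, 0 ≤ ρ s a
  /-- `ρ(s, ·)` is the density of the target policy with respect to the behavior policy; for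
  discrete actions, `ρ(s, a) = π(a | s) / π_b(a | s)` -/
  target_eq : ∀ s, target s = (behavior s).withDensity fun a => ENNReal.ofReal (ρ s a)
  /-- `μ` is stationary for the state process under the behavior policy -/
  stationary : Kernel.Invariant (behavior ⊗ₖ trans).snd μ
  measurable_V : ∀ θ, Measurable (V θ)

/-- The constants of the assumptions. -/
structure Bounds where
  rMax : ℝ
  ρMax : ℝ
  Cv : ℝ
  Cφ : ℝ
  Dv : ℝ
  LV : ℝ
  lamv : ℝ
  rMax_nonneg : 0 ≤ rMax
  ρMax_pos : 0 < ρMax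
  Cv_pos : 0 < Cv
  Cφ_pos : 0 < Cφ
  Dv_pos : 0 < Dv
  LV_pos : 0 < LV
  lamv_pos : 0 < lamv

namespace Problem

variable {S A : Type*} [MeasurableSpace S] [MeasurableSpace A] {N : ℕ} (p : Problem S A N)

/-- The joint law of `(a, s')` given the state `s`, under the behavior policy. -/
def stepKernel : Kernel S (A × S) := p.behavior ⊗ₖ p.trans

/-- The transition kernel of the state process under the behavior policy. -/
def stateKernel : Kernel S S := p.stepKernel.snd

/-- The law of `(s, a, s')` with `s ~ μ`, `a ~ π_b(· | s)`, `s' ~ P(· | s, a)`. -/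
def sampleLaw : Measure (S × A × S) := p.μ ⊗ₘ p.stepKernel

/-- The TD error `δ_{s,a,s'}(θ)`. -/
def tdError (θ : Param N) (o : S × A × S) : ℝ :=
  p.reward o.1 o.2.1 o.2.2 + p.γ * p.V θ o.2.2 - p.V θ o.1

/-- The feature vector `φ_θ(s) = ∇ V_θ(s)`, gradient in `θ`. -/
def feature (θ : Param N) (s : S) : Param N := gradient (fun θ => p.V θ s) θ

/-- The Hessian `∇² V_θ(s)` in `θ`, as an operator. -/
def hess (θ : Param N) (s : S) : Param N →L[ℝ] Param N :=
  fderiv ℝ (fun θ => p.feature θ s) θ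

/-- `A_θ = E_μ[φ_θ(S) φ_θ(S)ᵀ]`. -/
def featureCov (θ : Param N) : Param N →L[ℝ] Param N :=
  ∫ s, InnerProductSpace.rankOne ℝ (p.feature θ s) (p.feature θ s) ∂p.μ

/-- `E[ρ(S, A) δ_{S,A,S'}(θ) φ_θ(S)]`. -/
def tdMean (θ : Param N) : Param N :=
  ∫ o, (p.ρ o.1 o.2.1 * p.tdError θ o) • p.feature θ o.1 ∂p.sampleLaw

/-- The objective
`J(θ) = E[ρ δ(θ) φ_θ]ᵀ A_θ⁻¹ E[ρ δ(θ) φ_θ]`. -/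
def J (θ : Param N) : ℝ :=
  ⟪p.tdMean θ, (p.featureCov θ).inverse (p.tdMean θ)⟫

/-- `h(θ, ω) = (ρ δ(θ) - φ_θ(s)ᵀ ω) ∇² V_θ(s) ω`, for one sample. -/
def hTerm (θ ω : Param N) (o : S × A × S) : Param N :=
  (p.ρ o.1 o.2.1 * p.tdError θ o - ⟪p.feature θ o.1, ω⟫) • p.hess θ o.1 ω

/-- The direction of the fast update: `-φ φᵀ ω + ρ δ φ`. -/
def fastDir (θ ω : Param N) (o : S × A × S) : Param N :=
  -(⟪p.feature θ o.1, ω⟫ • p.feature θ o.1) +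
    (p.ρ o.1 o.2.1 * p.tdError θ o) • p.feature θ o.1

/-- The direction of the slow update: `ρ δ φ(s) - γ ρ φ(s') φ(s)ᵀ ω - h`. -/
def slowDir (θ ω : Param N) (o : S × A × S) : Param N :=
  (p.ρ o.1 o.2.1 * p.tdError θ o) • p.feature θ o.1 -
    (p.γ * p.ρ o.1 o.2.1 * ⟪p.feature θ o.1, ω⟫) • p.feature θ o.2.2 - p.hTerm θ ω o

/-- The projection radius `R_ω`. -/
def radius (b : Bounds) : ℝ :=
  b.ρMax * b.Cφ / b.lamv * (b.rMax + (1 + p.γ) * b.Cv)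

/-- The iterates `(θ_t, ω_t)` of the algorithm, driven by the samples `o 0, o 1, …`. -/
def iterates (b : Bounds) (α β : ℝ) (θ₀ ω₀ : Param N) (o : ℕ → S × A × S) :
    ℕ → Param N × Param N
  | 0 => (θ₀, ω₀)
  | t + 1 =>
    let x := iterates b α β θ₀ ω₀ o t
    (x.1 + α • p.slowDir x.1 x.2 (o t),
      projBall (p.radius b) (x.2 + β • p.fastDir x.1 x.2 (o t)))

/-- Bounded rewards, boundedness and smoothness of the function class, non-singularity, and
bounded importance sampling ratio. -/
structure Assumptions (b : Bounds) : Prop where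
  reward_nonneg : ∀ s a t, 0 ≤ p.reward s a t
  reward_le : ∀ s a t, p.reward s a t ≤ b.rMax
  smooth : ∀ s, ContDiff ℝ 2 fun θ => p.V θ s
  value_le : ∀ θ s, |p.V θ s| ≤ b.Cv
  feature_le : ∀ θ s, ‖p.feature θ s‖ ≤ b.Cφ
  hess_le : ∀ θ s, ‖p.hess θ s‖ ≤ b.Dv
  hess_lipschitz : ∀ θ η s, ‖p.hess θ s - p.hess η s‖ ≤ b.LV * ‖θ - η‖
  /-- the minimal eigenvalue of the symmetric operator `A_θ` is at least `lamv` -/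
  nonsingular : ∀ θ (x : ℝ),
    Module.End.HasEigenvalue (p.featureCov θ : Param N →ₗ[ℝ] Param N) x → b.lamv ≤ x
  ratio_le : ∀ s a, p.ρ s a ≤ b.ρMax

/-- Geometric uniform ergodicity of the state process under the behavior policy. -/
def GeometricallyErgodic (m κ : ℝ) : Prop :=
  ∀ s, ∀ t : ℕ, 0 < t → tvDist ((p.stateKernel ^ t) s) p.μ ≤ m * κ ^ t

variable {Ω : Type*} [MeasurableSpace Ω]

/-- I.i.d. sampling: the samples `(s_t, a_t, s'_t)` are independent with law `sampleLaw`. -/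
structure IsIIDSample (P : Measure Ω) (O : ℕ → Ω → S × A × S) : Prop where
  measurable : ∀ t, Measurable (O t)
  law : ∀ t, P.map (O t) = p.sampleLaw
  indep : iIndepFun O P

/-- Markovian sampling: a single trajectory under the behavior policy, with an arbitrary initial
distribution. Given the past up to the state at time `t`, the pair `(a_t, s_{t+1})` has the law
`stepKernel (s_t)`. -/
structure IsTrajectory (P : Measure Ω) (s : ℕ → Ω → S) (a : ℕ → Ω → A) : Prop where
  markov : ∃ ℱ : Filtration ℕ (inferInstance : MeasurableSpace Ω),
    (∀ t, Measurable[ℱ t] (s t)) ∧ (∀ t, Measurable[ℱ (t + 1)] (a t)) ∧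
    ∀ t (B : Set Ω), MeasurableSet[ℱ t] B → ∀ C : Set (A × S), MeasurableSet C →
      P (B ∩ {x | (a t x, s (t + 1) x) ∈ C}) = ∫⁻ x in B, p.stepKernel (s t x) C ∂P

end Problem

/-- `W` is uniform on `{0, …, T - 1}` and independent of the samples `X`. -/
structure IsUniformIndex {Ω Y : Type*} [MeasurableSpace Ω] [MeasurableSpace Y] (P : Measure Ω)
    (T : ℕ) (W : Ω → ℕ) (X : Ω → Y) : Prop where
  measurable : Measurable W
  uniform : ∀ k < T, P {x | W x = k} = (T : ENNReal)⁻¹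
  indep : IndepFun W X P

/-- Step-sizes of exact order `1/√T`, with ratio `α/β` at most `c₀`. -/
structure StepSizes (c₀ c₁ c₂ : ℝ) (T : ℕ) (α β : ℝ) : Prop where
  le_α : c₁ / √(T : ℝ) ≤ α
  α_le : α ≤ c₂ / √(T : ℝ)
  le_β : c₁ / √(T : ℝ) ≤ β
  β_le : β ≤ c₂ / √(T : ℝ)
  ratio : α / β ≤ c₀

end NonlinearTDC

end

/-! Write b(θ) = E[ρδφ] and ω*(θ) = A_θ⁻¹ b(θ). For fixed θ the concave quadratic ω ↦ 2⟨b(θ), ω⟩ -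
⟨A_θ ω, ω⟩ has its maximum J(θ) at ω*(θ). By the envelope principle ∇J is found by differentiating
this quadratic in θ with ω frozen at ω*(θ). Since ρ has conditional mean one given the state, the
outcome is that the mean slow direction at (θ, ω*(θ)) equals -½∇J(θ) (`inner_meanDeriv`,
`abs_J_expansion`). The mean fast direction is A_θ(ω*(θ) - ω), which pulls ω towards ω*(θ) at rate
λ_v.

Both time scales are controlled by the single Lyapunov function J(θ) + ‖ω - ω*(θ)‖². The slow step
contributes -(α/4)‖∇J‖² and a coupling error of order α‖ω - ω*‖². The fast step contributes at most
-2λ_v β‖ω - ω*‖², which absorbs the coupling once α/β is below a constant (`drift_le`). The Taylor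
remainders are O(α² + β²) (`lyapunov_step`); this needs ω* to have a Lipschitz derivative, which is
read off from the equation A_θ ω*(θ) = b(θ). The projection does no harm, because R_ω is chosen so
that ω*(θ) always lies in the ball.

Summing over T steps and dividing by αT, which is of order √T, gives 1/√T up to the noise, that is,
the error of replacing a sample by an independent stationary one (`sum_integral_norm_gradJ_sq_le`).
For i.i.d. samples the iterate is independent of the next sample and the noise vanishes in
expectation. Along a trajectory the iterate is replaced by the one τ steps earlier, with τ of order
log T: it has moved by O(τ/√T), and the law of the state is within O(1/T) of stationarity. This
costs the factor log T (`IsMarkov.noiseLE`, `markov_rate`). -/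

noncomputable section

namespace NonlinearTDC

/-! ### Bounded Lipschitz functions -/

/-- `f` is bounded by `K` and `K`-Lipschitz on `s`. -/
structure BddLip {X E : Type*} [PseudoMetricSpace X] [NormedAddCommGroup E] (s : Set X) (f : X → E)
    (K : ℝ) : Prop where
  nonneg : 0 ≤ K
  norm_le : ∀ x ∈ s, ‖f x‖ ≤ K
  norm_sub_le : ∀ x ∈ s, ∀ y ∈ s, ‖f x - f y‖ ≤ K * dist x y

namespace BddLip

variable {X Y E F : Type*} [PseudoMetricSpace X] [PseudoMetricSpace Y] [NormedAddCommGroup E]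
  [NormedAddCommGroup F] {s : Set X} {f g : X → E} {K L : ℝ}

theorem mono (hf : BddLip s f K) (h : K ≤ L) : BddLip s f L where
  nonneg := hf.nonneg.trans h
  norm_le x hx := (hf.norm_le x hx).trans h
  norm_sub_le x hx y hy := (hf.norm_sub_le x hx y hy).trans
    (mul_le_mul_of_nonneg_right h dist_nonneg)

theorem const (c : E) (h : ‖c‖ ≤ K) : BddLip s (fun _ => c) K where
  nonneg := (norm_nonneg c).trans h
  norm_le _ _ := h
  norm_sub_le x _ y _ := by
    simpa using mul_nonneg ((norm_nonneg c).trans h) (dist_nonneg (x := x) (y := y))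

theorem add (hf : BddLip s f K) (hg : BddLip s g L) : BddLip s (fun x => f x + g x) (K + L) where
  nonneg := add_nonneg hf.nonneg hg.nonneg
  norm_le x hx := (norm_add_le _ _).trans (add_le_add (hf.norm_le x hx) (hg.norm_le x hx))
  norm_sub_le x hx y hy := by
    have h := norm_add_le (f x - f y) (g x - g y)
    rw [add_sub_add_comm, add_mul]
    exact h.trans (add_le_add (hf.norm_sub_le x hx y hy) (hg.norm_sub_le x hx y hy))

theorem neg (hf : BddLip s f K) : BddLip s (fun x => -f x) K where
  nonneg := hf.nonneg
  norm_le x hx := by simpa using hf.norm_le x hx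
  norm_sub_le x hx y hy := by
    rw [neg_sub_neg, dist_comm]; exact hf.norm_sub_le y hy x hx

theorem sub (hf : BddLip s f K) (hg : BddLip s g L) : BddLip s (fun x => f x - g x) (K + L) := by
  simpa only [sub_eq_add_neg] using hf.add hg.neg

/-- Composition with a bounded bilinear map of norm at most one. -/
theorem bilin {G : Type*} [NormedAddCommGroup G] {h : X → F} {B : E → F → G}
    (hB : ∀ u v, ‖B u v‖ ≤ ‖u‖ * ‖v‖) (hl : ∀ u u' v, B (u - u') v = B u v - B u' v)
    (hr : ∀ u v v', B u (v - v') = B u v - B u v') (hf : BddLip s f K) (hh : BddLip s h L) :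
    BddLip s (fun x => B (f x) (h x)) (2 * K * L) where
  nonneg := mul_nonneg (mul_nonneg zero_le_two hf.nonneg) hh.nonneg
  norm_le x hx := by
    have h1 := mul_le_mul (hf.norm_le x hx) (hh.norm_le x hx) (norm_nonneg _) hf.nonneg
    have h2 := mul_nonneg hf.nonneg hh.nonneg
    linarith [hB (f x) (h x)]
  norm_sub_le x hx y hy := by
    -- Changing one factor at a time gives two terms, each at most K L dist x y; hence the factor 2.
    have e : B (f x) (h x) - B (f y) (h y) = B (f x) (h x - h y) + B (f x - f y) (h y) := by
      rw [hl, hr]; abel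
    rw [e]
    have h1 := mul_le_mul (hf.norm_le x hx) (hh.norm_sub_le x hx y hy) (norm_nonneg _) hf.nonneg
    have h2 := mul_le_mul (hf.norm_sub_le x hx y hy) (hh.norm_le y hy) (norm_nonneg _)
      (mul_nonneg hf.nonneg dist_nonneg)
    have h3 := norm_add_le (B (f x) (h x - h y)) (B (f x - f y) (h y))
    nlinarith [hB (f x) (h x - h y), hB (f x - f y) (h y)]

theorem smul [NormedSpace ℝ E] {c : X → ℝ} (hc : BddLip s c K) (hf : BddLip s f L) :
    BddLip s (fun x => c x • f x) (2 * K * L) :=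
  bilin (B := fun (c : ℝ) (v : E) => c • v) (fun u v => (norm_smul u v).le)
    (fun _ _ _ => sub_smul _ _ _) (fun _ _ _ => smul_sub _ _ _) hc hf

theorem clm_apply [NormedSpace ℝ E] [NormedSpace ℝ F] {T : X → E →L[ℝ] F} (hT : BddLip s T K)
    (hf : BddLip s f L) : BddLip s (fun x => T x (f x)) (2 * K * L) :=
  bilin (B := fun (T : E →L[ℝ] F) (v : E) => T v) (fun u v => u.le_opNorm v)
    (fun _ _ _ => rfl) (fun _ _ _ => map_sub _ _ _) hT hf

/-- The factor 1 + L serves both requirements at once: it dominates 1 for the bound and L for the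
Lipschitz estimate. -/
theorem comp {φ : Y → X} {t : Set Y} (hf : BddLip s f K) (hφ : Set.MapsTo φ t s) (hL : 0 ≤ L)
    (h : ∀ x ∈ t, ∀ y ∈ t, dist (φ x) (φ y) ≤ L * dist x y) :
    BddLip t (fun y => f (φ y)) (K * (1 + L)) where
  nonneg := mul_nonneg hf.nonneg (by linarith)
  norm_le x hx := by
    nlinarith [hf.norm_le _ (hφ hx), mul_nonneg hf.nonneg hL]
  norm_sub_le x hx y hy := by
    have h1 := hf.norm_sub_le _ (hφ hx) _ (hφ hy)
    have h2 := mul_le_mul_of_nonneg_left (h x hx y hy) hf.nonneg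
    nlinarith [mul_nonneg hf.nonneg (dist_nonneg (x := x) (y := y))]

theorem integral [NormedSpace ℝ E] {O : Type*} [MeasurableSpace O] {ν : Measure O}
    [IsProbabilityMeasure ν] {f : X → O → E} (hf : ∀ o, BddLip s (fun x => f x o) K)
    (hm : ∀ x ∈ s, AEStronglyMeasurable (f x) ν) : BddLip s (fun x => ∫ o, f x o ∂ν) K where
  nonneg := by
    obtain ⟨o⟩ := nonempty_of_isProbabilityMeasure ν
    exact (hf o).nonneg
  norm_le x hx := by
    simpa using norm_integral_le_of_norm_le_const (μ := ν) (f := f x)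
      (Filter.Eventually.of_forall fun o => (hf o).norm_le x hx)
  norm_sub_le x hx y hy := by
    have hi : ∀ z ∈ s, Integrable (f z) ν := fun z hz => Integrable.of_bound (hm z hz) K
      (Filter.Eventually.of_forall fun o => (hf o).norm_le z hz)
    rw [← integral_sub (hi x hx) (hi y hy)]
    simpa using norm_integral_le_of_norm_le_const (μ := ν) (f := fun o => f x o - f y o)
      (Filter.Eventually.of_forall fun o => (hf o).norm_sub_le x hx y hy)

theorem continuousOn (hf : BddLip s f K) : ContinuousOn f s := by
  have : LipschitzOnWith K.toNNReal f s := LipschitzOnWith.of_dist_le_mul fun x hx y hy => by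
    rw [dist_eq_norm, Real.coe_toNNReal _ hf.nonneg]; exact hf.norm_sub_le x hx y hy
  exact this.continuousOn

theorem inner [InnerProductSpace ℝ E] (hf : BddLip s f K) (hg : BddLip s g L) :
    BddLip s (fun x => ⟪f x, g x⟫) (2 * K * L) :=
  bilin (B := fun u v : E => ⟪u, v⟫) (fun u v => norm_inner_le_norm u v)
    (fun _ _ _ => inner_sub_left _ _ _) (fun _ _ _ => inner_sub_right _ _ _) hf hg

theorem rankOne [InnerProductSpace ℝ E] (hf : BddLip s f K) (hg : BddLip s g L) :
    BddLip s (fun x => InnerProductSpace.rankOne ℝ (f x) (g x)) (2 * K * L) :=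
  bilin (B := fun u v : E => InnerProductSpace.rankOne ℝ u v)
    (fun u v => by rw [InnerProductSpace.norm_rankOne])
    (fun _ _ _ => by simp) (fun _ _ _ => by simp) hf hg

theorem adjoint [InnerProductSpace ℝ E] [CompleteSpace E] {T : X → E →L[ℝ] E}
    (hT : BddLip s T K) : BddLip s (fun x => ContinuousLinearMap.adjoint (T x)) K where
  nonneg := hT.nonneg
  norm_le x hx := by
    rw [LinearIsometryEquiv.norm_map]; exact hT.norm_le x hx
  norm_sub_le x hx y hy := by
    rw [← map_sub, LinearIsometryEquiv.norm_map]; exact hT.norm_sub_le x hx y hy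

end BddLip

/-! ### Quadratic approximation and projection onto a ball -/

/-- A function with `K`-Lipschitz derivative is approximated quadratically by its linearization. -/
theorem norm_sub_sub_fderiv_le {E F : Type*} [NormedAddCommGroup E] [NormedSpace ℝ E]
    [NormedAddCommGroup F] [NormedSpace ℝ F] {f : E → F} {f' : E → E →L[ℝ] F} {K : ℝ}
    (hf : ∀ x, HasFDerivAt f (f' x) x) (h : ∀ x y, ‖f' x - f' y‖ ≤ K * ‖x - y‖) (hK : 0 ≤ K)
    (x y : E) : ‖f y - f x - f' x (y - x)‖ ≤ K * ‖y - x‖ ^ 2 := by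
  -- Mean value inequality on the segment against the fixed linear map `f' x`: there the derivative
  -- deviates from it by at most K‖y - x‖. The sharp constant K/2 is not needed.
  have := (convex_segment x y).norm_image_sub_le_of_norm_hasFDerivWithin_le' (f := f) (f' := f')
    (φ := f' x) (C := K * ‖y - x‖) (fun z _ => (hf z).hasFDerivWithinAt)
    (fun z hz => (h z x).trans (mul_le_mul_of_nonneg_left (norm_sub_le_of_mem_segment hz) hK))
    (left_mem_segment ℝ x y) (right_mem_segment ℝ x y)
  rw [pow_two, ← mul_assoc]; exact this

/-- The projection onto a ball does not increase the distance to its points. -/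
theorem norm_projBall_sub_le {N : ℕ} {R : ℝ} (hR : 0 ≤ R) (v w : Param N) (hw : ‖w‖ ≤ R) :
    ‖projBall R v - w‖ ≤ ‖v - w‖ := by
  unfold projBall
  split_ifs with h
  · exact le_rfl
  · have hv : 0 < ‖v‖ := lt_of_le_of_lt hR (not_le.mp h)
    set c := R / ‖v‖ with hc
    have hc0 : 0 ≤ c := div_nonneg hR hv.le
    have hc1 : c ≤ 1 := (div_le_one hv).2 (not_le.mp h).le
    have hcv : c * ‖v‖ = R := div_mul_cancel₀ _ hv.ne'
    have hin : ⟪v, w⟫ ≤ ‖v‖ * R := (real_inner_le_norm v w).trans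
      (mul_le_mul_of_nonneg_left hw hv.le)
    refine (sq_le_sq₀ (norm_nonneg _) (norm_nonneg _)).1 ?_
    rw [norm_sub_sq_real, norm_sub_sq_real, norm_smul, real_inner_smul_left, Real.norm_of_nonneg hc0]
    -- This product is ‖v - w‖² - ‖c v - w‖²; its second factor is nonnegative because ⟨v, w⟩ ≤ ‖v‖R
    -- = c‖v‖².
    have : 0 ≤ (1 - c) * ((1 + c) * ‖v‖ ^ 2 - 2 * ⟪v, w⟫) := by
      refine mul_nonneg (by linarith) ?_
      have : ‖v‖ * R = c * ‖v‖ ^ 2 := by rw [← hcv]; ring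
      nlinarith [sq_nonneg ‖v‖]
    nlinarith

theorem continuous_projBall {N : ℕ} {R : ℝ} (hR : 0 ≤ R) :
    Continuous (projBall R : Param N → Param N) := by
  unfold projBall
  -- For R > 0 both branches agree with (R / max ‖v‖ R) v, which is visibly continuous. For R = 0
  -- that quotient breaks down, but the map is constantly 0.
  rcases hR.eq_or_lt with rfl | hR
  · have : (fun v : Param N => if ‖v‖ ≤ 0 then v else ((0 : ℝ) / ‖v‖) • v) = fun _ => 0 := by
      funext v
      split_ifs with h
      · simpa using h
      · simp
    rw [this]; exact continuous_const
  · have : (fun v : Param N => if ‖v‖ ≤ R then v else (R / ‖v‖) • v) =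
        fun v => (R / max ‖v‖ R) • v := by
      funext v
      split_ifs with h
      · rw [max_eq_right h, div_self hR.ne', one_smul]
      · rw [max_eq_left (not_le.mp h).le]
    rw [this]
    exact (continuous_const.div (continuous_norm.max continuous_const)
      fun v => (lt_max_of_lt_right hR).ne').smul continuous_id

/-! ### Total variation -/

section TV

variable {X : Type*} [MeasurableSpace X]

theorem abs_measureReal_sub_le_tvDist (μ ν : Measure X) [IsProbabilityMeasure μ]
    [IsProbabilityMeasure ν] {B : Set X} (hB : MeasurableSet B) :
    |μ.real B - ν.real B| ≤ tvDist μ ν := by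
  refine le_ciSup (f := fun B : {B : Set X // MeasurableSet B} => |μ.real B.1 - ν.real B.1|)
    ⟨1, ?_⟩ ⟨B, hB⟩
  rintro _ ⟨C, rfl⟩
  have h1 : μ.real C.1 ≤ 1 := measureReal_le_one
  have h2 : ν.real C.1 ≤ 1 := measureReal_le_one
  have h3 : 0 ≤ μ.real C.1 := measureReal_nonneg
  have h4 : 0 ≤ ν.real C.1 := measureReal_nonneg
  exact abs_le.2 ⟨by linarith, by linarith⟩

/-- Layer-cake formula, cut off at K because the superlevel sets above K are empty. -/
theorem integral_eq_intervalIntegral_measureReal {μ : Measure X} [IsProbabilityMeasure μ]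
    {f : X → ℝ} (hf : Measurable f) {K : ℝ} (h0 : ∀ x, 0 ≤ f x) (h1 : ∀ x, f x ≤ K) :
    ∫ x, f x ∂μ = ∫ t in Set.Ioc 0 K, μ.real {x | t < f x} := by
  have hi : Integrable f μ := Integrable.of_bound hf.aestronglyMeasurable K
    (Filter.Eventually.of_forall fun x => by rw [Real.norm_of_nonneg (h0 x)]; exact h1 x)
  rw [hi.integral_eq_integral_meas_lt (Filter.Eventually.of_forall h0)]
  refine setIntegral_eq_of_subset_of_forall_sdiff_eq_zero measurableSet_Ioi
    Set.Ioc_subset_Ioi_self fun t ht => ?_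
  have : K < t := by
    by_contra hc
    exact ht.2 ⟨ht.1, not_lt.1 hc⟩
  have : {x | t < f x} = ∅ := by
    ext x; simpa using (h1 x).trans this.le
  simp [this]

/-- Shift f by K to land in [0, 2K] and apply the layer-cake formula: the measures of each
superlevel set differ by at most the total-variation distance, and the levels fill an interval of
length 2K. -/
theorem abs_integral_sub_le_tvDist (μ ν : Measure X) [IsProbabilityMeasure μ]
    [IsProbabilityMeasure ν] {f : X → ℝ} (hf : Measurable f) {K : ℝ} (hK : ∀ x, |f x| ≤ K) :
    |∫ x, f x ∂μ - ∫ x, f x ∂ν| ≤ 2 * K * tvDist μ ν := by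
  obtain ⟨x₀⟩ := nonempty_of_isProbabilityMeasure μ
  have hK0 : 0 ≤ K := (abs_nonneg _).trans (hK x₀)
  have hi : ∀ (ξ : Measure X) [IsProbabilityMeasure ξ], Integrable f ξ := fun ξ _ =>
    Integrable.of_bound hf.aestronglyMeasurable K (Filter.Eventually.of_forall hK)
  have hg : ∀ (ξ : Measure X) [IsProbabilityMeasure ξ],
      ∫ x, f x ∂ξ = (∫ t in Set.Ioc 0 (2 * K), ξ.real {x | t < f x + K}) - K := by
    intro ξ _
    rw [← integral_eq_intervalIntegral_measureReal (hf.add_const K)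
      (fun x => by linarith [(abs_le.1 (hK x)).1]) (fun x => by linarith [(abs_le.1 (hK x)).2]),
      integral_add (hi ξ) (integrable_const K)]
    simp
  have hm : ∀ (ξ : Measure X) [IsProbabilityMeasure ξ],
      IntegrableOn (fun t => ξ.real {x | t < f x + K}) (Set.Ioc 0 (2 * K)) := by
    intro ξ _
    have ha : Antitone fun t : ℝ => ξ.real {x | t < f x + K} := fun s t hst =>
      measureReal_mono fun x (hx : t < _) => hst.trans_lt hx
    refine Measure.integrableOn_of_bounded (M := 1) measure_Ioc_lt_top.ne ha.measurable.aestronglyMeasurable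
      (Filter.Eventually.of_forall fun t => ?_)
    rw [Real.norm_of_nonneg measureReal_nonneg]; exact measureReal_le_one
  rw [hg μ, hg ν, sub_sub_sub_cancel_right, ← integral_sub (hm μ) (hm ν)]
  have := norm_setIntegral_le_of_norm_le_const (μ := volume) (s := Set.Ioc 0 (2 * K))
    (f := fun t => μ.real {x | t < f x + K} - ν.real {x | t < f x + K}) (C := tvDist μ ν)
    measure_Ioc_lt_top (fun t _ => abs_measureReal_sub_le_tvDist μ ν
      (measurableSet_lt measurable_const (hf.add_const K)))
  rw [Real.norm_eq_abs, Measure.real, Real.volume_Ioc, sub_zero,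
    ENNReal.toReal_ofReal (by linarith)] at this
  linarith

end TV

/-! ### The constants of the problem -/

namespace Bounds

variable (b : Bounds)

/-- A bound for the TD error. -/
def tdBound : ℝ := b.rMax + 2 * b.Cv

/-- A number that dominates all the constants of the problem. -/
def M : ℝ :=
  1 + 1 / b.lamv + b.ρMax * b.tdBound + b.ρMax + b.Cφ + b.Dv + b.LV +
    b.ρMax * b.Cφ / b.lamv * b.tdBound

theorem M_bounds : 1 ≤ b.M ∧ 1 / b.lamv ≤ b.M ∧ b.ρMax * b.tdBound ≤ b.M ∧ b.ρMax ≤ b.M ∧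
    b.Cφ ≤ b.M ∧ b.Dv ≤ b.M ∧ b.LV ≤ b.M ∧ b.ρMax * b.Cφ / b.lamv * b.tdBound ≤ b.M ∧
    0 ≤ b.tdBound := by
  have h1 := b.rMax_nonneg
  have h2 := b.ρMax_pos
  have h3 := b.Cv_pos
  have h4 := b.Cφ_pos
  have h5 := b.Dv_pos
  have h6 := b.LV_pos
  have h7 := b.lamv_pos
  have h0 : 0 ≤ b.tdBound := by unfold tdBound; positivity
  have ha : 0 ≤ 1 / b.lamv := by positivity
  have hb : 0 ≤ b.ρMax * b.tdBound := by positivity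
  have hc : 0 ≤ b.ρMax * b.Cφ / b.lamv * b.tdBound := by positivity
  refine ⟨?_, ?_, ?_, ?_, ?_, ?_, ?_, ?_, h0⟩ <;> unfold M <;> linarith

theorem one_le_M : 1 ≤ b.M := b.M_bounds.1

theorem M_pos : 0 < b.M := zero_lt_one.trans_le b.one_le_M

/-- A common bound and Lipschitz constant for `fastDir`, `slowDir` and `fastDeriv`. -/
def K : ℝ := 100 * b.M ^ 6

/-- The region of pairs `(θ, ω)` with `‖ω‖ ≤ M`. -/
def region (N : ℕ) : Set (Param N × Param N) := {x | ‖x.2‖ ≤ b.M}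

theorem bddLip_snd (N : ℕ) :
    BddLip (b.region N) (fun x => x.2) b.M where
  nonneg := b.M_pos.le
  norm_le x hx := hx
  norm_sub_le x _ y _ := by
    refine le_trans ?_ (le_mul_of_one_le_left dist_nonneg b.one_le_M)
    rw [← dist_eq_norm, Prod.dist_eq]; exact le_max_right _ _

/-- As M ≥ 1, every polynomial in M that the calculus of `BddLip` produces can be raised to the
degree of `K` and compared by coefficients alone. -/
theorem pow_M_le {k l : ℕ} (h : k ≤ l) :
    b.M ^ k ≤ b.M ^ l := pow_le_pow_right₀ b.one_le_M h

end Bounds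

namespace Problem

variable {S A : Type*} [MeasurableSpace S] [MeasurableSpace A] {N : ℕ} {p : Problem S A N}
  {b : Bounds}

theorem radius_nonneg (p : Problem S A N) (b : Bounds) : 0 ≤ p.radius b := by
  have h1 := b.rMax_nonneg
  have h2 := b.ρMax_pos
  have h3 := b.Cv_pos
  have h4 := b.Cφ_pos
  have h7 := b.lamv_pos
  have h8 := p.γ_nonneg
  unfold radius; positivity

theorem radius_le_M (p : Problem S A N) (b : Bounds) : p.radius b ≤ b.M := by
  have h2 := b.ρMax_pos
  have h4 := b.Cφ_pos
  have h7 := b.lamv_pos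
  refine le_trans ?_ b.M_bounds.2.2.2.2.2.2.2.1
  unfold radius Bounds.tdBound
  gcongr
  · exact b.Cv_pos.le
  · linarith [p.γ_le_one]

theorem norm_γ_le (p : Problem S A N) (b : Bounds) : ‖p.γ‖ ≤ b.M := by
  rw [Real.norm_of_nonneg p.γ_nonneg]; exact p.γ_le_one.trans b.one_le_M

/-! ### Derivatives of the value functions -/

namespace Assumptions

variable (hp : p.Assumptions b)
include hp

theorem hasFDerivAt_V (θ : Param N) (s : S) :
    HasFDerivAt (fun θ => p.V θ s) (innerSL ℝ (p.feature θ s)) θ :=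
  (((hp.smooth s).differentiable (by norm_num)) θ).hasGradientAt.hasFDerivAt

theorem contDiff_feature (s : S) : ContDiff ℝ 1 fun θ => p.feature θ s := by
  have : ContDiff ℝ 1 (fderiv ℝ fun θ => p.V θ s) :=
    (hp.smooth s).fderiv_right (by norm_num)
  exact (InnerProductSpace.toDual ℝ (Param N)).symm.toContinuousLinearEquiv.contDiff.comp this

theorem hasFDerivAt_feature (θ : Param N) (s : S) :
    HasFDerivAt (fun θ => p.feature θ s) (p.hess θ s) θ :=
  ((hp.contDiff_feature s).differentiable (by norm_num) θ).hasFDerivAt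

/-- V is C², so its second derivative is symmetric; the Riesz isomorphism carries this over to the
derivative of the gradient. -/
theorem inner_hess_left (θ : Param N) (s : S) (u v : Param N) :
    ⟪p.hess θ s u, v⟫ = ⟪u, p.hess θ s v⟫ := by
  have hd : Differentiable ℝ (fderiv ℝ fun θ => p.V θ s) :=
    ((hp.smooth s).fderiv_right (m := 1) (by norm_num)).differentiable (by norm_num)
  have key : ∀ u v, ⟪p.hess θ s u, v⟫ = fderiv ℝ (fderiv ℝ fun θ => p.V θ s) θ u v := by
    intro u v
    have h : HasFDerivAt (fun θ => p.feature θ s) _ θ :=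
      ((InnerProductSpace.toDual ℝ (Param N)).symm.toContinuousLinearEquiv.hasFDerivAt).comp θ
        (hd θ).hasFDerivAt
    rw [(hp.hasFDerivAt_feature θ s).unique h]
    exact InnerProductSpace.toDual_symm_apply
  have hs : IsSymmSndFDerivAt ℝ (fun θ => p.V θ s) θ :=
    (hp.smooth s).contDiffAt.isSymmSndFDerivAt (by simp)
  rw [real_inner_comm (p.hess θ s v) u, key, key, hs.eq]

theorem norm_feature_le (θ : Param N) (s : S) : ‖p.feature θ s‖ ≤ b.M :=
  (hp.feature_le θ s).trans b.M_bounds.2.2.2.2.1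

theorem norm_hess_le (θ : Param N) (s : S) : ‖p.hess θ s‖ ≤ b.M :=
  (hp.hess_le θ s).trans b.M_bounds.2.2.2.2.2.1

theorem norm_hess_sub_le (θ η : Param N) (s : S) :
    ‖p.hess θ s - p.hess η s‖ ≤ b.M * ‖θ - η‖ :=
  (hp.hess_lipschitz θ η s).trans
    (mul_le_mul_of_nonneg_right b.M_bounds.2.2.2.2.2.2.1 (norm_nonneg _))

theorem ρ_le (s : S) (a : A) : p.ρ s a ≤ b.M := (hp.ratio_le s a).trans b.M_bounds.2.2.2.1

theorem norm_feature_sub_le (θ η : Param N) (s : S) :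
    ‖p.feature θ s - p.feature η s‖ ≤ b.M * ‖θ - η‖ :=
  convex_univ.norm_image_sub_le_of_norm_hasFDerivWithin_le
    (fun x _ => (hp.hasFDerivAt_feature x s).hasFDerivWithinAt) (fun x _ => hp.norm_hess_le x s)
    (Set.mem_univ η) (Set.mem_univ θ)

theorem abs_V_sub_le (θ η : Param N) (s : S) : |p.V θ s - p.V η s| ≤ b.M * ‖θ - η‖ :=
  convex_univ.norm_image_sub_le_of_norm_hasFDerivWithin_le
    (fun x _ => (hp.hasFDerivAt_V x s).hasFDerivWithinAt)
    (fun x _ => by rw [innerSL_apply_norm]; exact hp.norm_feature_le x s)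
    (Set.mem_univ η) (Set.mem_univ θ)

theorem norm_feature_expansion (θ η : Param N) (s : S) :
    ‖p.feature η s - p.feature θ s - p.hess θ s (η - θ)‖ ≤ b.M * ‖η - θ‖ ^ 2 :=
  norm_sub_sub_fderiv_le (fun x => hp.hasFDerivAt_feature x s)
    (fun x y => hp.norm_hess_sub_le x y s) b.M_pos.le θ η

theorem abs_V_expansion (θ η : Param N) (s : S) :
    |p.V η s - p.V θ s - ⟪p.feature θ s, η - θ⟫| ≤ b.M * ‖η - θ‖ ^ 2 :=
  norm_sub_sub_fderiv_le (fun x => hp.hasFDerivAt_V x s)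
    (fun x y => by rw [← map_sub, innerSL_apply_norm]; exact hp.norm_feature_sub_le x y s)
    b.M_pos.le θ η

/-- The factor 1 + γ is kept here, rather than rounded up to 2, because it appears in `radius`, and
ω* has to lie in exactly that ball. -/
theorem abs_tdError_le' (θ : Param N) (o : S × A × S) :
    |p.tdError θ o| ≤ b.rMax + (1 + p.γ) * b.Cv := by
  have h1 := hp.reward_nonneg o.1 o.2.1 o.2.2
  have h2 := hp.reward_le o.1 o.2.1 o.2.2
  have h3 := abs_le.1 (hp.value_le θ o.1)
  have h4 := abs_le.1 (hp.value_le θ o.2.2)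
  have h5 := p.γ_nonneg
  unfold tdError
  rw [abs_le]
  constructor <;> nlinarith [b.Cv_pos]

theorem abs_tdError_le (θ : Param N) (o : S × A × S) : |p.tdError θ o| ≤ b.tdBound := by
  refine (hp.abs_tdError_le' θ o).trans ?_
  unfold Bounds.tdBound
  nlinarith [b.Cv_pos, p.γ_le_one]

theorem abs_ratio_mul_tdError_le (θ : Param N) (o : S × A × S) :
    |p.ρ o.1 o.2.1 * p.tdError θ o| ≤ b.M := by
  rw [abs_mul, abs_of_nonneg (p.ρ_nonneg _ _)]
  exact (mul_le_mul (hp.ratio_le _ _) (hp.abs_tdError_le θ o) (abs_nonneg _) b.ρMax_pos.le).trans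
    b.M_bounds.2.2.1

theorem abs_ratio_mul_tdError_sub_le (θ η : Param N) (o : S × A × S) :
    |p.ρ o.1 o.2.1 * p.tdError θ o - p.ρ o.1 o.2.1 * p.tdError η o| ≤
      2 * b.M ^ 2 * ‖θ - η‖ := by
  rw [← mul_sub, abs_mul, abs_of_nonneg (p.ρ_nonneg _ _)]
  have h1 := hp.abs_V_sub_le θ η o.1
  have h2 := hp.abs_V_sub_le θ η o.2.2
  have h3 : |p.tdError θ o - p.tdError η o| ≤ 2 * (b.M * ‖θ - η‖) := by
    rw [abs_le] at *
    have h5 := p.γ_nonneg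
    have h6 := p.γ_le_one
    have h7 : 0 ≤ b.M * ‖θ - η‖ := mul_nonneg b.M_pos.le (norm_nonneg _)
    unfold tdError
    constructor <;> nlinarith
  have := mul_le_mul (hp.ρ_le o.1 o.2.1) h3 (abs_nonneg _) b.M_pos.le
  nlinarith

/-! ### The directions of the updates are bounded and Lipschitz -/

theorem bddLip_feature (s : S) :
    BddLip (b.region N) (fun x => p.feature x.1 s) b.M where
  nonneg := b.M_pos.le
  norm_le x _ := hp.norm_feature_le x.1 s
  norm_sub_le x _ y _ := (hp.norm_feature_sub_le x.1 y.1 s).trans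
    (mul_le_mul_of_nonneg_left (by rw [← dist_eq_norm, Prod.dist_eq]; exact le_max_left _ _)
      b.M_pos.le)

theorem bddLip_hess (s : S) : BddLip (b.region N) (fun x => p.hess x.1 s) b.M where
  nonneg := b.M_pos.le
  norm_le x _ := hp.norm_hess_le x.1 s
  norm_sub_le x _ y _ := (hp.norm_hess_sub_le x.1 y.1 s).trans
    (mul_le_mul_of_nonneg_left (by rw [← dist_eq_norm, Prod.dist_eq]; exact le_max_left _ _)
      b.M_pos.le)

theorem bddLip_ratio_mul_tdError (o : S × A × S) :
    BddLip (b.region N) (fun x => p.ρ o.1 o.2.1 * p.tdError x.1 o) (2 * b.M ^ 2) where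
  nonneg := by positivity
  norm_le x _ := (hp.abs_ratio_mul_tdError_le x.1 o).trans (by nlinarith [b.one_le_M])
  norm_sub_le x _ y _ := (hp.abs_ratio_mul_tdError_sub_le x.1 y.1 o).trans
    (mul_le_mul_of_nonneg_left (by rw [← dist_eq_norm, Prod.dist_eq]; exact le_max_left _ _)
      (by positivity))

end Assumptions

/-! ### The residual and the linearization of the fast direction -/

/-- The residual `ρ δ(θ) - φᵀ ω`. -/
def resid (p : Problem S A N) (θ ω : Param N) (o : S × A × S) : ℝ :=
  p.ρ o.1 o.2.1 * p.tdError θ o - ⟪p.feature θ o.1, ω⟫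

theorem fastDir_eq (θ ω : Param N) (o : S × A × S) :
    p.fastDir θ ω o = p.resid θ ω o • p.feature θ o.1 := by
  unfold fastDir resid
  rw [sub_smul]; abel

theorem slowDir_eq (θ ω : Param N) (o : S × A × S) :
    p.slowDir θ ω o = (p.ρ o.1 o.2.1 * p.tdError θ o) • p.feature θ o.1 -
      (p.γ * p.ρ o.1 o.2.1) • (⟪p.feature θ o.1, ω⟫ • p.feature θ o.2.2) -
        p.resid θ ω o • p.hess θ o.1 ω := by
  unfold slowDir hTerm resid
  rw [smul_smul]

/-- The gradient in `θ` of the residual. -/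
def residGrad (p : Problem S A N) (θ ω : Param N) (o : S × A × S) : Param N :=
  p.ρ o.1 o.2.1 • (p.γ • p.feature θ o.2.2 - p.feature θ o.1) - p.hess θ o.1 ω

/-- The derivative in `θ` of the direction of the fast update. -/
def fastDeriv (p : Problem S A N) (θ ω : Param N) (o : S × A × S) : Param N →L[ℝ] Param N :=
  InnerProductSpace.rankOne ℝ (p.feature θ o.1) (p.residGrad θ ω o) +
    p.resid θ ω o • p.hess θ o.1

theorem fastDeriv_apply (θ ω : Param N) (o : S × A × S) (v : Param N) :
    p.fastDeriv θ ω o v =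
      ⟪p.residGrad θ ω o, v⟫ • p.feature θ o.1 + p.resid θ ω o • p.hess θ o.1 v := by
  simp [fastDeriv]

namespace Assumptions

variable (hp : p.Assumptions b)
include hp

theorem bddLip_resid (o : S × A × S) :
    BddLip (b.region N) (fun x => p.resid x.1 x.2 o) (2 * b.M ^ 2 + 2 * b.M * b.M) :=
  (hp.bddLip_ratio_mul_tdError o).sub ((hp.bddLip_feature o.1).inner (b.bddLip_snd N))

theorem bddLip_fastDir (o : S × A × S) :
    BddLip (b.region N) (fun x => p.fastDir x.1 x.2 o) b.K := by
  simp_rw [fastDir_eq]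
  refine ((hp.bddLip_resid o).smul (hp.bddLip_feature o.1)).mono ?_
  have := b.pow_M_le (show 3 ≤ 6 by norm_num)
  have := pow_pos b.M_pos 6
  unfold Bounds.K; nlinarith

theorem norm_γ_mul_ρ_le (o : S × A × S) : ‖p.γ * p.ρ o.1 o.2.1‖ ≤ b.M := by
  rw [Real.norm_of_nonneg (mul_nonneg p.γ_nonneg (p.ρ_nonneg _ _))]
  nlinarith [hp.ρ_le o.1 o.2.1, p.γ_nonneg, p.γ_le_one, p.ρ_nonneg o.1 o.2.1]

theorem bddLip_slowDir (o : S × A × S) :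
    BddLip (b.region N) (fun x => p.slowDir x.1 x.2 o) b.K := by
  simp_rw [slowDir_eq]
  refine ((((hp.bddLip_ratio_mul_tdError o).smul (hp.bddLip_feature o.1)).sub
    ((BddLip.const _ (hp.norm_γ_mul_ρ_le o)).smul
      (((hp.bddLip_feature o.1).inner (b.bddLip_snd N)).smul (hp.bddLip_feature o.2.2)))).sub
    ((hp.bddLip_resid o).smul ((hp.bddLip_hess o.1).clm_apply (b.bddLip_snd N)))).mono ?_
  have := b.pow_M_le (show 3 ≤ 6 by norm_num)
  have := b.pow_M_le (show 4 ≤ 6 by norm_num)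
  have := pow_pos b.M_pos 6
  unfold Bounds.K; nlinarith

theorem norm_ρ_le (o : S × A × S) : ‖p.ρ o.1 o.2.1‖ ≤ b.M := by
  rw [Real.norm_of_nonneg (p.ρ_nonneg _ _)]; exact hp.ρ_le _ _

theorem bddLip_residGrad (o : S × A × S) :
    BddLip (b.region N) (fun x => p.residGrad x.1 x.2 o) (8 * b.M ^ 3) := by
  unfold residGrad
  refine (((BddLip.const _ (hp.norm_ρ_le o)).smul
    (((BddLip.const _ (norm_γ_le p b)).smul (hp.bddLip_feature o.2.2)).sub
      (hp.bddLip_feature o.1))).sub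
    ((hp.bddLip_hess o.1).clm_apply (b.bddLip_snd N))).mono ?_
  have := b.pow_M_le (show 2 ≤ 3 by norm_num)
  nlinarith

theorem bddLip_fastDeriv (o : S × A × S) :
    BddLip (b.region N) (fun x => p.fastDeriv x.1 x.2 o) b.K := by
  unfold fastDeriv
  refine (((hp.bddLip_feature o.1).rankOne (hp.bddLip_residGrad o)).add
    ((hp.bddLip_resid o).smul (hp.bddLip_hess o.1))).mono ?_
  have := b.pow_M_le (show 3 ≤ 6 by norm_num)
  have := b.pow_M_le (show 4 ≤ 6 by norm_num)
  have := pow_pos b.M_pos 6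
  unfold Bounds.K; nlinarith

/-- The residual is an affine combination of V_θ(s'), V_θ(s) and ⟨φ_θ(s), ω⟩, so its remainder is
the same combination of three Taylor remainders. Symmetry of the Hessian turns ⟨∇²V d, ω⟩ into ⟨∇²V
ω, d⟩, the form used in `residGrad`. The factors ρ ≤ M, γ ≤ 1 and ‖ω‖ ≤ M give 3M². -/
theorem abs_resid_expansion (θ η ω : Param N) (hω : ‖ω‖ ≤ b.M) (o : S × A × S) :
    |p.resid η ω o - p.resid θ ω o - ⟪p.residGrad θ ω o, η - θ⟫| ≤ 3 * b.M ^ 2 * ‖η - θ‖ ^ 2 := by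
  have h1 := hp.abs_V_expansion θ η o.1
  have h2 := hp.abs_V_expansion θ η o.2.2
  have h3 := hp.norm_feature_expansion θ η o.1
  set d := η - θ
  have e : p.resid η ω o - p.resid θ ω o - ⟪p.residGrad θ ω o, d⟫ =
      p.ρ o.1 o.2.1 * (p.γ * (p.V η o.2.2 - p.V θ o.2.2 - ⟪p.feature θ o.2.2, d⟫) -
        (p.V η o.1 - p.V θ o.1 - ⟪p.feature θ o.1, d⟫)) -
      ⟪p.feature η o.1 - p.feature θ o.1 - p.hess θ o.1 d, ω⟫ := by
    unfold resid residGrad tdError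
    simp only [inner_sub_left, real_inner_smul_left, hp.inner_hess_left θ o.1 ω]
    rw [real_inner_comm ω (p.hess θ o.1 d)]
    ring
  rw [e]
  set x := p.V η o.2.2 - p.V θ o.2.2 - ⟪p.feature θ o.2.2, d⟫
  set y := p.V η o.1 - p.V θ o.1 - ⟪p.feature θ o.1, d⟫
  set w := p.feature η o.1 - p.feature θ o.1 - p.hess θ o.1 d
  have hw : |⟪w, ω⟫| ≤ b.M * ‖d‖ ^ 2 * b.M :=
    (abs_real_inner_le_norm _ _).trans (mul_le_mul h3 hω (norm_nonneg _)
      (mul_nonneg b.M_pos.le (sq_nonneg _)))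
  have hxy : |p.γ * x - y| ≤ 2 * (b.M * ‖d‖ ^ 2) := by
    have h5 := p.γ_nonneg
    have h6 := p.γ_le_one
    have h7 : 0 ≤ b.M * ‖d‖ ^ 2 := mul_nonneg b.M_pos.le (sq_nonneg _)
    rw [abs_le] at *
    constructor <;> nlinarith
  have hr : |p.ρ o.1 o.2.1 * (p.γ * x - y)| ≤ b.M * (2 * (b.M * ‖d‖ ^ 2)) := by
    rw [abs_mul]
    exact mul_le_mul (hp.norm_ρ_le o) hxy (abs_nonneg _) b.M_pos.le
  have := abs_sub (p.ρ o.1 o.2.1 * (p.γ * x - y)) ⟪w, ω⟫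
  nlinarith

theorem norm_fastDir_expansion (θ η ω : Param N) (hω : ‖ω‖ ≤ b.M) (o : S × A × S) :
    ‖p.fastDir η ω o - p.fastDir θ ω o - p.fastDeriv θ ω o (η - θ)‖ ≤ b.K * ‖η - θ‖ ^ 2 := by
  have h1 := hp.abs_resid_expansion θ η ω hω o
  have h2 := hp.norm_feature_expansion θ η o.1
  have h3 := hp.norm_feature_sub_le η θ o.1
  have h4 := (hp.bddLip_resid o).norm_sub_le (η, ω) hω (θ, ω) hω
  have h5 := (hp.bddLip_resid o).norm_le (θ, ω) hω
  have h6 := hp.norm_feature_le θ o.1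
  have hdist : dist (η, ω) (θ, ω) = ‖η - θ‖ := by
    rw [Prod.dist_eq, dist_self, dist_eq_norm, max_eq_left (norm_nonneg _)]
  rw [hdist] at h4
  rw [fastDir_eq, fastDir_eq, fastDeriv_apply]
  set d := η - θ
  -- Product rule with remainder: a product of two increments, and each factor times the Taylor
  -- remainder of the other.
  have e : p.resid η ω o • p.feature η o.1 - p.resid θ ω o • p.feature θ o.1 -
      (⟪p.residGrad θ ω o, d⟫ • p.feature θ o.1 + p.resid θ ω o • p.hess θ o.1 d) =
      (p.resid η ω o - p.resid θ ω o) • (p.feature η o.1 - p.feature θ o.1) +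
      p.resid θ ω o • (p.feature η o.1 - p.feature θ o.1 - p.hess θ o.1 d) +
      (p.resid η ω o - p.resid θ ω o - ⟪p.residGrad θ ω o, d⟫) • p.feature θ o.1 := by
    module
  rw [e]
  have hM := b.M_pos
  have g1 : ‖(p.resid η ω o - p.resid θ ω o) • (p.feature η o.1 - p.feature θ o.1)‖ ≤
      (2 * b.M ^ 2 + 2 * b.M * b.M) * ‖d‖ * (b.M * ‖d‖) := by
    rw [norm_smul]; exact mul_le_mul h4 h3 (norm_nonneg _) (by positivity)
  have g2 : ‖p.resid θ ω o • (p.feature η o.1 - p.feature θ o.1 - p.hess θ o.1 d)‖ ≤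
      (2 * b.M ^ 2 + 2 * b.M * b.M) * (b.M * ‖d‖ ^ 2) := by
    rw [norm_smul]; exact mul_le_mul h5 h2 (norm_nonneg _) (by positivity)
  have g3 : ‖(p.resid η ω o - p.resid θ ω o - ⟪p.residGrad θ ω o, d⟫) • p.feature θ o.1‖ ≤
      3 * b.M ^ 2 * ‖d‖ ^ 2 * b.M := by
    rw [norm_smul]; exact mul_le_mul h1 h6 (norm_nonneg _) (by positivity)
  refine (norm_add₃_le.trans (add_le_add (add_le_add g1 g2) g3)).trans ?_
  have h36 := b.pow_M_le (show 3 ≤ 6 by norm_num)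
  -- The three terms contribute 4M³, 4M³ and 3M³.
  have : 11 * b.M ^ 3 ≤ b.K := by unfold Bounds.K; linarith [pow_pos hM 6]
  calc _ = 11 * b.M ^ 3 * ‖d‖ ^ 2 := by ring
    _ ≤ _ := mul_le_mul_of_nonneg_right this (sq_nonneg _)

end Assumptions

/-- The pointwise identity behind the formula for `∇ J`. -/
theorem inner_fastDeriv_add_inner_slowDir (hp : p.Assumptions b) (θ ω : Param N) (o : S × A × S)
    (v : Param N) :
    ⟪p.fastDeriv θ ω o v + p.fastDeriv θ 0 o v, ω⟫ + 2 * ⟪p.slowDir θ ω o, v⟫ =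
      2 * (p.ρ o.1 o.2.1 * p.tdError θ o * ⟪p.feature θ o.1, v⟫ -
        p.ρ o.1 o.2.1 * (⟪p.feature θ o.1, ω⟫ * ⟪p.feature θ o.1, v⟫)) := by
  -- `fastDeriv` at ω differentiates ρδφ - φφᵀω and at 0 it differentiates ρδφ. Their sum paired
  -- with ω is therefore the θ-derivative of 2⟨ρδφ, ω⟩ - ⟨φφᵀω, ω⟩. The Hessian terms and those with
  -- φ(s') cancel against the slow direction, by symmetry of the Hessian.
  rw [slowDir_eq, fastDeriv_apply, fastDeriv_apply]
  unfold resid residGrad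
  simp only [inner_add_left, inner_sub_left, real_inner_smul_left, inner_zero_right, map_zero,
    inner_zero_left, hp.inner_hess_left θ o.1 ω, hp.inner_hess_left θ o.1 v]
  rw [real_inner_comm (p.hess θ o.1 v) ω]
  rw [← hp.inner_hess_left θ o.1 v ω, real_inner_comm ω (p.hess θ o.1 v)]
  ring

end Problem

/-! ### Measurability of vectors and operators, and a spectral bound -/

/-- An operator is the finite sum of the rank-one operators built from its values on an orthonormal
basis, and each of these depends continuously on the value. -/
theorem measurable_clm_of_apply {N : ℕ} {X : Type*} [MeasurableSpace X]
    {T : X → Param N →L[ℝ] Param N} (h : ∀ v, Measurable fun x => T x v) : Measurable T := by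
  have e : T = fun x => ∑ i, InnerProductSpace.rankOne ℝ (T x (EuclideanSpace.basisFun (Fin N) ℝ i))
      (EuclideanSpace.basisFun (Fin N) ℝ i) := by
    funext x
    ext1 v
    rw [sum_apply]
    simp only [InnerProductSpace.rankOne_apply]
    conv_lhs => rw [← (EuclideanSpace.basisFun (Fin N) ℝ).sum_repr' v]
    simp only [map_sum, map_smul]
  rw [e]
  refine Finset.measurable_fun_sum _ fun i _ => ?_
  have hc : Continuous fun u : Param N =>
      InnerProductSpace.rankOne ℝ u (EuclideanSpace.basisFun (Fin N) ℝ i) := by fun_prop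
  exact hc.measurable.comp (h _)

theorem measurable_of_inner {N : ℕ} {X : Type*} [MeasurableSpace X]
    {f : X → Param N} (h : ∀ v, Measurable fun x => ⟪f x, v⟫) : Measurable f := by
  have e : f = fun x => ∑ i, ⟪f x, EuclideanSpace.basisFun (Fin N) ℝ i⟫ •
      EuclideanSpace.basisFun (Fin N) ℝ i := by
    funext x
    conv_lhs => rw [← (EuclideanSpace.basisFun (Fin N) ℝ).sum_repr' (f x)]
    simp only [real_inner_comm]
  rw [e]
  exact Finset.measurable_fun_sum _ fun i _ => (h _).smul_const _

/-- A symmetric operator whose eigenvalues are at least `l` is bounded below by `l`. -/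
theorem le_inner_of_eigenvalue_le {E : Type*} [NormedAddCommGroup E] [InnerProductSpace ℝ E]
    [FiniteDimensional ℝ E] {T : E →L[ℝ] E} (hs : ∀ x y, ⟪T x, y⟫ = ⟪x, T y⟫)
    (h0 : ∀ x, 0 ≤ ⟪T x, x⟫) {l : ℝ}
    (hl : ∀ μ : ℝ, Module.End.HasEigenvalue (T : E →ₗ[ℝ] E) μ → l ≤ μ) (x : E) :
    l * ‖x‖ ^ 2 ≤ ⟪T x, x⟫ := by
  rcases eq_or_ne x 0 with rfl | hx
  · simp
  have : Nontrivial E := ⟨x, 0, hx⟩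
  have hsym : (T : E →ₗ[ℝ] E).IsSymmetric := hs
  -- The infimum of the Rayleigh quotient is itself an eigenvalue. Positivity of T bounds the
  -- quotients below, so that the real infimum lies under each of them.
  have h1 := hl _ hsym.hasEigenvalue_iInf_of_finiteDimensional
  have h2 : (⨅ x : {x : E // x ≠ 0}, RCLike.re ⟪(T : E →ₗ[ℝ] E) x, x⟫ / ‖(x : E)‖ ^ 2) ≤
      ⟪T x, x⟫ / ‖x‖ ^ 2 := by
    refine ciInf_le (f := fun x : {x : E // x ≠ 0} =>
      RCLike.re ⟪(T : E →ₗ[ℝ] E) x, x⟫ / ‖(x : E)‖ ^ 2) ⟨0, ?_⟩ ⟨x, hx⟩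
    rintro _ ⟨y, rfl⟩
    exact div_nonneg (h0 y) (sq_nonneg _)
  have hx' : 0 < ‖x‖ ^ 2 := by positivity
  exact (le_div_iff₀ hx').1 (h1.trans h2)

theorem inner_integral_left {X E : Type*} [MeasurableSpace X] {ν : Measure X}
    [NormedAddCommGroup E] [InnerProductSpace ℝ E] [CompleteSpace E] {f : X → E}
    (hf : Integrable f ν) (v : E) : ⟪∫ x, f x ∂ν, v⟫ = ∫ x, ⟪f x, v⟫ ∂ν := by
  rw [real_inner_comm, ← integral_inner hf]
  simp only [real_inner_comm]

theorem integrable_inner_left {X E : Type*} [MeasurableSpace X] {ν : Measure X}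
    [NormedAddCommGroup E] [InnerProductSpace ℝ E] {f : X → E}
    (hf : Integrable f ν) (v : E) : Integrable (fun x => ⟪f x, v⟫) ν := by
  simpa only [real_inner_comm] using hf.const_inner (𝕜 := ℝ) v

namespace Problem

variable {S A : Type*} [MeasurableSpace S] [MeasurableSpace A] {N : ℕ} {p : Problem S A N}
  {b : Bounds}

instance (p : Problem S A N) : IsMarkovKernel p.trans := p.markov_trans
instance (p : Problem S A N) : IsMarkovKernel p.target := p.markov_target
instance (p : Problem S A N) : IsMarkovKernel p.behavior := p.markov_behavior
instance (p : Problem S A N) : IsProbabilityMeasure p.μ := p.prob_μ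
instance (p : Problem S A N) : IsMarkovKernel p.stepKernel := by unfold stepKernel; infer_instance
instance (p : Problem S A N) : IsMarkovKernel p.stateKernel := by
  unfold stateKernel; infer_instance
instance (p : Problem S A N) : IsProbabilityMeasure p.sampleLaw := by
  unfold sampleLaw; infer_instance

/-! ### Measurability -/

theorem measurable_tdError (p : Problem S A N) (θ : Param N) : Measurable (p.tdError θ) := by
  unfold tdError
  have h1 := p.measurable_V θ
  have h2 := p.measurable_reward
  fun_prop

theorem measurable_ratio (p : Problem S A N) :
    Measurable fun o : S × A × S => p.ρ o.1 o.2.1 :=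
  p.measurable_ρ.comp (measurable_fst.prodMk (measurable_fst.comp measurable_snd))

theorem tendsto_norm_natCast : Filter.Tendsto (fun n : ℕ => ‖(n : ℝ)‖) Filter.atTop Filter.atTop := by
  simpa using tendsto_natCast_atTop_atTop (R := ℝ)

namespace Assumptions

variable (hp : p.Assumptions b)
include hp

/-- V is assumed measurable in s for each θ only. Its directional derivatives are limits of
difference quotients with step 1/n, hence again measurable; the Hessian is obtained from the
features in the same way. -/
theorem measurable_feature (θ : Param N) : Measurable (p.feature θ) := by
  refine measurable_of_inner fun v => ?_
  refine measurable_of_tendsto_metrizable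
    (f := fun (n : ℕ) s => (n : ℝ) • (p.V (θ + (n : ℝ)⁻¹ • v) s - p.V θ s)) (fun n => ?_)
    (tendsto_pi_nhds.2 fun s => (hp.hasFDerivAt_V θ s).lim v tendsto_norm_natCast)
  have h1 := p.measurable_V (θ + (n : ℝ)⁻¹ • v)
  have h2 := p.measurable_V θ
  fun_prop

theorem measurable_hess (θ : Param N) : Measurable (p.hess θ) := by
  refine measurable_clm_of_apply fun v => ?_
  refine measurable_of_tendsto_metrizable
    (f := fun (n : ℕ) s => (n : ℝ) • (p.feature (θ + (n : ℝ)⁻¹ • v) s - p.feature θ s))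
    (fun n => ?_)
    (tendsto_pi_nhds.2 fun s => (hp.hasFDerivAt_feature θ s).lim v tendsto_norm_natCast)
  have h1 := hp.measurable_feature (θ + (n : ℝ)⁻¹ • v)
  have h2 := hp.measurable_feature θ
  fun_prop

theorem measurable_hess_apply (θ v : Param N) : Measurable fun s => p.hess θ s v :=
  (ContinuousLinearMap.measurable_apply v).comp (hp.measurable_hess θ)

theorem measurable_resid (θ ω : Param N) : Measurable (p.resid θ ω) := by
  unfold resid
  have h1 := p.measurable_tdError θ
  have h2 := p.measurable_ratio
  have h3 := hp.measurable_feature θ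
  fun_prop

theorem measurable_fastDir (θ ω : Param N) : Measurable (p.fastDir θ ω) := by
  simp_rw [funext (fastDir_eq (p := p) θ ω)]
  exact (hp.measurable_resid θ ω).smul ((hp.measurable_feature θ).comp measurable_fst)

theorem measurable_slowDir (θ ω : Param N) : Measurable (p.slowDir θ ω) := by
  simp_rw [funext (slowDir_eq (p := p) θ ω)]
  have h1 := p.measurable_tdError θ
  have h2 := p.measurable_ratio
  have h3 := hp.measurable_feature θ
  have h4 := hp.measurable_resid θ ω
  have h5 := hp.measurable_hess_apply θ ω
  fun_prop

theorem measurable_fastDeriv (θ ω : Param N) : Measurable (p.fastDeriv θ ω) := by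
  refine measurable_clm_of_apply fun v => ?_
  simp_rw [fastDeriv_apply]
  unfold residGrad
  have h2 := p.measurable_ratio
  have h3 := hp.measurable_feature θ
  have h4 := hp.measurable_resid θ ω
  have h5 := hp.measurable_hess_apply θ ω
  have h6 := hp.measurable_hess_apply θ v
  fun_prop

end Assumptions

/-! ### Means under the sample law -/

theorem map_fst_sampleLaw (p : Problem S A N) : p.sampleLaw.map Prod.fst = p.μ :=
  Measure.fst_compProd p.μ p.stepKernel

theorem integral_comp_fst (p : Problem S A N) {E : Type*} [NormedAddCommGroup E] [NormedSpace ℝ E]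
    {h : S → E} (hh : StronglyMeasurable h) : ∫ o, h o.1 ∂p.sampleLaw = ∫ s, h s ∂p.μ := by
  rw [← p.map_fst_sampleLaw, integral_map measurable_fst.aemeasurable hh.aestronglyMeasurable]

theorem integral_ratio (p : Problem S A N) (s : S) : ∫ a, p.ρ s a ∂p.behavior s = 1 := by
  have hm : Measurable (p.ρ s) := p.measurable_ρ.comp measurable_prodMk_left
  rw [integral_eq_lintegral_of_nonneg_ae (Filter.Eventually.of_forall (p.ρ_nonneg s))
    hm.aestronglyMeasurable]
  have h : p.target s Set.univ = 1 := measure_univ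
  rw [p.target_eq s, withDensity_apply _ MeasurableSet.univ, Measure.restrict_univ] at h
  rw [h]; simp

/-- Given s, the ratio integrates to one over the behavior policy, being the density of a
probability measure; so it may be dropped in front of a function of s alone. -/
theorem integral_ratio_mul (hp : p.Assumptions b) {h : S → ℝ} (hh : Measurable h) {C : ℝ}
    (hC : ∀ s, |h s| ≤ C) :
    ∫ o, p.ρ o.1 o.2.1 * h o.1 ∂p.sampleLaw = ∫ s, h s ∂p.μ := by
  have hi : Integrable (fun o : S × A × S => p.ρ o.1 o.2.1 * h o.1) p.sampleLaw := by
    refine Integrable.of_bound (C := b.M * C)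
      (p.measurable_ratio.mul (hh.comp measurable_fst)).aestronglyMeasurable
      (Filter.Eventually.of_forall fun o => ?_)
    rw [norm_mul]
    exact mul_le_mul (hp.norm_ρ_le o) (hC _) (norm_nonneg _) b.M_pos.le
  unfold sampleLaw at hi ⊢
  rw [Measure.integral_compProd hi]
  congr 1
  funext s
  have hm : Measurable (p.ρ s) := p.measurable_ρ.comp measurable_prodMk_left
  have hf : (p.stepKernel s).map Prod.fst = p.behavior s := by
    rw [← Kernel.fst_apply, stepKernel, Kernel.fst_compProd]
  simp only
  rw [integral_mul_const, ← integral_map (f := p.ρ s) measurable_fst.aemeasurable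
    hm.aestronglyMeasurable, hf, p.integral_ratio, one_mul]

/-- The mean direction of the fast update. -/
def meanFast (p : Problem S A N) (x : Param N × Param N) : Param N :=
  ∫ o, p.fastDir x.1 x.2 o ∂p.sampleLaw

/-- The mean direction of the slow update. -/
def meanSlow (p : Problem S A N) (x : Param N × Param N) : Param N :=
  ∫ o, p.slowDir x.1 x.2 o ∂p.sampleLaw

/-- The mean of the derivative of the direction of the fast update. -/
def meanDeriv (p : Problem S A N) (x : Param N × Param N) : Param N →L[ℝ] Param N :=
  ∫ o, p.fastDeriv x.1 x.2 o ∂p.sampleLaw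

namespace Assumptions

variable (hp : p.Assumptions b)
include hp

theorem bddLip_meanFast : BddLip (b.region N) p.meanFast b.K :=
  BddLip.integral hp.bddLip_fastDir fun x _ => (hp.measurable_fastDir x.1 x.2).aestronglyMeasurable

theorem bddLip_meanSlow : BddLip (b.region N) p.meanSlow b.K :=
  BddLip.integral hp.bddLip_slowDir fun x _ => (hp.measurable_slowDir x.1 x.2).aestronglyMeasurable

theorem bddLip_meanDeriv : BddLip (b.region N) p.meanDeriv b.K :=
  BddLip.integral hp.bddLip_fastDeriv
    fun x _ => (hp.measurable_fastDeriv x.1 x.2).aestronglyMeasurable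

theorem integrable_fastDir {x : Param N × Param N} (hx : x ∈ b.region N) :
    Integrable (p.fastDir x.1 x.2) p.sampleLaw :=
  Integrable.of_bound (hp.measurable_fastDir x.1 x.2).aestronglyMeasurable b.K
    (Filter.Eventually.of_forall fun o => (hp.bddLip_fastDir o).norm_le x hx)

theorem integrable_slowDir {x : Param N × Param N} (hx : x ∈ b.region N) :
    Integrable (p.slowDir x.1 x.2) p.sampleLaw :=
  Integrable.of_bound (hp.measurable_slowDir x.1 x.2).aestronglyMeasurable b.K
    (Filter.Eventually.of_forall fun o => (hp.bddLip_slowDir o).norm_le x hx)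

theorem integrable_fastDeriv {x : Param N × Param N} (hx : x ∈ b.region N) :
    Integrable (p.fastDeriv x.1 x.2) p.sampleLaw :=
  Integrable.of_bound (hp.measurable_fastDeriv x.1 x.2).aestronglyMeasurable b.K
    (Filter.Eventually.of_forall fun o => (hp.bddLip_fastDeriv o).norm_le x hx)

theorem measurable_rankOne_feature (θ : Param N) :
    Measurable fun s => InnerProductSpace.rankOne ℝ (p.feature θ s) (p.feature θ s) := by
  refine measurable_clm_of_apply fun v => ?_
  simp only [InnerProductSpace.rankOne_apply]
  have := hp.measurable_feature θ
  fun_prop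

theorem integrable_rankOne_feature (θ : Param N) :
    Integrable (fun s => InnerProductSpace.rankOne ℝ (p.feature θ s) (p.feature θ s)) p.μ := by
  refine Integrable.of_bound (hp.measurable_rankOne_feature θ).aestronglyMeasurable (b.M * b.M)
    (Filter.Eventually.of_forall fun s => ?_)
  rw [InnerProductSpace.norm_rankOne]
  exact mul_le_mul (hp.norm_feature_le θ s) (hp.norm_feature_le θ s) (norm_nonneg _) b.M_pos.le

theorem bddLip_featureCov :
    BddLip (b.region N) (fun x => p.featureCov x.1) (2 * b.M * b.M) :=
  BddLip.integral (fun s => (hp.bddLip_feature s).rankOne (hp.bddLip_feature s))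
    fun x _ => (hp.measurable_rankOne_feature x.1).aestronglyMeasurable

theorem featureCov_apply (θ v : Param N) :
    p.featureCov θ v = ∫ s, ⟪p.feature θ s, v⟫ • p.feature θ s ∂p.μ := by
  unfold featureCov
  rw [ContinuousLinearMap.integral_apply (hp.integrable_rankOne_feature θ)]
  simp

theorem integrable_inner_smul_feature (θ v : Param N) :
    Integrable (fun s => ⟪p.feature θ s, v⟫ • p.feature θ s) p.μ := by
  simpa using (hp.integrable_rankOne_feature θ).apply_continuousLinearMap v

theorem inner_featureCov (θ v w : Param N) :
    ⟪p.featureCov θ v, w⟫ = ∫ s, ⟪p.feature θ s, v⟫ * ⟪p.feature θ s, w⟫ ∂p.μ := by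
  rw [hp.featureCov_apply, inner_integral_left (hp.integrable_inner_smul_feature θ v)]
  simp only [real_inner_smul_left]

theorem inner_featureCov_comm (θ v w : Param N) :
    ⟪p.featureCov θ v, w⟫ = ⟪v, p.featureCov θ w⟫ := by
  rw [real_inner_comm (p.featureCov θ w) v, hp.inner_featureCov, hp.inner_featureCov]
  simp only [mul_comm]

theorem le_inner_featureCov (θ v : Param N) :
    b.lamv * ‖v‖ ^ 2 ≤ ⟪p.featureCov θ v, v⟫ :=
  le_inner_of_eigenvalue_le (hp.inner_featureCov_comm θ)
    (fun x => by
      rw [hp.inner_featureCov]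
      exact integral_nonneg fun s => mul_self_nonneg _)
    (hp.nonsingular θ) v

/-- Coercivity and Cauchy–Schwarz. Estimates on A_θ⁻¹u are obtained from this by applying A_θ and
bounding u, so the inverse itself need never be differentiated. -/
theorem norm_le_norm_featureCov (θ v : Param N) : b.lamv * ‖v‖ ≤ ‖p.featureCov θ v‖ := by
  rcases eq_or_ne v 0 with rfl | hv
  · simp
  have h := (hp.le_inner_featureCov θ v).trans (real_inner_le_norm _ _)
  have hv' : 0 < ‖v‖ := norm_pos_iff.2 hv
  refine le_of_mul_le_mul_right ?_ hv'
  linarith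

theorem norm_le_M_mul_norm_featureCov (θ v : Param N) : ‖v‖ ≤ b.M * ‖p.featureCov θ v‖ := by
  have h := hp.norm_le_norm_featureCov θ v
  have h1 : ‖v‖ ≤ 1 / b.lamv * ‖p.featureCov θ v‖ := by
    rw [div_mul_eq_mul_div, one_mul, le_div_iff₀ b.lamv_pos]; linarith
  exact h1.trans (mul_le_mul_of_nonneg_right b.M_bounds.2.1 (norm_nonneg _))

theorem isInvertible_featureCov (θ : Param N) : (p.featureCov θ).IsInvertible := by
  have hinj : Function.Injective (p.featureCov θ : Param N →ₗ[ℝ] Param N) := by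
    rw [← LinearMap.ker_eq_bot, LinearMap.ker_eq_bot']
    intro v hv
    have := hp.norm_le_M_mul_norm_featureCov θ v
    rw [show p.featureCov θ v = 0 from hv, norm_zero, mul_zero] at this
    exact norm_le_zero_iff.1 this
  exact ⟨(LinearEquiv.ofInjectiveEndo _ hinj).toContinuousLinearEquiv, by ext; rfl⟩

theorem integrable_ratio_mul_tdError_smul (θ : Param N) :
    Integrable (fun o => (p.ρ o.1 o.2.1 * p.tdError θ o) • p.feature θ o.1) p.sampleLaw := by
  have h1 := p.measurable_tdError θ
  have h2 := p.measurable_ratio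
  have h3 := hp.measurable_feature θ
  refine Integrable.of_bound (C := b.M * b.M)
    (by fun_prop : Measurable _).aestronglyMeasurable (Filter.Eventually.of_forall fun o => ?_)
  rw [norm_smul]
  exact mul_le_mul (hp.abs_ratio_mul_tdError_le θ o) (hp.norm_feature_le θ _) (norm_nonneg _)
    b.M_pos.le

theorem meanFast_eq (θ ω : Param N) : p.meanFast (θ, ω) = p.tdMean θ - p.featureCov θ ω := by
  have hm : Measurable fun s => ⟪p.feature θ s, ω⟫ • p.feature θ s := by
    have := hp.measurable_feature θ
    fun_prop
  have hi : Integrable (fun o : S × A × S => ⟪p.feature θ o.1, ω⟫ • p.feature θ o.1)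
      p.sampleLaw := by
    have := hp.integrable_inner_smul_feature θ ω
    rw [← p.map_fst_sampleLaw] at this
    exact this.comp_measurable measurable_fst
  have e : p.fastDir θ ω = fun o => (p.ρ o.1 o.2.1 * p.tdError θ o) • p.feature θ o.1 -
      ⟪p.feature θ o.1, ω⟫ • p.feature θ o.1 := by
    funext o
    rw [fastDir]; abel
  change ∫ o, p.fastDir θ ω o ∂p.sampleLaw = _
  rw [e, integral_sub (hp.integrable_ratio_mul_tdError_smul θ) hi, hp.featureCov_apply,
    p.integral_comp_fst (h := fun s => ⟪p.feature θ s, ω⟫ • p.feature θ s) hm.stronglyMeasurable,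
    tdMean]

end Assumptions

/-! ### The minimizer ω* and the gradient of the objective -/

/-- The minimizer `ω*(θ) = A_θ⁻¹ E[ρ δ φ]`. -/
def wStar (p : Problem S A N) (θ : Param N) : Param N := (p.featureCov θ).inverse (p.tdMean θ)

/-- The derivative of `ω*`. -/
def wDeriv (p : Problem S A N) (θ : Param N) : Param N →L[ℝ] Param N :=
  (p.featureCov θ).inverse ∘L p.meanDeriv (θ, p.wStar θ)

/-- The gradient of `J`. -/
def gradJ (p : Problem S A N) (θ : Param N) : Param N := (-2 : ℝ) • p.meanSlow (θ, p.wStar θ)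

namespace Assumptions

variable (hp : p.Assumptions b)
include hp

theorem featureCov_wStar (θ : Param N) : p.featureCov θ (p.wStar θ) = p.tdMean θ :=
  (hp.isInvertible_featureCov θ).self_apply_inverse _

theorem featureCov_wDeriv (θ v : Param N) :
    p.featureCov θ (p.wDeriv θ v) = p.meanDeriv (θ, p.wStar θ) v :=
  (hp.isInvertible_featureCov θ).self_apply_inverse _

theorem meanFast_eq_featureCov (θ ω : Param N) :
    p.meanFast (θ, ω) = p.featureCov θ (p.wStar θ - ω) := by
  rw [hp.meanFast_eq, map_sub, hp.featureCov_wStar]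

/-- This is what the projection radius is made for: ω*(θ) lies in the ball, so projecting never
increases the distance to it. -/
theorem norm_wStar_le_radius (θ : Param N) : ‖p.wStar θ‖ ≤ p.radius b := by
  have h1 := hp.norm_le_norm_featureCov θ (p.wStar θ)
  rw [hp.featureCov_wStar] at h1
  have h2 : ‖p.tdMean θ‖ ≤ b.ρMax * (b.rMax + (1 + p.γ) * b.Cv) * b.Cφ := by
    simpa [tdMean] using norm_integral_le_of_norm_le_const (μ := p.sampleLaw)
      (f := fun o => (p.ρ o.1 o.2.1 * p.tdError θ o) • p.feature θ o.1)
      (C := b.ρMax * (b.rMax + (1 + p.γ) * b.Cv) * b.Cφ)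
      (Filter.Eventually.of_forall fun o => by
        rw [norm_smul, norm_mul, Real.norm_of_nonneg (p.ρ_nonneg _ _)]
        have h3 := hp.abs_tdError_le' θ o
        have h4 := b.ρMax_pos.le
        exact mul_le_mul (mul_le_mul (hp.ratio_le _ _) h3 (abs_nonneg _) h4)
          (hp.feature_le θ _) (norm_nonneg _) (mul_nonneg h4 ((abs_nonneg _).trans h3)))
  unfold radius
  rw [div_mul_eq_mul_div, le_div_iff₀ b.lamv_pos]
  linarith

theorem norm_wStar_le (θ : Param N) : ‖p.wStar θ‖ ≤ b.M :=
  (hp.norm_wStar_le_radius θ).trans (p.radius_le_M b)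

omit hp in
theorem dist_mk_left (θ η ω : Param N) : dist (θ, ω) (η, ω) = ‖θ - η‖ := by
  rw [Prod.dist_eq, dist_self, dist_eq_norm, max_eq_left (norm_nonneg _)]

omit hp in
theorem dist_mk_right (θ ω ξ : Param N) : dist (θ, ω) (θ, ξ) = ‖ω - ξ‖ := by
  rw [Prod.dist_eq, dist_self, dist_eq_norm, max_eq_right (norm_nonneg _)]

/-- `meanFast (η, ·)` vanishes at ω*(η) and `meanFast (θ, ·)` is affine with zero ω*(θ). Regularity
of ω* is thereby reduced to that of `meanFast`, as in the implicit function theorem. -/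
theorem featureCov_wStar_sub (θ η : Param N) :
    p.featureCov θ (p.wStar η - p.wStar θ) =
      p.meanFast (η, p.wStar η) - p.meanFast (θ, p.wStar η) := by
  rw [hp.meanFast_eq_featureCov, hp.meanFast_eq_featureCov, sub_self, map_zero, zero_sub,
    ← map_neg, neg_sub]

theorem norm_wStar_sub_le (θ η : Param N) :
    ‖p.wStar η - p.wStar θ‖ ≤ b.M * b.K * ‖η - θ‖ := by
  refine (hp.norm_le_M_mul_norm_featureCov θ _).trans ?_
  rw [hp.featureCov_wStar_sub, mul_assoc]
  refine mul_le_mul_of_nonneg_left ?_ b.M_pos.le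
  have := hp.bddLip_meanFast.norm_sub_le (η, p.wStar η) (hp.norm_wStar_le η) (θ, p.wStar η)
    (hp.norm_wStar_le η)
  rwa [dist_mk_left] at this

theorem norm_meanFast_expansion (θ η ω : Param N) (hω : ‖ω‖ ≤ b.M) :
    ‖p.meanFast (η, ω) - p.meanFast (θ, ω) - p.meanDeriv (θ, ω) (η - θ)‖ ≤
      b.K * ‖η - θ‖ ^ 2 := by
  have h1 := hp.integrable_fastDir (x := (η, ω)) hω
  have h2 := hp.integrable_fastDir (x := (θ, ω)) hω
  have h3 := hp.integrable_fastDeriv (x := (θ, ω)) hω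
  unfold meanFast meanDeriv
  rw [ContinuousLinearMap.integral_apply h3, ← integral_sub h1 h2]
  refine le_of_eq_of_le (congrArg _
    (integral_sub (h1.sub h2) (h3.apply_continuousLinearMap (η - θ))).symm) ?_
  simpa using norm_integral_le_of_norm_le_const (μ := p.sampleLaw)
    (Filter.Eventually.of_forall fun o => hp.norm_fastDir_expansion θ η ω hω o)

theorem K_nonneg : 0 ≤ b.K := hp.bddLip_meanFast.nonneg

theorem norm_wDeriv_apply_le (θ v : Param N) : ‖p.wDeriv θ v‖ ≤ b.M * b.K * ‖v‖ := by
  refine (hp.norm_le_M_mul_norm_featureCov θ _).trans ?_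
  rw [hp.featureCov_wDeriv, mul_assoc]
  exact mul_le_mul_of_nonneg_left ((p.meanDeriv (θ, p.wStar θ)).le_of_opNorm_le
    (hp.bddLip_meanDeriv.norm_le _ (hp.norm_wStar_le θ)) v) b.M_pos.le

/-- After applying A_θ, expand `meanFast` in θ with its second argument frozen at ω*(η). Moving that
argument back to ω*(θ) in the derivative changes it by O(‖η - θ‖), hence costs only a further
quadratic term. -/
theorem norm_wStar_expansion (θ η : Param N) :
    ‖p.wStar η - p.wStar θ - p.wDeriv θ (η - θ)‖ ≤
      b.M * (b.K + b.K * (b.M * b.K)) * ‖η - θ‖ ^ 2 := by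
  refine (hp.norm_le_M_mul_norm_featureCov θ _).trans ?_
  rw [mul_assoc]
  refine mul_le_mul_of_nonneg_left ?_ b.M_pos.le
  rw [map_sub, hp.featureCov_wStar_sub, hp.featureCov_wDeriv]
  have e : p.meanFast (η, p.wStar η) - p.meanFast (θ, p.wStar η) -
      p.meanDeriv (θ, p.wStar θ) (η - θ) =
      (p.meanFast (η, p.wStar η) - p.meanFast (θ, p.wStar η) -
        p.meanDeriv (θ, p.wStar η) (η - θ)) +
      (p.meanDeriv (θ, p.wStar η) - p.meanDeriv (θ, p.wStar θ)) (η - θ) := by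
    rw [sub_apply]; abel
  rw [e, add_mul]
  refine (norm_add_le _ _).trans (add_le_add
    (hp.norm_meanFast_expansion θ η _ (hp.norm_wStar_le η)) ?_)
  have h1 := hp.bddLip_meanDeriv.norm_sub_le (θ, p.wStar η) (hp.norm_wStar_le η) (θ, p.wStar θ)
    (hp.norm_wStar_le θ)
  rw [dist_mk_right] at h1
  refine (ContinuousLinearMap.le_of_opNorm_le _
    (h1.trans (mul_le_mul_of_nonneg_left (hp.norm_wStar_sub_le θ η) hp.K_nonneg)) _).trans
    (le_of_eq (by ring))

/-- With Q_θ(ω) = 2⟨b(θ), ω⟩ - ⟨A_θ ω, ω⟩ = ⟨`meanFast (θ, ω)` + `meanFast (θ, 0)`, ω⟩, the first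
term is Q_η - Q_θ at the frozen point ω*(θ). The second is max Q_η - Q_η(ω*(θ)) = ⟨A_η Δ, Δ⟩ for the
increment Δ of ω*, and is quadratically small. -/
theorem J_sub (θ η : Param N) :
    p.J η - p.J θ = ⟪p.meanFast (η, p.wStar θ) - p.meanFast (θ, p.wStar θ) +
      (p.meanFast (η, 0) - p.meanFast (θ, 0)), p.wStar θ⟫ +
      ⟪p.wStar η - p.wStar θ, p.meanFast (η, p.wStar θ) - p.meanFast (η, p.wStar η)⟫ := by
  have e1 : p.J η = ⟪p.tdMean η, p.wStar η⟫ := rfl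
  have e2 : p.J θ = ⟪p.tdMean θ, p.wStar θ⟫ := rfl
  have e3 := hp.inner_featureCov_comm η (p.wStar η) (p.wStar θ)
  rw [hp.featureCov_wStar] at e3
  rw [e1, e2]
  simp only [hp.meanFast_eq, hp.featureCov_wStar, map_zero, sub_zero, sub_self,
    inner_add_left, inner_sub_left, inner_sub_right]
  rw [real_inner_comm (p.tdMean η) (p.wStar η), real_inner_comm (p.tdMean η) (p.wStar θ),
    real_inner_comm (p.featureCov η (p.wStar θ)) (p.wStar θ), e3]
  ring

/-- The envelope formula for ∇J: integrate `inner_fastDeriv_add_inner_slowDir` at ω = ω*(θ). Once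
the ratio is integrated out of the last term, the right side is 2⟨b(θ) - A_θ ω*(θ), v⟩, which is
zero. -/
theorem inner_meanDeriv (θ v : Param N) :
    ⟪p.meanDeriv (θ, p.wStar θ) v + p.meanDeriv (θ, 0) v, p.wStar θ⟫ = ⟪p.gradJ θ, v⟫ := by
  set w := p.wStar θ with hw
  have hwM : ‖w‖ ≤ b.M := hp.norm_wStar_le θ
  have h0M : ‖(0 : Param N)‖ ≤ b.M := by simpa using b.M_pos.le
  have h1 := (hp.integrable_fastDeriv (x := (θ, w)) hwM).apply_continuousLinearMap v
  have h2 := (hp.integrable_fastDeriv (x := (θ, 0)) h0M).apply_continuousLinearMap v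
  have h3 := hp.integrable_slowDir (x := (θ, w)) hwM
  have h4 := hp.integrable_ratio_mul_tdError_smul θ
  have e1 : ⟪p.meanDeriv (θ, w) v + p.meanDeriv (θ, 0) v, w⟫ =
      ∫ o, ⟪p.fastDeriv θ w o v + p.fastDeriv θ 0 o v, w⟫ ∂p.sampleLaw := by
    unfold meanDeriv
    rw [ContinuousLinearMap.integral_apply (hp.integrable_fastDeriv (x := (θ, w)) hwM),
      ContinuousLinearMap.integral_apply (hp.integrable_fastDeriv (x := (θ, 0)) h0M),
      ← integral_add h1 h2]
    exact inner_integral_left (h1.add h2) w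
  have e2 : ⟪p.meanSlow (θ, w), v⟫ = ∫ o, ⟪p.slowDir θ w o, v⟫ ∂p.sampleLaw :=
    inner_integral_left h3 v
  have e3 : ⟪p.tdMean θ, v⟫ =
      ∫ o, p.ρ o.1 o.2.1 * p.tdError θ o * ⟪p.feature θ o.1, v⟫ ∂p.sampleLaw := by
    unfold tdMean
    rw [inner_integral_left h4]
    simp only [real_inner_smul_left]
  have e4 : ⟪p.featureCov θ w, v⟫ = ∫ o, p.ρ o.1 o.2.1 *
      (⟪p.feature θ o.1, w⟫ * ⟪p.feature θ o.1, v⟫) ∂p.sampleLaw := by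
    have hm := hp.measurable_feature θ
    rw [hp.inner_featureCov, integral_ratio_mul hp
      (h := fun s => ⟪p.feature θ s, w⟫ * ⟪p.feature θ s, v⟫) (by fun_prop)
      (C := b.M * ‖w‖ * (b.M * ‖v‖))]
    intro s
    rw [abs_mul]
    have h : ∀ u, |⟪p.feature θ s, u⟫| ≤ b.M * ‖u‖ := fun u =>
      (abs_real_inner_le_norm _ _).trans
        (mul_le_mul_of_nonneg_right (hp.norm_feature_le θ s) (norm_nonneg _))
    exact mul_le_mul (h w) (h v) (abs_nonneg _) (mul_nonneg b.M_pos.le (norm_nonneg _))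
  have i1 : Integrable (fun o => ⟪p.fastDeriv θ w o v + p.fastDeriv θ 0 o v, w⟫) p.sampleLaw :=
    integrable_inner_left (h1.add h2) w
  have i2 : Integrable (fun o => ⟪p.slowDir θ w o, v⟫) p.sampleLaw :=
    integrable_inner_left h3 v
  have i3 : Integrable (fun o => p.ρ o.1 o.2.1 * p.tdError θ o * ⟪p.feature θ o.1, v⟫)
      p.sampleLaw := by
    simpa only [real_inner_smul_left] using integrable_inner_left h4 v
  -- The pointwise identity expresses this integrand through three integrable ones.
  have i4 : Integrable (fun o => p.ρ o.1 o.2.1 *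
      (⟪p.feature θ o.1, w⟫ * ⟪p.feature θ o.1, v⟫)) p.sampleLaw := by
    have := i3.sub ((i1.add (i2.const_mul 2)).const_mul (1 / 2))
    refine this.congr (Filter.Eventually.of_forall fun o => ?_)
    have := inner_fastDeriv_add_inner_slowDir hp θ w o v
    simp only [Pi.sub_apply, Pi.add_apply]
    linarith
  have key : ⟪p.meanDeriv (θ, w) v + p.meanDeriv (θ, 0) v, w⟫ + 2 * ⟪p.meanSlow (θ, w), v⟫ =
      2 * (⟪p.tdMean θ, v⟫ - ⟪p.featureCov θ w, v⟫) := by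
    rw [e1, e2, e3, e4, ← integral_const_mul, ← integral_add i1 (i2.const_mul 2),
      ← integral_sub i3 i4, ← integral_const_mul]
    congr 1; funext o
    exact inner_fastDeriv_add_inner_slowDir hp θ w o v
  rw [hw, hp.featureCov_wStar, ← hw, sub_self, mul_zero] at key
  unfold gradJ
  rw [real_inner_smul_left, ← hw]
  linarith

/-- In `J_sub` the frozen part leaves two Taylor remainders of `meanFast` paired with ω*, and the
other part is a product of two increments of order ‖η - θ‖. Only Lipschitz continuity of ω* is used.
-/
theorem abs_J_expansion (θ η : Param N) :
    |p.J η - p.J θ - ⟪p.gradJ θ, η - θ⟫| ≤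
      (2 * b.K * b.M + b.M * b.K * (b.K * (b.M * b.K))) * ‖η - θ‖ ^ 2 := by
  have h0M : ‖(0 : Param N)‖ ≤ b.M := by simpa using b.M_pos.le
  rw [← hp.inner_meanDeriv θ, hp.J_sub θ η]
  have h1 := hp.norm_meanFast_expansion θ η _ (hp.norm_wStar_le θ)
  have h2 := hp.norm_meanFast_expansion θ η 0 h0M
  have h3 := hp.norm_wStar_sub_le θ η
  have h4 := hp.bddLip_meanFast.norm_sub_le (η, p.wStar θ) (hp.norm_wStar_le θ) (η, p.wStar η)
    (hp.norm_wStar_le η)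
  rw [dist_mk_right, norm_sub_rev (p.wStar θ)] at h4
  set a := p.meanFast (η, p.wStar θ) - p.meanFast (θ, p.wStar θ)
  set c := p.meanFast (η, 0) - p.meanFast (θ, 0)
  set f := p.meanFast (η, p.wStar θ) - p.meanFast (η, p.wStar η)
  set Da := p.meanDeriv (θ, p.wStar θ) (η - θ)
  set Dc := p.meanDeriv (θ, 0) (η - θ)
  have hM := b.M_pos
  have hK := hp.K_nonneg
  have e : ⟪a + c, p.wStar θ⟫ + ⟪p.wStar η - p.wStar θ, f⟫ - ⟪Da + Dc, p.wStar θ⟫ =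
      ⟪(a - Da) + (c - Dc), p.wStar θ⟫ + ⟪p.wStar η - p.wStar θ, f⟫ := by
    simp only [inner_add_left, inner_sub_left]; ring
  rw [e]
  have g1 : |⟪(a - Da) + (c - Dc), p.wStar θ⟫| ≤
      (b.K * ‖η - θ‖ ^ 2 + b.K * ‖η - θ‖ ^ 2) * b.M :=
    (abs_real_inner_le_norm _ _).trans (mul_le_mul ((norm_add_le _ _).trans (add_le_add h1 h2))
      (hp.norm_wStar_le θ) (norm_nonneg _) (by positivity))
  have h5 : ‖f‖ ≤ b.K * (b.M * b.K * ‖η - θ‖) :=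
    h4.trans (mul_le_mul_of_nonneg_left h3 hK)
  have g2 : |⟪p.wStar η - p.wStar θ, f⟫| ≤
      b.M * b.K * ‖η - θ‖ * (b.K * (b.M * b.K * ‖η - θ‖)) :=
    (abs_real_inner_le_norm _ _).trans (mul_le_mul h3 h5 (norm_nonneg _) (by positivity))
  refine (abs_add_le _ _).trans ((add_le_add g1 g2).trans (le_of_eq (by ring)))

theorem hasGradientAt_J (θ : Param N) : HasGradientAt p.J (p.gradJ θ) θ := by
  rw [hasGradientAt_iff_isLittleO]
  refine Asymptotics.IsBigO.trans_isLittleO (g := fun η => ‖η - θ‖ ^ 2) ?_ ?_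
  · refine Asymptotics.IsBigO.of_bound
      (2 * b.K * b.M + b.M * b.K * (b.K * (b.M * b.K))) (Filter.Eventually.of_forall fun η => ?_)
    rw [Real.norm_of_nonneg (sq_nonneg ‖η - θ‖)]
    exact hp.abs_J_expansion θ η
  · exact Asymptotics.isLittleO_pow_sub_sub θ one_lt_two

theorem differentiable_J : Differentiable ℝ p.J := fun θ => (hp.hasGradientAt_J θ).differentiableAt

theorem gradient_J (θ : Param N) : gradient p.J θ = p.gradJ θ := (hp.hasGradientAt_J θ).gradient

end Assumptions

end Problem

/-! ### Constants of the Lyapunov analysis -/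

namespace Bounds

variable (b : Bounds)

/-- A bound and Lipschitz constant for `ω*`. -/
def wLip : ℝ := b.M + b.M * b.K

/-- A bound and Lipschitz constant for `∇ J`. -/
def gradLip : ℝ := 2 * (b.K * (1 + (1 + b.wLip)))

/-- A bound and Lipschitz constant for the derivative of `ω*`. -/
def wDerivLip : ℝ :=
  b.M * b.K + b.M * (b.K * (1 + (1 + b.wLip)) + 2 * b.M * b.M * (b.M * b.K))

/-- A bound and Lipschitz constant for the weights of the two directions in the derivative of the
Lyapunov function. -/
def weightLip : ℝ :=
  b.gradLip + 2 * 2 * (2 * b.wDerivLip * (b.M + b.wLip)) + 2 * 2 * (b.M + b.wLip)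

/-- The constant of the second-order terms in one step. -/
def stepConst : ℝ :=
  (2 * b.K * b.M + b.M * b.K * (b.K * (b.M * b.K))) * b.K ^ 2 +
    4 * b.M * (b.M * (b.K + b.K * (b.M * b.K))) * b.K ^ 2 + (b.M * b.K * b.K) ^ 2 + b.K ^ 2 +
    b.M * b.K * b.K ^ 2

/-- The constant of the coupling between the two time scales. -/
def couplingConst : ℝ := (b.K + b.M * b.K) ^ 2 + 2 * (b.M * b.K) * b.K

/-- The bound for the ratio of the step-sizes. -/
def ratioBound : ℝ := 2 * b.lamv / b.couplingConst

theorem K_pos : 0 < b.K := by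
  have := pow_pos b.M_pos 6
  unfold K; linarith

theorem couplingConst_pos : 0 < b.couplingConst := by
  have := b.K_pos
  have := b.M_pos
  unfold couplingConst; positivity

theorem ratioBound_pos : 0 < b.ratioBound :=
  div_pos (mul_pos two_pos b.lamv_pos) b.couplingConst_pos

theorem wLip_nonneg : 0 ≤ b.wLip := by
  have := b.K_pos
  have := b.M_pos
  unfold wLip; positivity

theorem wDerivLip_nonneg : 0 ≤ b.wDerivLip := by
  have := b.K_pos
  have := b.M_pos
  have := b.wLip_nonneg
  unfold wDerivLip; positivity

theorem gradLip_nonneg : 0 ≤ b.gradLip := by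
  have := b.K_pos
  have := b.wLip_nonneg
  unfold gradLip; positivity

end Bounds

/-! ### The Lyapunov function and its drift -/

namespace Problem

variable {S A : Type*} [MeasurableSpace S] [MeasurableSpace A] {N : ℕ} {p : Problem S A N}
  {b : Bounds}

/-- The weight of the slow direction in the derivative of the Lyapunov function. -/
def slowWeight (p : Problem S A N) (x : Param N × Param N) : Param N :=
  p.gradJ x.1 - (2 : ℝ) • ContinuousLinearMap.adjoint (p.wDeriv x.1) (x.2 - p.wStar x.1)

/-- The weight of the fast direction in the derivative of the Lyapunov function. -/
def fastWeight (p : Problem S A N) (x : Param N × Param N) : Param N :=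
  (2 : ℝ) • (x.2 - p.wStar x.1)

/-- The Lyapunov function `J(θ) + ‖ω - ω*(θ)‖²`. -/
def lyapunov (p : Problem S A N) (x : Param N × Param N) : ℝ :=
  p.J x.1 + ‖x.2 - p.wStar x.1‖ ^ 2

namespace Assumptions

theorem norm_fst_sub_le (x y : Param N × Param N) : ‖x.1 - y.1‖ ≤ dist x y := by
  rw [← dist_eq_norm, Prod.dist_eq]; exact le_max_left _ _

theorem continuous_of_bddLip {E : Type*} [NormedAddCommGroup E] {f : Param N → E} {K : ℝ}
    (h : BddLip (b.region N) (fun x => f x.1) K) : Continuous f := by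
  -- The slice ω = 0 lies in the region, and distances on it are distances between the θ components.
  have h0 : ∀ θ : Param N, (θ, (0 : Param N)) ∈ b.region N := fun θ => by
    change ‖(0 : Param N)‖ ≤ b.M
    rw [norm_zero]; exact b.M_pos.le
  have : LipschitzWith K.toNNReal f := LipschitzWith.of_dist_le_mul fun θ η => by
    rw [dist_eq_norm, Real.coe_toNNReal _ h.nonneg, dist_eq_norm, ← dist_mk_left θ η 0]
    exact h.norm_sub_le _ (h0 θ) _ (h0 η)
  exact this.continuous

variable (hp : p.Assumptions b)
include hp

theorem bddLip_wStar : BddLip (b.region N) (fun x => p.wStar x.1) b.wLip where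
  nonneg := b.wLip_nonneg
  norm_le x _ := (hp.norm_wStar_le x.1).trans (by
    have := mul_pos b.M_pos b.K_pos
    unfold Bounds.wLip; linarith)
  norm_sub_le x _ y _ := by
    refine (hp.norm_wStar_sub_le y.1 x.1).trans ?_
    have h1 := norm_fst_sub_le x y
    have h2 := mul_pos b.M_pos b.K_pos
    have h3 := b.M_pos
    unfold Bounds.wLip
    gcongr
    linarith

theorem bddLip_comp_wStar {E : Type*} [NormedAddCommGroup E] {f : Param N × Param N → E} {K : ℝ}
    (hf : BddLip (b.region N) f K) :
    BddLip (b.region N) (fun x => f (x.1, p.wStar x.1)) (K * (1 + (1 + b.wLip))) := by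
  refine hf.comp (φ := fun x : Param N × Param N => (x.1, p.wStar x.1))
    (fun x _ => hp.norm_wStar_le x.1) (by linarith [b.wLip_nonneg]) fun x hx y hy => ?_
  have h1 := norm_fst_sub_le x y
  have h2 := hp.bddLip_wStar.norm_sub_le x hx y hy
  have h3 := b.wLip_nonneg
  have h4 : 0 ≤ dist x y := dist_nonneg
  rw [Prod.dist_eq, dist_eq_norm, dist_eq_norm]
  exact max_le (by nlinarith) (by nlinarith)

theorem bddLip_gradJ : BddLip (b.region N) (fun x => p.gradJ x.1) b.gradLip := by
  have h := hp.bddLip_comp_wStar hp.bddLip_meanSlow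
  refine ⟨b.gradLip_nonneg, fun x hx => ?_, fun x hx y hy => ?_⟩
  · rw [gradJ, norm_smul, Bounds.gradLip]
    have := h.norm_le x hx
    norm_num
    linarith
  · rw [gradJ, gradJ, ← smul_sub, norm_smul, Bounds.gradLip]
    have := h.norm_sub_le x hx y hy
    norm_num
    linarith

theorem bddLip_wDeriv : BddLip (b.region N) (fun x => p.wDeriv x.1) b.wDerivLip := by
  have hM := b.M_pos
  have hK := b.K_pos
  have hw := b.wLip_nonneg
  have h := hp.bddLip_comp_wStar hp.bddLip_meanDeriv
  refine ⟨b.wDerivLip_nonneg, fun x _ => ?_, fun x hx y hy => ?_⟩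
  · refine ContinuousLinearMap.opNorm_le_bound _ b.wDerivLip_nonneg fun v => ?_
    refine (hp.norm_wDeriv_apply_le x.1 v).trans
      (mul_le_mul_of_nonneg_right ?_ (norm_nonneg _))
    unfold Bounds.wDerivLip
    have : 0 ≤ b.M * (b.K * (1 + (1 + b.wLip)) + 2 * b.M * b.M * (b.M * b.K)) := by positivity
    linarith
  · refine ContinuousLinearMap.opNorm_le_bound _
      (mul_nonneg b.wDerivLip_nonneg dist_nonneg) fun v => ?_
    rw [sub_apply]
    refine (hp.norm_le_M_mul_norm_featureCov x.1 _).trans ?_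
    -- Difference of the two linear equations that define the derivatives of ω*, with the second one
    -- rewritten for the operator of the first.
    have e : p.featureCov x.1 (p.wDeriv x.1 v - p.wDeriv y.1 v) =
        (p.meanDeriv (x.1, p.wStar x.1) - p.meanDeriv (y.1, p.wStar y.1)) v -
          (p.featureCov x.1 - p.featureCov y.1) (p.wDeriv y.1 v) := by
      rw [map_sub, sub_apply, sub_apply, hp.featureCov_wDeriv, hp.featureCov_wDeriv]
      abel
    rw [e]
    have h1 := ContinuousLinearMap.le_of_opNorm_le _ (h.norm_sub_le x hx y hy) v
    have h2 := ContinuousLinearMap.le_of_opNorm_le_of_le _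
      (hp.bddLip_featureCov.norm_sub_le x hx y hy) (hp.norm_wDeriv_apply_le y.1 v)
    have h3 := (norm_sub_le _ _).trans (add_le_add h1 h2)
    refine (mul_le_mul_of_nonneg_left h3 hM.le).trans ?_
    have h4 : 0 ≤ b.M * b.K * (dist x y * ‖v‖) := by positivity
    unfold Bounds.wDerivLip
    linear_combination h4

theorem bddLip_sub_wStar :
    BddLip (b.region N) (fun x => x.2 - p.wStar x.1) (b.M + b.wLip) :=
  (b.bddLip_snd N).sub hp.bddLip_wStar

theorem bddLip_slowWeight : BddLip (b.region N) p.slowWeight b.weightLip := by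
  have h0 := (hp.bddLip_sub_wStar).nonneg
  refine (hp.bddLip_gradJ.sub ((BddLip.const (2 : ℝ) (by norm_num : ‖(2 : ℝ)‖ ≤ 2)).smul
    (hp.bddLip_wDeriv.adjoint.clm_apply hp.bddLip_sub_wStar))).mono ?_
  unfold Bounds.weightLip
  linarith

theorem bddLip_fastWeight : BddLip (b.region N) p.fastWeight b.weightLip := by
  have h0 := (hp.bddLip_sub_wStar).nonneg
  refine ((BddLip.const (2 : ℝ) (by norm_num : ‖(2 : ℝ)‖ ≤ 2)).smul hp.bddLip_sub_wStar).mono ?_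
  have h1 := b.gradLip_nonneg
  have h2 := mul_nonneg b.wDerivLip_nonneg h0
  unfold Bounds.weightLip
  linarith

theorem continuous_wStar : Continuous p.wStar := continuous_of_bddLip hp.bddLip_wStar

theorem continuous_gradJ : Continuous p.gradJ := continuous_of_bddLip hp.bddLip_gradJ

theorem continuous_wDeriv : Continuous p.wDeriv := continuous_of_bddLip hp.bddLip_wDeriv

theorem continuous_fastWeight : Continuous p.fastWeight := by
  have := hp.continuous_wStar
  unfold fastWeight; fun_prop

theorem continuous_slowWeight : Continuous p.slowWeight := by
  have h1 := hp.continuous_wStar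
  have h2 := hp.continuous_gradJ
  have h3 : Continuous fun θ => ContinuousLinearMap.adjoint (p.wDeriv θ) :=
    ContinuousLinearMap.adjoint.continuous.comp hp.continuous_wDeriv
  exact (h2.comp continuous_fst).sub (((h3.comp continuous_fst).clm_apply
    (continuous_snd.sub (h1.comp continuous_fst))).const_smul (2 : ℝ))

theorem norm_sub_wStar_le {x : Param N × Param N} (hx : x ∈ b.region N) :
    ‖x.2 - p.wStar x.1‖ ≤ 2 * b.M := by
  have h1 : ‖x.2‖ ≤ b.M := hx
  linarith [norm_sub_le x.2 (p.wStar x.1), hp.norm_wStar_le x.1]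

theorem abs_lyapunov_le {x : Param N × Param N} (hx : x ∈ b.region N) :
    |p.lyapunov x| ≤ b.K * b.M + 4 * b.M ^ 2 := by
  have h1 := hp.norm_sub_wStar_le hx
  have h2 : |p.J x.1| ≤ b.K * b.M := by
    have h0 : ‖(0 : Param N)‖ ≤ b.M := by simpa using b.M_pos.le
    have h3 := hp.bddLip_meanFast.norm_le (x.1, 0) h0
    rw [hp.meanFast_eq, map_zero, sub_zero] at h3
    exact (abs_real_inner_le_norm _ _).trans
      (mul_le_mul h3 (hp.norm_wStar_le x.1) (norm_nonneg _) b.K_pos.le)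
  have h3 : ‖x.2 - p.wStar x.1‖ ^ 2 ≤ (2 * b.M) ^ 2 := by gcongr
  unfold lyapunov
  refine (abs_add_le _ _).trans ?_
  rw [abs_of_nonneg (sq_nonneg ‖x.2 - p.wStar x.1‖)]
  linarith

/-- The change of the Lyapunov function in one step of the algorithm. -/
theorem lyapunov_step {x : Param N × Param N} (hx : ‖x.2‖ ≤ p.radius b) {α β : ℝ} (hα : 0 ≤ α)
    (hβ : 0 ≤ β) (o : S × A × S) :
    p.lyapunov (x.1 + α • p.slowDir x.1 x.2 o, projBall (p.radius b) (x.2 + β • p.fastDir x.1 x.2 o))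
      ≤ p.lyapunov x + α * ⟪p.slowWeight x, p.slowDir x.1 x.2 o⟫ +
        β * ⟪p.fastWeight x, p.fastDir x.1 x.2 o⟫ + b.stepConst * (α ^ 2 + β ^ 2) := by
  have hM := b.M_pos
  have hK := b.K_pos
  have hxr : x ∈ b.region N := hx.trans (p.radius_le_M b)
  have hs := (hp.bddLip_slowDir o).norm_le x hxr
  have hf := (hp.bddLip_fastDir o).norm_le x hxr
  set s := p.slowDir x.1 x.2 o
  set f := p.fastDir x.1 x.2 o
  set y := projBall (p.radius b) (x.2 + β • f)
  set a := p.wStar x.1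
  set a' := p.wStar (x.1 + α • s)
  have hR := p.radius_nonneg b
  have hαs : ‖α • s‖ ≤ α * b.K := by
    rw [norm_smul, Real.norm_of_nonneg hα]; gcongr
  have hβf : ‖β • f‖ ≤ β * b.K := by
    rw [norm_smul, Real.norm_of_nonneg hβ]; gcongr
  have hJ := hp.abs_J_expansion x.1 (x.1 + α • s)
  have hW := hp.norm_wStar_expansion x.1 (x.1 + α • s)
  have hL := hp.norm_wStar_sub_le x.1 (x.1 + α • s)
  rw [add_sub_cancel_left] at hJ hW hL
  -- The current ω already lies in the ball, so the projected step is no longer than the raw one.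
  have hy : ‖y - x.2‖ ≤ β * b.K := by
    have := norm_projBall_sub_le hR (x.2 + β • f) x.2 hx
    rw [add_sub_cancel_left] at this
    exact this.trans hβf
  -- The target a = ω*(θ) lies in the ball, so the projection may be dropped before expanding the
  -- square.
  have hya : ‖y - a‖ ^ 2 ≤ ‖x.2 - a‖ ^ 2 + β * (2 * ⟪x.2 - a, f⟫) + (β * b.K) ^ 2 := by
    have h1 := norm_projBall_sub_le hR (x.2 + β • f) a (hp.norm_wStar_le_radius x.1)
    have h2 : ‖y - a‖ ^ 2 ≤ ‖(x.2 - a) + β • f‖ ^ 2 := by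
      rw [sub_add_eq_add_sub]; gcongr
    rw [norm_add_sq_real, real_inner_smul_right] at h2
    have h3 : ‖β • f‖ ^ 2 ≤ (β * b.K) ^ 2 := by gcongr
    linarith
  have hL' : ‖a' - a‖ ≤ b.M * b.K * (α * b.K) := hL.trans (by gcongr)
  have hz := hp.norm_sub_wStar_le hxr
  -- The target moves from a to a'. To first order this enters through the derivative of ω* paired
  -- with the old error; the other three terms are of second order in (α, β).
  have e1 : ‖y - a'‖ ^ 2 = ‖y - a‖ ^ 2 - 2 * ⟪x.2 - a, p.wDeriv x.1 (α • s)⟫ -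
      2 * ⟪x.2 - a, a' - a - p.wDeriv x.1 (α • s)⟫ - 2 * ⟪y - x.2, a' - a⟫ + ‖a' - a‖ ^ 2 := by
    have : y - a' = (y - a) - (a' - a) := by abel
    rw [this, norm_sub_sq_real, inner_sub_right (x.2 - a)]
    have : y - a = (x.2 - a) + (y - x.2) := by abel
    rw [this, inner_add_left]; ring
  have g1 : |⟪x.2 - a, a' - a - p.wDeriv x.1 (α • s)⟫| ≤
      2 * b.M * (b.M * (b.K + b.K * (b.M * b.K)) * (α * b.K) ^ 2) :=
    (abs_real_inner_le_norm _ _).trans (mul_le_mul hz (hW.trans (by gcongr)) (norm_nonneg _)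
      (by positivity))
  have g2 : |⟪y - x.2, a' - a⟫| ≤ β * b.K * (b.M * b.K * (α * b.K)) :=
    (abs_real_inner_le_norm _ _).trans (mul_le_mul hy hL' (norm_nonneg _) (by positivity))
  have g3 : ‖a' - a‖ ^ 2 ≤ (b.M * b.K * (α * b.K)) ^ 2 := by gcongr
  have g4 : (2 * b.K * b.M + b.M * b.K * (b.K * (b.M * b.K))) * ‖α • s‖ ^ 2 ≤
      (2 * b.K * b.M + b.M * b.K * (b.K * (b.M * b.K))) * (α * b.K) ^ 2 := by gcongr
  have w1 : ⟪p.slowWeight x, s⟫ = ⟪p.gradJ x.1, s⟫ - 2 * ⟪x.2 - a, p.wDeriv x.1 s⟫ := by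
    rw [slowWeight, inner_sub_left, real_inner_smul_left, ContinuousLinearMap.adjoint_inner_left]
  have w2 : ⟪p.fastWeight x, f⟫ = 2 * ⟪x.2 - a, f⟫ := by
    rw [fastWeight, real_inner_smul_left]
  unfold lyapunov
  change p.J (x.1 + α • s) + ‖y - a'‖ ^ 2 ≤ p.J x.1 + ‖x.2 - a‖ ^ 2 + _ + _ + _
  rw [e1, w1, w2, map_smul, real_inner_smul_right]
  rw [map_smul] at g1
  rw [real_inner_smul_right] at hJ
  have hJ' := (abs_le.1 hJ).2
  have g1' := (abs_le.1 g1).1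
  have g2' := (abs_le.1 g2).1
  have hab : 2 * (α * β) ≤ α ^ 2 + β ^ 2 := by nlinarith [sq_nonneg (α - β)]
  have hab' := mul_le_mul_of_nonneg_left hab (by positivity : 0 ≤ b.M * b.K * b.K ^ 2)
  -- `stepConst` multiplies α² + β² as a whole; `r1` and `r2` supply the squares that the estimate
  -- does not produce.
  have r1 : 0 ≤ ((2 * b.K * b.M + b.M * b.K * (b.K * (b.M * b.K))) * b.K ^ 2 +
    4 * b.M * (b.M * (b.K + b.K * (b.M * b.K))) * b.K ^ 2 + (b.M * b.K * b.K) ^ 2) * β ^ 2 := by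
    positivity
  have r2 : 0 ≤ b.K ^ 2 * α ^ 2 := by positivity
  unfold Bounds.stepConst
  linear_combination hJ' + hya + 2 * g1' + 2 * g2' + g3 + g4 + hab' + r1 + r2

/-- The mean drift of the Lyapunov function. -/
theorem drift_le {x : Param N × Param N} (hx : x ∈ b.region N) {α β : ℝ} (hα : 0 ≤ α)
    (hβ : 0 ≤ β) (hαβ : α * b.couplingConst ≤ 2 * b.lamv * β) :
    α * ⟪p.slowWeight x, p.meanSlow x⟫ + β * ⟪p.fastWeight x, p.meanFast x⟫ ≤
      -(α / 4) * ‖p.gradJ x.1‖ ^ 2 := by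
  have hM := b.M_pos
  have hK := b.K_pos
  obtain ⟨θ, ω⟩ := x
  simp only
  set z := ω - p.wStar θ with hz
  have h1 := hp.bddLip_meanSlow.norm_sub_le (θ, ω) hx (θ, p.wStar θ) (hp.norm_wStar_le θ)
  rw [dist_mk_right] at h1
  set e := p.meanSlow (θ, ω) - p.meanSlow (θ, p.wStar θ) with he
  -- The mean slow direction is that of gradient ascent up to an error e of size K‖z‖, caused by ω
  -- differing from ω*(θ).
  have hG : p.meanSlow (θ, ω) = e - (1 / 2 : ℝ) • p.gradJ θ := by
    rw [he, gradJ, smul_smul]; norm_num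
  have hF : ⟪p.fastWeight (θ, ω), p.meanFast (θ, ω)⟫ ≤ -2 * (b.lamv * ‖z‖ ^ 2) := by
    have := hp.le_inner_featureCov θ z
    rw [hp.meanFast_eq_featureCov, fastWeight, real_inner_smul_left, ← neg_sub ω, map_neg,
      inner_neg_right, real_inner_comm]
    linarith
  have hS : ⟪p.slowWeight (θ, ω), p.meanSlow (θ, ω)⟫ ≤
      -(1 / 4) * ‖p.gradJ θ‖ ^ 2 + b.couplingConst * ‖z‖ ^ 2 := by
    have w1 : ⟪p.slowWeight (θ, ω), p.meanSlow (θ, ω)⟫ = ⟪p.gradJ θ, p.meanSlow (θ, ω)⟫ -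
        2 * ⟪z, p.wDeriv θ (p.meanSlow (θ, ω))⟫ := by
      rw [slowWeight, inner_sub_left, real_inner_smul_left, ContinuousLinearMap.adjoint_inner_left]
    have n1 : ‖p.meanSlow (θ, ω)‖ ≤ b.K * ‖z‖ + 1 / 2 * ‖p.gradJ θ‖ := by
      rw [hG]
      refine (norm_sub_le _ _).trans (add_le_add h1 ?_)
      rw [norm_smul]; norm_num
    have n2 : ⟪p.gradJ θ, p.meanSlow (θ, ω)⟫ ≤
        ‖p.gradJ θ‖ * (b.K * ‖z‖) - 1 / 2 * ‖p.gradJ θ‖ ^ 2 := by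
      rw [hG, inner_sub_right, real_inner_smul_right, real_inner_self_eq_norm_sq]
      have := (real_inner_le_norm (p.gradJ θ) e).trans
        (mul_le_mul_of_nonneg_left h1 (norm_nonneg _))
      linarith
    have n3 : -(‖z‖ * (b.M * b.K * (b.K * ‖z‖ + 1 / 2 * ‖p.gradJ θ‖))) ≤
        ⟪z, p.wDeriv θ (p.meanSlow (θ, ω))⟫ := by
      refine (abs_le.1 ((abs_real_inner_le_norm _ _).trans
        (mul_le_mul_of_nonneg_left ?_ (norm_nonneg _)))).1
      exact (hp.norm_wDeriv_apply_le θ _).trans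
        (mul_le_mul_of_nonneg_left n1 (by positivity))
    rw [w1]
    unfold Bounds.couplingConst
    -- This square splits the mixed term (K + MK)‖∇J‖‖z‖ into ¼‖∇J‖² and (K + MK)²‖z‖²; half of the
    -- descent -½‖∇J‖² remains.
    nlinarith [sq_nonneg (1 / 2 * ‖p.gradJ θ‖ - (b.K + b.M * b.K) * ‖z‖)]
  have h2 := mul_le_mul_of_nonneg_left hS hα
  have h3 := mul_le_mul_of_nonneg_left hF hβ
  have h4 := mul_le_mul_of_nonneg_right hαβ (sq_nonneg ‖z‖)
  linarith

end Assumptions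

end Problem

/-! ### A uniform random index -/

/-- Split according to the value of W: the indicator of W = k is independent of X and has mean 1/T.
-/
theorem integral_uniformIndex {Ω Y : Type*} [MeasurableSpace Ω] [MeasurableSpace Y]
    {P : Measure Ω} [IsProbabilityMeasure P] {T : ℕ} (hT : 1 ≤ T) {W : Ω → ℕ} {X : Ω → Y}
    (hX : Measurable X) (h : IsUniformIndex P T W X) {f : ℕ → Y → ℝ} (hf : ∀ k, Measurable (f k))
    {B : ℝ} (hB : ∀ k y, |f k y| ≤ B) :
    Integrable (fun x => f (W x) (X x)) P ∧
      ∫ x, f (W x) (X x) ∂P = 1 / (T : ℝ) * ∑ k ∈ Finset.range T, ∫ x, f k (X x) ∂P := by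
  have hm : Measurable fun x => f (W x) (X x) := by
    have : Measurable fun q : Y × ℕ => f q.2 q.1 := measurable_from_prod_countable_left hf
    exact this.comp (hX.prodMk h.measurable)
  have hint : Integrable (fun x => f (W x) (X x)) P :=
    Integrable.of_bound hm.aestronglyMeasurable B (Filter.Eventually.of_forall fun x => hB _ _)
  refine ⟨hint, ?_⟩
  have hT0 : (T : ENNReal) ≠ 0 := by exact_mod_cast (by omega : T ≠ 0)
  have hset : ∀ k, MeasurableSet {x | W x = k} := fun k => h.measurable (measurableSet_singleton k)
  -- The T masses 1/T already add up to one, so W < T almost surely.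
  have hae : ∀ᵐ x ∂P, x ∈ ⋃ k ∈ Finset.range T, {x | W x = k} := by
    have hU : MeasurableSet (⋃ k ∈ Finset.range T, {x | W x = k}) :=
      Finset.measurableSet_biUnion _ fun k _ => hset k
    refine (prob_compl_eq_zero_iff hU).2 ?_
    rw [measure_biUnion_finset (fun i _ j _ hij => ?_) fun k _ => hset k,
      Finset.sum_congr rfl fun k hk => h.uniform k (Finset.mem_range.1 hk)]
    · rw [Finset.sum_const, Finset.card_range, nsmul_eq_mul,
        ENNReal.mul_inv_cancel hT0 (ENNReal.natCast_ne_top T)]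
    · exact Set.disjoint_left.2 fun x hi hj => hij (hi.symm.trans hj)
  have hsplit : ∀ᵐ x ∂P, f (W x) (X x) = ∑ k ∈ Finset.range T,
      Set.indicator {k} (fun _ => (1 : ℝ)) (W x) * f k (X x) := by
    filter_upwards [hae] with x hx
    simp only [Set.mem_iUnion, Set.mem_ofPred_eq, exists_prop, exists_eq_right'] at hx
    rw [Finset.sum_eq_single_of_mem (W x) hx fun k _ hk => ?_]
    · simp
    · rw [Set.indicator_of_notMem (by simpa using hk.symm), zero_mul]
  have hind : ∀ k, Measurable (Set.indicator {k} fun _ : ℕ => (1 : ℝ)) := fun k =>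
    measurable_from_top
  rw [integral_congr_ae hsplit, integral_finsetSum, Finset.mul_sum]
  · refine Finset.sum_congr rfl fun k hk => ?_
    have hi : IndepFun (fun x => Set.indicator {k} (fun _ => (1 : ℝ)) (W x))
        (fun x => f k (X x)) P := h.indep.comp (hind k) (hf k)
    have := hi.integral_mul_eq_mul_integral ((hind k).comp h.measurable).aestronglyMeasurable
      ((hf k).comp hX).aestronglyMeasurable
    simp only [Pi.mul_apply] at this
    rw [this]
    congr 1
    have e : (fun x => Set.indicator {k} (fun _ => (1 : ℝ)) (W x)) =
        Set.indicator {x | W x = k} 1 := by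
      funext x; rfl
    rw [e, integral_indicator_one (hset k), Measure.real, h.uniform k (Finset.mem_range.1 hk)]
    simp
  · intro k _
    refine Integrable.of_bound (C := B)
      (((hind k).comp h.measurable).mul ((hf k).comp hX)).aestronglyMeasurable
      (Filter.Eventually.of_forall fun x => ?_)
    rw [norm_mul]
    have h1 : ‖Set.indicator {k} (fun _ => (1 : ℝ)) (W x)‖ ≤ 1 := by
      by_cases hx : W x ∈ ({k} : Set ℕ) <;> simp [hx]
    have h2 : ‖f k (X x)‖ ≤ B := hB k (X x)
    exact (mul_le_mul h1 h2 (norm_nonneg _) zero_le_one).trans (one_mul B).le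

/-! ### Summation of a recursive inequality -/

/-- Telescoping from t = 1, because ω₀ need not lie in the ball and the recursion is not available
at t = 0. That first term is bounded by G separately, and e 0 ≥ 0 allows the error sum to start at
0. -/
theorem sum_le_of_recursion {a g e : ℕ → ℝ} {c G L : ℝ} (hc : 0 < c)
    (h : ∀ t, 1 ≤ t → a (t + 1) ≤ a t - c * g t + e t) (h0 : g 0 ≤ G)
    (ha : ∀ t, 1 ≤ t → |a t| ≤ L) (he : 0 ≤ e 0) {T : ℕ} (hT : 1 ≤ T) :
    ∑ t ∈ Finset.range T, g t ≤ G + (2 * L + ∑ t ∈ Finset.range T, e t) / c := by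
  have key : c * ∑ t ∈ Finset.range T, g t + a T ≤ c * G + a 1 + ∑ t ∈ Finset.range T, e t := by
    induction T, hT using Nat.le_induction with
    | base => simp only [Finset.sum_range_one]; nlinarith
    | succ n hn ih =>
      rw [Finset.sum_range_succ, Finset.sum_range_succ]
      linarith [h n hn]
  have h1 := abs_le.1 (ha T hT)
  have h2 := abs_le.1 (ha 1 le_rfl)
  rw [← sub_le_iff_le_add', le_div_iff₀ hc]
  linarith

namespace Problem

variable {S A : Type*} [MeasurableSpace S] [MeasurableSpace A] {N : ℕ} {p : Problem S A N}
  {b : Bounds}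

/-! ### Measurability of the iterates -/

namespace Assumptions

variable (hp : p.Assumptions b)
include hp

/-- Carathéodory function: continuous in (θ, ω), measurable in the sample. -/
theorem measurable_uncurry_slowDir :
    Measurable fun q : (Param N × Param N) × (S × A × S) => p.slowDir q.1.1 q.1.2 q.2 := by
  refine measurable_uncurry_of_continuous_of_measurable
    (u := fun (x : Param N × Param N) o => p.slowDir x.1 x.2 o) (fun o => ?_)
    (fun x => hp.measurable_slowDir x.1 x.2)
  have h1 := fun s => (hp.smooth s).continuous
  have h2 := fun s => (hp.contDiff_feature s).continuous
  have h3 : ∀ s, Continuous fun θ => p.hess θ s := fun s =>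
    (hp.contDiff_feature s).continuous_fderiv (by norm_num)
  have h4 := h1 o.1
  have h5 := h1 o.2.2
  have h6 := h2 o.1
  have h7 := h2 o.2.2
  have h8 : Continuous fun x : Param N × Param N => p.hess x.1 o.1 x.2 :=
    ((h3 o.1).comp continuous_fst).clm_apply continuous_snd
  unfold slowDir hTerm tdError
  fun_prop

theorem measurable_uncurry_fastDir :
    Measurable fun q : (Param N × Param N) × (S × A × S) => p.fastDir q.1.1 q.1.2 q.2 := by
  refine measurable_uncurry_of_continuous_of_measurable
    (u := fun (x : Param N × Param N) o => p.fastDir x.1 x.2 o) (fun o => ?_)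
    (fun x => hp.measurable_fastDir x.1 x.2)
  have h4 := (hp.smooth o.1).continuous
  have h5 := (hp.smooth o.2.2).continuous
  have h6 := (hp.contDiff_feature o.1).continuous
  unfold fastDir tdError
  fun_prop

/-- The σ-algebra is a parameter and only samples before t are required, so the same lemma shows
that the iterate is adapted to the past. -/
theorem measurable_iterates {Ω : Type*} {m : MeasurableSpace Ω} {O : ℕ → Ω → S × A × S}
    (α β : ℝ) (θ₀ ω₀ : Param N) (t : ℕ) (hO : ∀ i < t, Measurable (O i)) :
    Measurable fun x => p.iterates b α β θ₀ ω₀ (fun t => O t x) t := by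
  induction t with
  | zero => exact measurable_const
  | succ t ih =>
    have h1 := ih fun i hi => hO i (hi.trans t.lt_succ_self)
    have h2 := hO t t.lt_succ_self
    have h3 := hp.measurable_uncurry_slowDir.comp (h1.prodMk h2)
    have h4 := hp.measurable_uncurry_fastDir.comp (h1.prodMk h2)
    have h5 := (continuous_projBall (N := N) (p.radius_nonneg b)).measurable
    exact (h1.fst.add (h3.const_smul α)).prodMk (h5.comp (h1.snd.add (h4.const_smul β)))

omit hp in
theorem norm_iterates_snd_le (α β : ℝ) (θ₀ ω₀ : Param N) (o : ℕ → S × A × S) {t : ℕ}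
    (ht : 1 ≤ t) : ‖(p.iterates b α β θ₀ ω₀ o t).2‖ ≤ p.radius b := by
  obtain ⟨t, rfl⟩ := Nat.exists_eq_add_of_le' ht
  exact norm_projBall_le (p.radius_nonneg b) _

omit hp in
theorem iterates_mem_region (α β : ℝ) (θ₀ ω₀ : Param N) (o : ℕ → S × A × S) {t : ℕ}
    (ht : 1 ≤ t) : p.iterates b α β θ₀ ω₀ o t ∈ b.region N :=
  (norm_iterates_snd_le α β θ₀ ω₀ o ht).trans (p.radius_le_M b)

theorem dist_iterates_succ_le {α β : ℝ} (hα : 0 ≤ α) (hβ : 0 ≤ β) (θ₀ ω₀ : Param N)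
    (o : ℕ → S × A × S) {t : ℕ} (ht : 1 ≤ t) :
    dist (p.iterates b α β θ₀ ω₀ o (t + 1)) (p.iterates b α β θ₀ ω₀ o t) ≤ (α + β) * b.K := by
  have h1 := norm_iterates_snd_le (p := p) (b := b) α β θ₀ ω₀ o ht
  have h2 := iterates_mem_region (p := p) (b := b) α β θ₀ ω₀ o ht
  simp only [iterates]
  set x := p.iterates b α β θ₀ ω₀ o t
  have hs := (hp.bddLip_slowDir (o t)).norm_le x h2
  have hf := (hp.bddLip_fastDir (o t)).norm_le x h2
  have hK := b.K_pos
  rw [Prod.dist_eq]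
  refine max_le ?_ ?_
  · rw [dist_eq_norm, add_sub_cancel_left, norm_smul, Real.norm_of_nonneg hα]
    nlinarith
  · have h3 := norm_projBall_sub_le (p.radius_nonneg b) (x.2 + β • p.fastDir x.1 x.2 (o t)) x.2 h1
    rw [add_sub_cancel_left, norm_smul, Real.norm_of_nonneg hβ] at h3
    rw [dist_eq_norm]
    nlinarith

theorem dist_iterates_add_le {α β : ℝ} (hα : 0 ≤ α) (hβ : 0 ≤ β) (θ₀ ω₀ : Param N)
    (o : ℕ → S × A × S) {t : ℕ} (ht : 1 ≤ t) (n : ℕ) :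
    dist (p.iterates b α β θ₀ ω₀ o (t + n)) (p.iterates b α β θ₀ ω₀ o t) ≤
      n * ((α + β) * b.K) := by
  induction n with
  | zero => simp
  | succ n ih =>
    refine (dist_triangle _ (p.iterates b α β θ₀ ω₀ o (t + n)) _).trans ?_
    have := hp.dist_iterates_succ_le hα hβ θ₀ ω₀ o (t := t + n) (by omega)
    rw [← add_assoc]
    push_cast
    linarith

end Assumptions

/-! ### The noise -/

/-- The bound for the noise terms. -/
def _root_.NonlinearTDC.Bounds.noiseBound (b : Bounds) : ℝ := 2 * b.weightLip * b.K

/-- The part of the derivative of the Lyapunov function along the slow direction. -/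
def slowNoise (p : Problem S A N) (x : Param N × Param N) (o : S × A × S) : ℝ :=
  ⟪p.slowWeight x, p.slowDir x.1 x.2 o⟫

/-- The part of the derivative of the Lyapunov function along the fast direction. -/
def fastNoise (p : Problem S A N) (x : Param N × Param N) (o : S × A × S) : ℝ :=
  ⟪p.fastWeight x, p.fastDir x.1 x.2 o⟫

namespace Assumptions

variable (hp : p.Assumptions b)
include hp

theorem bddLip_slowNoise (o : S × A × S) :
    BddLip (b.region N) (fun x => p.slowNoise x o) b.noiseBound :=
  hp.bddLip_slowWeight.inner (hp.bddLip_slowDir o)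

theorem bddLip_fastNoise (o : S × A × S) :
    BddLip (b.region N) (fun x => p.fastNoise x o) b.noiseBound :=
  hp.bddLip_fastWeight.inner (hp.bddLip_fastDir o)

theorem measurable_slowNoise : Measurable (Function.uncurry p.slowNoise) :=
  (hp.continuous_slowWeight.measurable.comp measurable_fst).inner hp.measurable_uncurry_slowDir

theorem measurable_fastNoise : Measurable (Function.uncurry p.fastNoise) :=
  (hp.continuous_fastWeight.measurable.comp measurable_fst).inner hp.measurable_uncurry_fastDir

theorem integral_slowNoise {x : Param N × Param N} (hx : x ∈ b.region N) :
    ∫ o, p.slowNoise x o ∂p.sampleLaw = ⟪p.slowWeight x, p.meanSlow x⟫ :=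
  integral_inner (hp.integrable_slowDir hx) _

theorem integral_fastNoise {x : Param N × Param N} (hx : x ∈ b.region N) :
    ∫ o, p.fastNoise x o ∂p.sampleLaw = ⟪p.fastWeight x, p.meanFast x⟫ :=
  integral_inner (hp.integrable_fastDir hx) _

end Assumptions

/-- The error that is made in the expectation of `ψ (x_t, o_t)` when the sample `o_t` is replaced
by an independent sample of law `sampleLaw` is at most `η`. -/
def NoiseLE {Ω : Type*} [MeasurableSpace Ω] (p : Problem S A N) (P : Measure Ω)
    (ψ : Param N × Param N → S × A × S → ℝ) (X : Ω → Param N × Param N) (O : Ω → S × A × S)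
    (η : ℝ) : Prop :=
  |∫ x, ψ (X x) (O x) ∂P - ∫ x, ∫ o, ψ (X x) o ∂p.sampleLaw ∂P| ≤ η

/-! ### Summed descent of the Lyapunov function -/

/-- The main estimate: the sum of the expected squared gradients. -/
theorem Assumptions.sum_integral_norm_gradJ_sq_le (hp : p.Assumptions b) {Ω : Type*}
    [MeasurableSpace Ω] {P : Measure Ω} [IsProbabilityMeasure P] {O : ℕ → Ω → S × A × S}
    (hO : ∀ t, Measurable (O t)) {α β : ℝ} (hα : 0 < α) (hβ : 0 < β)
    (hαβ : α / β ≤ b.ratioBound) (θ₀ ω₀ : Param N) {T : ℕ} (hT : 1 ≤ T) {η : ℕ → ℝ}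
    (hη : ∀ t, 0 ≤ η t)
    (hs : ∀ t, 1 ≤ t → p.NoiseLE P p.slowNoise
      (fun x => p.iterates b α β θ₀ ω₀ (fun t => O t x) t) (O t) (η t))
    (hf : ∀ t, 1 ≤ t → p.NoiseLE P p.fastNoise
      (fun x => p.iterates b α β θ₀ ω₀ (fun t => O t x) t) (O t) (η t)) :
    ∑ t ∈ Finset.range T, ∫ x, ‖p.gradJ (p.iterates b α β θ₀ ω₀ (fun t => O t x) t).1‖ ^ 2 ∂P ≤
      b.gradLip ^ 2 + (2 * (b.K * b.M + 4 * b.M ^ 2) + ∑ t ∈ Finset.range T,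
        ((α + β) * η t + b.stepConst * (α ^ 2 + β ^ 2))) / (α / 4) := by
  have hM := b.M_pos
  have hK := b.K_pos
  set X : ℕ → Ω → Param N × Param N := fun t x => p.iterates b α β θ₀ ω₀ (fun t => O t x) t
    with hX
  have hXm : ∀ t, Measurable (X t) := fun t => hp.measurable_iterates α β θ₀ ω₀ t fun i _ => hO i
  have hXr : ∀ t, 1 ≤ t → ∀ x, X t x ∈ b.region N := fun t ht x =>
    iterates_mem_region α β θ₀ ω₀ _ ht
  have hXR : ∀ t, 1 ≤ t → ∀ x, ‖(X t x).2‖ ≤ p.radius b := fun t ht x =>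
    norm_iterates_snd_le α β θ₀ ω₀ _ ht
  have hJc : Continuous p.J := hp.differentiable_J.continuous
  have hwc := hp.continuous_wStar
  have hgc := hp.continuous_gradJ
  have hLc : Continuous p.lyapunov := by unfold lyapunov; fun_prop
  have hgb : ∀ θ : Param N, ‖p.gradJ θ‖ ≤ b.gradLip := fun θ =>
    hp.bddLip_gradJ.norm_le (θ, 0) (by
      change ‖(0 : Param N)‖ ≤ b.M
      rw [norm_zero]; exact hM.le)
  have hgb2 : ∀ θ : Param N, ‖p.gradJ θ‖ ^ 2 ≤ b.gradLip ^ 2 := fun θ => by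
    have := hgb θ; gcongr
  have hgi : ∀ t, Integrable (fun x => ‖p.gradJ (X t x).1‖ ^ 2) P := fun t =>
    Integrable.of_bound
      (((hgc.comp continuous_fst).norm.pow 2).measurable.comp (hXm t)).aestronglyMeasurable
      (b.gradLip ^ 2) (Filter.Eventually.of_forall fun x => by
        rw [Real.norm_of_nonneg (sq_nonneg _)]; exact hgb2 _)
  have hLi : ∀ t, 1 ≤ t → Integrable (fun x => p.lyapunov (X t x)) P := fun t ht =>
    Integrable.of_bound (hLc.measurable.comp (hXm t)).aestronglyMeasurable _
      (Filter.Eventually.of_forall fun x => hp.abs_lyapunov_le (hXr t ht x))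
  have hni : ∀ (ψ : Param N × Param N → S × A × S → ℝ), Measurable (Function.uncurry ψ) →
      (∀ o, BddLip (b.region N) (fun x => ψ x o) b.noiseBound) → ∀ t, 1 ≤ t →
      Integrable (fun x => ψ (X t x) (O t x)) P := fun ψ hψ hb t ht =>
    Integrable.of_bound (hψ.comp ((hXm t).prodMk (hO t))).aestronglyMeasurable _
      (Filter.Eventually.of_forall fun x => (hb _).norm_le _ (hXr t ht x))
  have hmi : ∀ (ψ : Param N × Param N → S × A × S → ℝ), Measurable (Function.uncurry ψ) →
      (∀ o, BddLip (b.region N) (fun x => ψ x o) b.noiseBound) → ∀ t, 1 ≤ t →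
      Integrable (fun x => ∫ o, ψ (X t x) o ∂p.sampleLaw) P := fun ψ hψ hb t ht =>
    Integrable.of_bound ((hψ.stronglyMeasurable.integral_prod_right).measurable.comp
      (hXm t)).aestronglyMeasurable b.noiseBound
      (Filter.Eventually.of_forall fun x => by
        simpa using norm_integral_le_of_norm_le_const (μ := p.sampleLaw)
          (Filter.Eventually.of_forall fun o => (hb o).norm_le _ (hXr t ht x)))
  -- The telescoped quantity is the expected Lyapunov function, and α/4 is the descent factor of
  -- `drift_le`.
  refine sum_le_of_recursion (a := fun t => ∫ x, p.lyapunov (X t x) ∂P)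
    (g := fun t => ∫ x, ‖p.gradJ (X t x).1‖ ^ 2 ∂P) (c := α / 4) (by positivity) ?_ ?_ ?_ ?_ hT
  · intro t ht
    have hs' := (abs_le.1 (hs t ht)).2
    have hf' := (abs_le.1 (hf t ht)).2
    have i1 := hni _ hp.measurable_slowNoise hp.bddLip_slowNoise t ht
    have i2 := hni _ hp.measurable_fastNoise hp.bddLip_fastNoise t ht
    have i3 := hmi _ hp.measurable_slowNoise hp.bddLip_slowNoise t ht
    have i4 := hmi _ hp.measurable_fastNoise hp.bddLip_fastNoise t ht
    have j1 : Integrable (fun x => p.lyapunov (X t x) + α * p.slowNoise (X t x) (O t x)) P :=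
      (hLi t ht).add (i1.const_mul α)
    have j2 : Integrable (fun x => p.lyapunov (X t x) + α * p.slowNoise (X t x) (O t x) +
        β * p.fastNoise (X t x) (O t x)) P := j1.add (i2.const_mul β)
    have step : ∫ x, p.lyapunov (X (t + 1) x) ∂P ≤ ∫ x, p.lyapunov (X t x) +
        α * p.slowNoise (X t x) (O t x) + β * p.fastNoise (X t x) (O t x) +
        b.stepConst * (α ^ 2 + β ^ 2) ∂P :=
      integral_mono (hLi (t + 1) (by omega))
        (j2.add (integrable_const _))
        fun x => hp.lyapunov_step (hXR t ht x) hα.le hβ.le (O t x)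
    rw [integral_add j2 (integrable_const _), integral_add j1 (i2.const_mul β),
      integral_add (hLi t ht) (i1.const_mul α), integral_const_mul, integral_const_mul,
      integral_const] at step
    have drift : ∫ x, (α * ∫ o, p.slowNoise (X t x) o ∂p.sampleLaw) +
        (β * ∫ o, p.fastNoise (X t x) o ∂p.sampleLaw) ∂P ≤
        ∫ x, -(α / 4) * ‖p.gradJ (X t x).1‖ ^ 2 ∂P := by
      refine integral_mono ((i3.const_mul α).add (i4.const_mul β)) ((hgi t).const_mul _)
        fun x => ?_
      simp only
      rw [hp.integral_slowNoise (hXr t ht x), hp.integral_fastNoise (hXr t ht x)]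
      refine hp.drift_le (hXr t ht x) hα.le hβ.le ?_
      -- Cross-multiplied, the bound on α/β is the condition under which the fast contraction
      -- absorbs the coupling.
      unfold Bounds.ratioBound at hαβ
      rwa [div_le_div_iff₀ hβ b.couplingConst_pos] at hαβ
    rw [integral_add (i3.const_mul α) (i4.const_mul β), integral_const_mul, integral_const_mul,
      integral_const_mul] at drift
    simp only [probReal_univ, one_smul] at step
    have h1 := mul_le_mul_of_nonneg_left hs' hα.le
    have h2 := mul_le_mul_of_nonneg_left hf' hβ.le
    linarith
  · refine (integral_mono (hgi 0) (integrable_const (b.gradLip ^ 2))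
      fun x => hgb2 _).trans ?_
    simp
  · intro t ht
    simpa using norm_integral_le_of_norm_le_const (μ := P) (f := fun x => p.lyapunov (X t x))
      (Filter.Eventually.of_forall fun x => hp.abs_lyapunov_le (hXr t ht x))
  · have h1 : 0 ≤ b.stepConst := by unfold Bounds.stepConst; positivity
    have h2 := hη 0
    positivity

end Problem

/-! ### Truncation and independence -/

/-- A measurable function that is bounded on a measurable set can be cut off outside of it. -/
theorem exists_truncation {X O : Type*} [MeasurableSpace X] [MeasurableSpace O] {R : Set X}
    (hR : MeasurableSet R) {ψ : X → O → ℝ} (hψ : Measurable (Function.uncurry ψ)) {B : ℝ}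
    (hB0 : 0 ≤ B) (hB : ∀ x ∈ R, ∀ o, |ψ x o| ≤ B) :
    ∃ φ : X → O → ℝ, Measurable (Function.uncurry φ) ∧ (∀ x o, |φ x o| ≤ B) ∧
      ∀ x ∈ R, φ x = ψ x := by
  classical
  refine ⟨fun x o => if x ∈ R then ψ x o else 0, ?_, fun x o => ?_, fun x hx => ?_⟩
  · exact Measurable.ite (measurable_fst hR) hψ measurable_const
  · beta_reduce
    split_ifs with h
    · exact hB x h o
    · simpa using hB0
  · funext o
    exact if_pos hx

theorem measurableSet_region (b : Bounds) (N : ℕ) : MeasurableSet (b.region N) :=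
  (isClosed_le continuous_snd.norm continuous_const).measurableSet

/-- Independence makes the joint law a product, to which Fubini applies. -/
theorem IndepFun.integral_eq_integral_integral {Ω X Y : Type*} [MeasurableSpace Ω]
    [MeasurableSpace X] [MeasurableSpace Y] {P : Measure Ω} [IsProbabilityMeasure P] {f : Ω → X}
    {g : Ω → Y} (h : IndepFun f g P) (hf : Measurable f) (hg : Measurable g) {ψ : X → Y → ℝ}
    (hψ : Measurable (Function.uncurry ψ)) {B : ℝ} (hB : ∀ x y, |ψ x y| ≤ B) :
    ∫ x, ψ (f x) (g x) ∂P = ∫ x, ∫ y, ψ (f x) y ∂P.map g ∂P := by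
  have := Measure.isProbabilityMeasure_map (μ := P) hf.aemeasurable
  have := Measure.isProbabilityMeasure_map (μ := P) hg.aemeasurable
  have e := (indepFun_iff_map_prod_eq_prod_map_map hf.aemeasurable hg.aemeasurable).1 h
  have h1 : ∫ x, ψ (f x) (g x) ∂P =
      ∫ q, Function.uncurry ψ q ∂P.map (fun x => (f x, g x)) :=
    (integral_map (hf.prodMk hg).aemeasurable hψ.aestronglyMeasurable).symm
  rw [h1, e, integral_prod _ (Integrable.of_bound hψ.aestronglyMeasurable B
    (Filter.Eventually.of_forall fun q => hB q.1 q.2))]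
  exact integral_map (f := fun x => ∫ y, ψ x y ∂P.map g) hf.aemeasurable
    hψ.stronglyMeasurable.integral_prod_right.aestronglyMeasurable

namespace Problem

variable {S A : Type*} [MeasurableSpace S] [MeasurableSpace A] {N : ℕ} {p : Problem S A N}
  {b : Bounds}

/-! ### Independent samples -/

section IID

variable {Ω : Type*} [MeasurableSpace Ω] {P : Measure Ω} {O : ℕ → Ω → S × A × S}

/-- The iterate at time t is a function of the samples with index below t, and families over
disjoint index sets are independent. -/
theorem Assumptions.indepFun_iterates (hp : p.Assumptions b) (hO : p.IsIIDSample P O)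
    (α β : ℝ) (θ₀ ω₀ : Param N) (t : ℕ) :
    IndepFun (fun x => p.iterates b α β θ₀ ω₀ (fun t => O t x) t) (O t) P := by
  have h1 : iIndep (fun i => MeasurableSpace.comap (O i) inferInstance) P := hO.indep.iIndep
  have h2 := indep_iSup_of_disjoint (fun i => (hO.measurable i).comap_le) h1
    (S := Set.Iio t) (T := {t}) (by simp)
  rw [IndepFun_iff_Indep]
  refine indep_of_indep_of_le_left (indep_of_indep_of_le_right h2 ?_) ?_
  · exact le_iSup₂_of_le t rfl le_rfl
  · refine Measurable.comap_le ?_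
    refine hp.measurable_iterates α β θ₀ ω₀ t fun i hi => ?_
    exact Measurable.of_comap_le (le_iSup₂_of_le (f := fun i (_ : i ∈ Set.Iio t) =>
      MeasurableSpace.comap (O i) inferInstance) i hi le_rfl)

theorem Assumptions.noiseLE_of_isIIDSample [IsProbabilityMeasure P] (hp : p.Assumptions b) (hO : p.IsIIDSample P O)
    (α β : ℝ) (θ₀ ω₀ : Param N) {ψ : Param N × Param N → S × A × S → ℝ}
    (hψ : Measurable (Function.uncurry ψ)) {B : ℝ}
    (hB : ∀ o, BddLip (b.region N) (fun x => ψ x o) B) {t : ℕ} (ht : 1 ≤ t) :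
    p.NoiseLE P ψ (fun x => p.iterates b α β θ₀ ω₀ (fun t => O t x) t) (O t) 0 := by
  have hB0 : 0 ≤ B := by
    obtain ⟨o⟩ := nonempty_of_isProbabilityMeasure p.sampleLaw
    exact (hB o).nonneg
  -- The integrand is bounded on the region only; its truncation is bounded everywhere and agrees
  -- with it along the iterates from time 1 on.
  obtain ⟨φ, hφ, hφB, hφe⟩ := exists_truncation (measurableSet_region b N) hψ hB0
    fun x hx o => (hB o).norm_le x hx
  have h := IndepFun.integral_eq_integral_integral (hp.indepFun_iterates hO α β θ₀ ω₀ t)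
    (hp.measurable_iterates α β θ₀ ω₀ t fun i _ => hO.measurable i) (hO.measurable t) hφ hφB
  rw [hO.law] at h
  have e : ∀ x, φ (p.iterates b α β θ₀ ω₀ (fun t => O t x) t) =
      ψ (p.iterates b α β θ₀ ω₀ (fun t => O t x) t) := fun x =>
    hφe _ (Assumptions.iterates_mem_region α β θ₀ ω₀ _ ht)
  simp only [e] at h
  rw [NoiseLE, h, sub_self, abs_zero]

end IID

/-! ### Markovian samples -/

section Markov

variable {Ω : Type*} [MeasurableSpace Ω] {P : Measure Ω} {s : ℕ → Ω → S} {a : ℕ → Ω → A}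

/-- The Markov property with respect to a filtration. -/
structure IsMarkov (p : Problem S A N) (P : Measure Ω)
    (ℱ : Filtration ℕ (inferInstance : MeasurableSpace Ω)) (s : ℕ → Ω → S) (a : ℕ → Ω → A) :
    Prop where
  state : ∀ t, Measurable[ℱ t] (s t)
  action : ∀ t, Measurable[ℱ (t + 1)] (a t)
  law : ∀ t (B : Set Ω), MeasurableSet[ℱ t] B → ∀ C : Set (A × S), MeasurableSet C →
    P (B ∩ {x | (a t x, s (t + 1) x) ∈ C}) = ∫⁻ x in B, p.stepKernel (s t x) C ∂P

namespace IsMarkov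

variable {ℱ : Filtration ℕ (inferInstance : MeasurableSpace Ω)} (h : p.IsMarkov P ℱ s a)
  {𝒴 : Type*} [MeasurableSpace 𝒴] {Y : Ω → 𝒴} {t : ℕ}
include h

theorem measurable_state (t : ℕ) : Measurable (s t) := (h.state t).mono (ℱ.le t) le_rfl

theorem measurable_action (t : ℕ) : Measurable (a t) := (h.action t).mono (ℱ.le (t + 1)) le_rfl

variable [IsProbabilityMeasure P]

/-- Joint form of the Markov property: anything known at time t may be carried along with the state.
Rectangles suffice to identify the two measures, and on them it is the defining property. -/
theorem map_eq_compProd (hY : Measurable[ℱ t] Y) :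
    P.map (fun x => ((Y x, s t x), (a t x, s (t + 1) x))) =
      (P.map fun x => (Y x, s t x)) ⊗ₘ (p.stepKernel.comap Prod.snd measurable_snd) := by
  have hZ' : Measurable[ℱ t] fun x => (Y x, s t x) := hY.prodMk (h.state t)
  have hZ : Measurable fun x => (Y x, s t x) := hZ'.mono (ℱ.le t) le_rfl
  have hU : Measurable fun x => (a t x, s (t + 1) x) :=
    (h.measurable_action t).prodMk (h.measurable_state (t + 1))
  have := Measure.isProbabilityMeasure_map (μ := P) (hZ.prodMk hU).aemeasurable
  have := Measure.isProbabilityMeasure_map (μ := P) hZ.aemeasurable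
  refine Measure.ext_prod fun {D C} hD hC => ?_
  rw [Measure.map_apply (hZ.prodMk hU) (hD.prod hC), Measure.compProd_apply_prod hD hC,
    setLIntegral_map hD (Kernel.measurable_coe _ hC) hZ]
  exact h.law t _ (hZ' hD) C hC

theorem integral_step (hY : Measurable[ℱ t] Y) {f : (𝒴 × S) × (A × S) → ℝ} (hf : Measurable f)
    {B : ℝ} (hB : ∀ q, |f q| ≤ B) :
    ∫ x, f ((Y x, s t x), (a t x, s (t + 1) x)) ∂P =
      ∫ x, ∫ u, f ((Y x, s t x), u) ∂p.stepKernel (s t x) ∂P := by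
  have hZ : Measurable fun x => (Y x, s t x) :=
    (hY.mono (ℱ.le t) le_rfl).prodMk (h.measurable_state t)
  have hU : Measurable fun x => (a t x, s (t + 1) x) :=
    (h.measurable_action t).prodMk (h.measurable_state (t + 1))
  have := Measure.isProbabilityMeasure_map (μ := P) hZ.aemeasurable
  rw [← integral_map (hZ.prodMk hU).aemeasurable hf.aestronglyMeasurable, h.map_eq_compProd hY,
    Measure.integral_compProd (Integrable.of_bound hf.aestronglyMeasurable B
      (Filter.Eventually.of_forall hB))]
  have hm : StronglyMeasurable fun z => ∫ u, f (z, u) ∂p.stepKernel.comap Prod.snd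
      (measurable_snd : Measurable (Prod.snd : 𝒴 × S → S)) z :=
    hf.stronglyMeasurable.integral_kernel_prod_right'
  rw [integral_map hZ.aemeasurable hm.aestronglyMeasurable]
  rfl

omit h in
theorem _root_.NonlinearTDC.measurable_integral_kernel {X Z W : Type*} [MeasurableSpace X]
    [MeasurableSpace Z] [MeasurableSpace W] (κ : Kernel Z W) [IsMarkovKernel κ]
    {f : X × Z → W → ℝ} (hf : Measurable (Function.uncurry f)) :
    Measurable fun q : X × Z => ∫ w, f q w ∂κ q.2 := by
  have : StronglyMeasurable fun q : X × Z => ∫ w, Function.uncurry f (q, w) ∂κ.comap Prod.snd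
      (measurable_snd : Measurable (Prod.snd : X × Z → Z)) q :=
    hf.stronglyMeasurable.integral_kernel_prod_right'
  exact this.measurable

omit h in
theorem _root_.NonlinearTDC.abs_integral_le_of_abs_le {X : Type*} [MeasurableSpace X]
    {ν : Measure X} [IsProbabilityMeasure ν] {f : X → ℝ} {B : ℝ} (hB : ∀ x, |f x| ≤ B) :
    |∫ x, f x ∂ν| ≤ B := by
  simpa using norm_integral_le_of_norm_le_const (μ := ν) (f := f) (Filter.Eventually.of_forall hB)

omit h in
instance (n : ℕ) : IsMarkovKernel (p.stateKernel ^ n) := by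
  induction n with
  | zero => rw [pow_zero]; exact inferInstanceAs (IsMarkovKernel Kernel.id)
  | succ n ih => rw [pow_succ]; exact inferInstanceAs (IsMarkovKernel (_ ∘ₖ _))

/-- Induction that integrates out the last transition first: f is replaced by its one-step average,
which has the same bound. Hence the generalization over f. -/
theorem integral_state (hY : Measurable[ℱ t] Y) (n : ℕ) {f : 𝒴 → S → ℝ}
    (hf : Measurable (Function.uncurry f)) {B : ℝ} (hB : ∀ y z, |f y z| ≤ B) :
    ∫ x, f (Y x) (s (t + n) x) ∂P =
      ∫ x, ∫ z, f (Y x) z ∂(p.stateKernel ^ n) (s t x) ∂P := by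
  induction n generalizing f with
  | zero =>
    congr 1; funext x
    have hm : Measurable (f (Y x)) := hf.comp measurable_prodMk_left
    change _ = ∫ z, f (Y x) z ∂(Kernel.id (s t x))
    rw [Kernel.id_apply, integral_dirac' _ _ hm.stronglyMeasurable, add_zero]
  | succ n ih =>
    have hYn : Measurable[ℱ (t + n)] Y := hY.mono (ℱ.mono (by omega)) le_rfl
    set g : 𝒴 → S → ℝ := fun y z => ∫ z', f y z' ∂p.stateKernel z with hg
    have hgm : Measurable (Function.uncurry g) :=
      measurable_integral_kernel p.stateKernel (f := fun (q : 𝒴 × S) z' => f q.1 z')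
        (hf.comp (measurable_fst.fst.prodMk measurable_snd))
    have hgB : ∀ y z, |g y z| ≤ B := fun y z => abs_integral_le_of_abs_le (hB y)
    have h1 := h.integral_step hYn (f := fun q => f q.1.1 q.2.2)
      (hf.comp (measurable_fst.fst.prodMk measurable_snd.snd)) (fun q => hB _ _)
    rw [← add_assoc, h1]
    have h2 : ∀ x, ∫ u, f (Y x) u.2 ∂p.stepKernel (s (t + n) x) = g (Y x) (s (t + n) x) := by
      intro x
      have hm : Measurable (f (Y x)) := hf.comp measurable_prodMk_left
      rw [hg, stateKernel]
      simp only
      rw [Kernel.snd_apply, integral_map measurable_snd.aemeasurable hm.aestronglyMeasurable]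
    simp only [h2]
    rw [ih hgm hgB]
    congr 1; funext x
    have hm : Measurable (f (Y x)) := hf.comp measurable_prodMk_left
    -- This order applies the n-step kernel first and the single step last, matching the averaging
    -- above.
    have e : p.stateKernel ^ (n + 1) = p.stateKernel ∘ₖ (p.stateKernel ^ n) := pow_succ' _ _
    have : IsMarkovKernel (p.stateKernel ∘ₖ (p.stateKernel ^ n)) := inferInstance
    rw [e, Kernel.integral_comp (Integrable.of_bound hm.aestronglyMeasurable B
      (Filter.Eventually.of_forall (hB (Y x))))]

/-- After `n` steps the error of replacing a sample by a stationary one decays geometrically. -/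
theorem abs_integral_sub_le {m κ : ℝ} (herg : p.GeometricallyErgodic m κ) (hY : Measurable[ℱ t] Y)
    {n : ℕ} (hn : 0 < n) {f : 𝒴 → S × A × S → ℝ} (hf : Measurable (Function.uncurry f)) {B : ℝ}
    (hB : ∀ y o, |f y o| ≤ B) :
    |∫ x, f (Y x) (s (t + n) x, a (t + n) x, s (t + n + 1) x) ∂P -
      ∫ x, ∫ o, f (Y x) o ∂p.sampleLaw ∂P| ≤ 2 * B * (m * κ ^ n) := by
  have hYn : Measurable[ℱ (t + n)] Y := hY.mono (ℱ.mono (by omega)) le_rfl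
  have hYm : Measurable Y := hY.mono (ℱ.le t) le_rfl
  have hB0 : 0 ≤ B := by
    obtain ⟨x⟩ := nonempty_of_isProbabilityMeasure P
    exact (abs_nonneg _).trans (hB (Y x) (s t x, a t x, s t x))
  -- Averaging over the action and the next state given the state leaves a function of the state
  -- alone. The stationary law uses the same step kernel, so only the laws of the states have to be
  -- compared.
  set g : 𝒴 → S → ℝ := fun y z => ∫ u, f y (z, u) ∂p.stepKernel z with hg
  have hgm : Measurable (Function.uncurry g) :=
    measurable_integral_kernel p.stepKernel (f := fun (q : 𝒴 × S) u => f q.1 (q.2, u))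
      (hf.comp (measurable_fst.fst.prodMk (measurable_fst.snd.prodMk measurable_snd)))
  have hgB : ∀ y z, |g y z| ≤ B := fun y z => abs_integral_le_of_abs_le fun u => hB _ _
  have h1 := h.integral_step hYn (f := fun q => f q.1.1 (q.1.2, q.2))
    (hf.comp (measurable_fst.fst.prodMk (measurable_fst.snd.prodMk measurable_snd)))
    (fun q => hB _ _)
  have h2 : ∫ x, f (Y x) (s (t + n) x, a (t + n) x, s (t + n + 1) x) ∂P =
      ∫ x, ∫ z, g (Y x) z ∂(p.stateKernel ^ n) (s t x) ∂P := h1.trans (h.integral_state hY n hgm hgB)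
  have h3 : ∀ y, ∫ o, f y o ∂p.sampleLaw = ∫ z, g y z ∂p.μ := fun y => by
    have hm : Measurable (f y) := hf.comp measurable_prodMk_left
    exact Measure.integral_compProd (Integrable.of_bound hm.aestronglyMeasurable B
      (Filter.Eventually.of_forall (hB y)))
  simp only [h3]
  have hi1 : Integrable (fun x => ∫ z, g (Y x) z ∂(p.stateKernel ^ n) (s t x)) P := by
    refine Integrable.of_bound (Measurable.aestronglyMeasurable ?_) B
      (Filter.Eventually.of_forall fun x => abs_integral_le_of_abs_le (hgB (Y x)))
    have := measurable_integral_kernel (p.stateKernel ^ n) (f := fun (q : 𝒴 × S) z => g q.1 z)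
      (hgm.comp (measurable_fst.fst.prodMk measurable_snd))
    exact this.comp (hYm.prodMk (h.measurable_state t))
  have hi2 : Integrable (fun x => ∫ z, g (Y x) z ∂p.μ) P :=
    Integrable.of_bound
      (hgm.stronglyMeasurable.integral_prod_right.measurable.comp hYm).aestronglyMeasurable B
      (Filter.Eventually.of_forall fun x => abs_integral_le_of_abs_le (hgB (Y x)))
  rw [h2, ← integral_sub hi1 hi2]
  refine abs_integral_le_of_abs_le fun x => ?_
  refine (abs_integral_sub_le_tvDist _ _ (hgm.comp measurable_prodMk_left) (hgB (Y x))).trans ?_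
  exact mul_le_mul_of_nonneg_left (herg (s t x) n hn) (by linarith)

/-- The noise along a trajectory, when the iterate is compared with the one `n` steps before. -/
theorem noiseLE (hp : p.Assumptions b) {m κ : ℝ} (herg : p.GeometricallyErgodic m κ) {α β : ℝ}
    (hα : 0 ≤ α) (hβ : 0 ≤ β) (θ₀ ω₀ : Param N) {ψ : Param N × Param N → S × A × S → ℝ}
    (hψ : Measurable (Function.uncurry ψ)) {B : ℝ}
    (hB : ∀ o, BddLip (b.region N) (fun x => ψ x o) B) (ht : 1 ≤ t) {n : ℕ} (hn : 0 < n) :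
    p.NoiseLE P ψ
      (fun x => p.iterates b α β θ₀ ω₀ (fun t => (s t x, a t x, s (t + 1) x)) (t + n))
      (fun x => (s (t + n) x, a (t + n) x, s (t + n + 1) x))
      (2 * B * (n * ((α + β) * b.K)) + 2 * B * (m * κ ^ n)) := by
  set X : ℕ → Ω → Param N × Param N := fun t x =>
    p.iterates b α β θ₀ ω₀ (fun t => (s t x, a t x, s (t + 1) x)) t with hX
  set O : ℕ → Ω → S × A × S := fun t x => (s t x, a t x, s (t + 1) x) with hO
  have hB0 : 0 ≤ B := by
    obtain ⟨o⟩ := nonempty_of_isProbabilityMeasure p.sampleLaw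
    exact (hB o).nonneg
  have hOm : ∀ t, Measurable (O t) := fun t =>
    (h.measurable_state t).prodMk ((h.measurable_action t).prodMk (h.measurable_state (t + 1)))
  have hXm : ∀ t, Measurable (X t) := fun t =>
    hp.measurable_iterates α β θ₀ ω₀ t fun i _ => hOm i
  -- The last sample entering X_t has index t - 1 and contains s_t and a_{t-1}, both known at time
  -- t.
  have hXℱ : Measurable[ℱ t] (X t) := by
    refine hp.measurable_iterates α β θ₀ ω₀ t fun i hi => ?_
    exact ((h.state i).mono (ℱ.mono hi.le) le_rfl).prodMk
      (((h.action i).mono (ℱ.mono hi) le_rfl).prodMk ((h.state (i + 1)).mono (ℱ.mono hi) le_rfl))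
  have hXr : ∀ t, 1 ≤ t → ∀ x, X t x ∈ b.region N := fun t ht x =>
    Assumptions.iterates_mem_region α β θ₀ ω₀ _ ht
  obtain ⟨φ, hφ, hφB, hφe⟩ := exists_truncation (measurableSet_region b N) hψ hB0
    fun x hx o => (hB o).norm_le x hx
  -- Going back n steps is paid for twice, once with the actual sample and once with the stationary
  -- one; between the two replacements lies the mixing error at lag n.
  have hlip : ∀ x o, |φ (X (t + n) x) o - φ (X t x) o| ≤ B * (n * ((α + β) * b.K)) := fun x o => by
    rw [hφe _ (hXr (t + n) (by omega) x), hφe _ (hXr t ht x)]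
    exact ((hB o).norm_sub_le _ (hXr (t + n) (by omega) x) _ (hXr t ht x)).trans
      (mul_le_mul_of_nonneg_left (hp.dist_iterates_add_le hα hβ θ₀ ω₀ _ ht n) hB0)
  have hi : ∀ i, Integrable (fun x => φ (X i x) (O (t + n) x)) P := fun i =>
    Integrable.of_bound (hφ.comp ((hXm i).prodMk (hOm (t + n)))).aestronglyMeasurable B
      (Filter.Eventually.of_forall fun x => hφB _ _)
  have hj : ∀ i, Integrable (fun x => ∫ o, φ (X i x) o ∂p.sampleLaw) P := fun i =>
    Integrable.of_bound (hφ.stronglyMeasurable.integral_prod_right.measurable.comp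
      (hXm i)).aestronglyMeasurable B
      (Filter.Eventually.of_forall fun x => abs_integral_le_of_abs_le (hφB (X i x)))
  have hk : ∀ y, Integrable (φ y) p.sampleLaw := fun y =>
    Integrable.of_bound (hφ.comp measurable_prodMk_left).aestronglyMeasurable B
      (Filter.Eventually.of_forall fun o => hφB y o)
  have h1 : |∫ x, φ (X (t + n) x) (O (t + n) x) ∂P - ∫ x, φ (X t x) (O (t + n) x) ∂P| ≤
      B * (n * ((α + β) * b.K)) := by
    rw [← integral_sub (hi (t + n)) (hi t)]
    exact abs_integral_le_of_abs_le fun x => hlip x _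
  have h2 := h.abs_integral_sub_le herg hXℱ hn hφ hφB
  have h3 : |∫ x, ∫ o, φ (X (t + n) x) o ∂p.sampleLaw ∂P - ∫ x, ∫ o, φ (X t x) o ∂p.sampleLaw ∂P| ≤
      B * (n * ((α + β) * b.K)) := by
    rw [← integral_sub (hj (t + n)) (hj t)]
    refine abs_integral_le_of_abs_le fun x => ?_
    rw [← integral_sub (hk _) (hk _)]
    exact abs_integral_le_of_abs_le fun o => hlip x o
  have e : ∀ x, ψ (X (t + n) x) = φ (X (t + n) x) := fun x => (hφe _ (hXr (t + n) (by omega) x)).symm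
  unfold NoiseLE
  change |∫ x, ψ (X (t + n) x) (O (t + n) x) ∂P -
    ∫ x, ∫ o, ψ (X (t + n) x) o ∂p.sampleLaw ∂P| ≤ _
  simp only [e]
  rw [abs_le] at *
  constructor <;> linarith [h1.1, h1.2, h2.1, h2.2, h3.1, h3.2]

end IsMarkov

end Markov

/-- Crude bound for the early times, at which no iterate from one mixing time before is available.
-/
theorem noiseLE_two_mul {Ω : Type*} [MeasurableSpace Ω] {P : Measure Ω} [IsProbabilityMeasure P]
    {ψ : Param N × Param N → S × A × S → ℝ} {B : ℝ}
    (hB : ∀ o, BddLip (b.region N) (fun x => ψ x o) B) {X : Ω → Param N × Param N}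
    (hX : ∀ x, X x ∈ b.region N) (O : Ω → S × A × S) : p.NoiseLE P ψ X O (2 * B) := by
  have h1 : |∫ x, ψ (X x) (O x) ∂P| ≤ B :=
    abs_integral_le_of_abs_le fun x => (hB _).norm_le _ (hX x)
  have h2 : |∫ x, ∫ o, ψ (X x) o ∂p.sampleLaw ∂P| ≤ B :=
    abs_integral_le_of_abs_le fun x => abs_integral_le_of_abs_le fun o => (hB o).norm_le _ (hX x)
  refine (abs_sub _ _).trans ?_
  linarith

end Problem

/-! ### Step-sizes, final constants and the mixing time -/

theorem IsUniformIndex.comp {Ω Y Z : Type*} [MeasurableSpace Ω] [MeasurableSpace Y]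
    [MeasurableSpace Z] {P : Measure Ω} {T : ℕ} {W : Ω → ℕ} {X : Ω → Y}
    (h : IsUniformIndex P T W X) {g : Y → Z} (hg : Measurable g) :
    IsUniformIndex P T W (fun x => g (X x)) :=
  ⟨h.measurable, h.uniform, h.indep.comp measurable_id hg⟩

theorem StepSizes.pos {c₀ c₁ c₂ : ℝ} {T : ℕ} {α β : ℝ} (h : StepSizes c₀ c₁ c₂ T α β)
    (hc : 0 < c₁) (hT : 1 ≤ T) : 0 < α ∧ 0 < β := by
  have : 0 < c₁ / √(T : ℝ) := div_pos hc (Real.sqrt_pos.2 (by exact_mod_cast hT))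
  exact ⟨this.trans_le h.le_α, this.trans_le h.le_β⟩

/-- The constant of the final bounds; `E` bounds the contribution of the noise. -/
def Bounds.rateConst (b : Bounds) (c₁ c₂ E : ℝ) : ℝ :=
  b.gradLip ^ 2 + (2 * (b.K * b.M + 4 * b.M ^ 2) + 2 * b.stepConst * c₂ ^ 2 + E) * 4 / c₁

theorem Bounds.stepConst_nonneg (b : Bounds) : 0 ≤ b.stepConst := by
  have := b.K_pos
  have := b.M_pos
  unfold stepConst; positivity

theorem Bounds.noiseBound_nonneg (b : Bounds) : 0 ≤ b.noiseBound := by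
  have := b.K_pos
  have := b.M_pos
  have := b.wLip_nonneg
  have := b.gradLip_nonneg
  have := b.wDerivLip_nonneg
  unfold noiseBound weightLip; positivity

/-- The mixing time: after `mixingTime κ T` steps the distance to stationarity is of order `1/T`. -/
def mixingTime (κ : ℝ) (T : ℕ) : ℕ := ⌈Real.log T / (-Real.log κ)⌉₊

section mixingTime

variable {κ : ℝ} (h0 : 0 < κ) (h1 : κ < 1) {T : ℕ} (hT : 2 ≤ T)
include h0 h1 hT

theorem mixingTime_pos : 0 < mixingTime κ T := by
  have hT' : (1 : ℝ) < T := by exact_mod_cast hT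
  exact Nat.ceil_pos.2 (div_pos (Real.log_pos hT') (neg_pos.2 (Real.log_neg h0 h1)))

theorem pow_mixingTime_le : κ ^ mixingTime κ T ≤ 1 / (T : ℝ) := by
  have hT' : (0 : ℝ) < T := by exact_mod_cast (by omega : 0 < T)
  have hl : 0 < -Real.log κ := neg_pos.2 (Real.log_neg h0 h1)
  have h := Nat.le_ceil (Real.log T / (-Real.log κ))
  rw [div_le_iff₀ hl] at h
  rw [← Real.log_le_log_iff (pow_pos h0 _) (by positivity), Real.log_pow, one_div, Real.log_inv]
  unfold mixingTime
  linarith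

/-- Rounding up adds at most 1, and 1 ≤ log T / log 2 for T ≥ 2. The second inequality later lets
terms without a logarithm be absorbed too. -/
theorem mixingTime_le :
    (mixingTime κ T : ℝ) ≤ (1 / (-Real.log κ) + 1 / Real.log 2) * Real.log T ∧
      1 ≤ (1 / (-Real.log κ) + 1 / Real.log 2) * Real.log T := by
  have hT' : (2 : ℝ) ≤ T := by exact_mod_cast hT
  have hl : 0 < -Real.log κ := neg_pos.2 (Real.log_neg h0 h1)
  have h2 : 0 < Real.log 2 := Real.log_pos one_lt_two
  have h3 : Real.log 2 ≤ Real.log T := Real.log_le_log two_pos hT'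
  have h4 : 1 ≤ 1 / Real.log 2 * Real.log T := by
    rw [one_div_mul_eq_div, le_div_iff₀ h2]; linarith
  have h5 : 0 ≤ 1 / (-Real.log κ) * Real.log T :=
    mul_nonneg (one_div_nonneg.2 hl.le) (h2.le.trans h3)
  have h6 := (Nat.ceil_lt_add_one (a := Real.log T / (-Real.log κ))
    (div_nonneg (h2.le.trans h3) hl.le)).le
  rw [← one_div_mul_eq_div] at h6
  rw [add_mul]
  refine ⟨?_, by linarith⟩
  unfold mixingTime
  rw [← one_div_mul_eq_div (-Real.log κ)]
  linarith

end mixingTime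

/-! ### The convergence rates -/

namespace Problem

variable {S A : Type*} [MeasurableSpace S] [MeasurableSpace A] {N : ℕ} {p : Problem S A N}
  {b : Bounds} {Ω : Type*} [MeasurableSpace Ω] {P : Measure Ω} [IsProbabilityMeasure P]

/-- The rate of convergence, in terms of the accumulated noise. -/
theorem Assumptions.integral_norm_gradient_sq_le (hp : p.Assumptions b)
    {O : ℕ → Ω → S × A × S} (hO : ∀ t, Measurable (O t)) {c₁ c₂ : ℝ} (hc₁ : 0 < c₁) {T : ℕ}
    (hT : 1 ≤ T) {W : Ω → ℕ} (hW : IsUniformIndex P T W (fun x t => O t x)) {α β : ℝ}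
    (hst : StepSizes b.ratioBound c₁ c₂ T α β) (θ₀ ω₀ : Param N) {η : ℕ → ℝ} (hη : ∀ t, 0 ≤ η t)
    (hs : ∀ t, 1 ≤ t → p.NoiseLE P p.slowNoise
      (fun x => p.iterates b α β θ₀ ω₀ (fun t => O t x) t) (O t) (η t))
    (hf : ∀ t, 1 ≤ t → p.NoiseLE P p.fastNoise
      (fun x => p.iterates b α β θ₀ ω₀ (fun t => O t x) t) (O t) (η t))
    {E : ℝ} (hE : ∑ t ∈ Finset.range T, (α + β) * η t ≤ E) :
    Integrable (fun x =>
      ‖gradient p.J (p.iterates b α β θ₀ ω₀ (fun t => O t x) (W x)).1‖ ^ 2) P ∧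
    ∫ x, ‖gradient p.J (p.iterates b α β θ₀ ω₀ (fun t => O t x) (W x)).1‖ ^ 2 ∂P ≤
      b.rateConst c₁ c₂ E * (1 / √(T : ℝ)) := by
  obtain ⟨hα, hβ⟩ := hst.pos hc₁ hT
  simp only [hp.gradient_J]
  have hgb : ∀ θ : Param N, ‖p.gradJ θ‖ ^ 2 ≤ b.gradLip ^ 2 := fun θ => by
    have := hp.bddLip_gradJ.norm_le (θ, 0) (by
      change ‖(0 : Param N)‖ ≤ b.M
      rw [norm_zero]; exact b.M_pos.le)
    gcongr
  -- Each iterate is a measurable function of the whole sample sequence, which is the object that W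
  -- is independent of.
  have hfm : ∀ k, Measurable fun o : ℕ → S × A × S =>
      ‖p.gradJ (p.iterates b α β θ₀ ω₀ o k).1‖ ^ 2 := fun k =>
    ((hp.continuous_gradJ.comp continuous_fst).norm.pow 2).measurable.comp
      (hp.measurable_iterates (O := fun t (o : ℕ → S × A × S) => o t) α β θ₀ ω₀ k
        fun i _ => measurable_pi_apply i)
  obtain ⟨h1, h2⟩ := integral_uniformIndex hT (measurable_pi_lambda _ hO) hW hfm
    (B := b.gradLip ^ 2) (fun k o => by rw [abs_of_nonneg (sq_nonneg _)]; exact hgb _)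
  refine ⟨h1, ?_⟩
  rw [h2]
  have h3 := hp.sum_integral_norm_gradJ_sq_le hO hα hβ hst.ratio θ₀ ω₀ hT hη hs hf
  have hT' : (1 : ℝ) ≤ T := by exact_mod_cast hT
  set r := √(T : ℝ) with hr
  have hr1 : 1 ≤ r := Real.one_le_sqrt.2 hT'
  have hr0 : 0 < r := zero_lt_one.trans_le hr1
  have hrT : (T : ℝ) = r ^ 2 := (Real.sq_sqrt (by linarith)).symm
  have hC := b.stepConst_nonneg
  have hM := b.M_pos
  have hK := b.K_pos
  have hE0 : 0 ≤ E := le_trans (Finset.sum_nonneg fun t _ =>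
    mul_nonneg (add_pos hα hβ).le (hη t)) hE
  have hα2 : α ^ 2 ≤ (c₂ / r) ^ 2 := pow_le_pow_left₀ hα.le hst.α_le 2
  have hβ2 : β ^ 2 ≤ (c₂ / r) ^ 2 := pow_le_pow_left₀ hβ.le hst.β_le 2
  have hsum : ∑ t ∈ Finset.range T, ((α + β) * η t + b.stepConst * (α ^ 2 + β ^ 2)) ≤
      E + 2 * b.stepConst * c₂ ^ 2 := by
    rw [Finset.sum_add_distrib, Finset.sum_const, Finset.card_range, nsmul_eq_mul]
    refine add_le_add hE ?_
    have h5 : α ^ 2 + β ^ 2 ≤ 2 * (c₂ / r) ^ 2 := by linarith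
    calc (T : ℝ) * (b.stepConst * (α ^ 2 + β ^ 2))
        ≤ r ^ 2 * (b.stepConst * (2 * (c₂ / r) ^ 2)) := by rw [hrT]; gcongr
      _ = 2 * b.stepConst * c₂ ^ 2 := by field_simp
  set D := 2 * (b.K * b.M + 4 * b.M ^ 2) + 2 * b.stepConst * c₂ ^ 2 + E with hD
  have hD0 : 0 ≤ D := by positivity
  -- The second-order terms sum to O(T · 1/T). Dividing by α/4, which is at least c₁/(4√T), costs a
  -- factor √T, and the average 1/T turns it into 1/√T.
  have h4 : (2 * (b.K * b.M + 4 * b.M ^ 2) + ∑ t ∈ Finset.range T,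
      ((α + β) * η t + b.stepConst * (α ^ 2 + β ^ 2))) / (α / 4) ≤ D * 4 / c₁ * r := by
    calc _ ≤ D / (α / 4) := by
          refine div_le_div_of_nonneg_right ?_ (by positivity)
          linarith
      _ ≤ D / (c₁ / r / 4) := by
          have := hst.le_α
          gcongr
      _ = D * 4 / c₁ * r := by field_simp
  have h5 : b.gradLip ^ 2 ≤ b.gradLip ^ 2 * r := le_mul_of_one_le_right (sq_nonneg _) hr1
  calc 1 / (T : ℝ) * _ ≤ 1 / (T : ℝ) * ((b.gradLip ^ 2 + D * 4 / c₁) * r) := by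
        refine mul_le_mul_of_nonneg_left (h3.trans ?_) (by positivity)
        linarith
    _ = b.rateConst c₁ c₂ E * (1 / r) := by
        rw [hrT, Bounds.rateConst, ← hD]
        field_simp

theorem Assumptions.iid_rate (hp : p.Assumptions b) {c₁ c₂ : ℝ} (hc₁ : 0 < c₁)
    {O : ℕ → Ω → S × A × S} (hO : p.IsIIDSample P O) {T : ℕ} (hT : 1 ≤ T) {W : Ω → ℕ}
    (hW : IsUniformIndex P T W (fun x t => O t x)) {α β : ℝ}
    (hst : StepSizes b.ratioBound c₁ c₂ T α β) (θ₀ ω₀ : Param N) :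
    Integrable (fun x =>
      ‖gradient p.J (p.iterates b α β θ₀ ω₀ (fun t => O t x) (W x)).1‖ ^ 2) P ∧
    ∫ x, ‖gradient p.J (p.iterates b α β θ₀ ω₀ (fun t => O t x) (W x)).1‖ ^ 2 ∂P ≤
      b.rateConst c₁ c₂ 0 * (1 / √(T : ℝ)) :=
  hp.integral_norm_gradient_sq_le hO.measurable hc₁ hT hW hst θ₀ ω₀ (η := fun _ => 0)
    (fun _ => le_rfl)
    (fun _ ht => hp.noiseLE_of_isIIDSample hO α β θ₀ ω₀ hp.measurable_slowNoise
      hp.bddLip_slowNoise ht)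
    (fun _ ht => hp.noiseLE_of_isIIDSample hO α β θ₀ ω₀ hp.measurable_fastNoise
      hp.bddLip_fastNoise ht)
    (by simp)

/-- The bound for the accumulated noise along a trajectory, relative to the mixing time. -/
def _root_.NonlinearTDC.Bounds.markovConst (b : Bounds) (c₂ m : ℝ) : ℝ :=
  2 * c₂ * (4 * b.noiseBound + 4 * b.noiseBound * b.K * c₂ + 2 * b.noiseBound * m)

/-- With lag τ equal to the mixing time, the noise is O(1) for the first τ steps and O(τ/√T + 1/T)
afterwards. Its sum is O(τ + τ√T), and the factor α + β = O(1/√T) reduces it to O(τ) = O(log T). -/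
theorem Assumptions.markov_rate (hp : p.Assumptions b) {c₁ c₂ m κ : ℝ} (hc₁ : 0 < c₁)
    (hc₂ : c₁ ≤ c₂) (hm : 0 < m) (h0 : 0 < κ) (h1 : κ < 1) (herg : p.GeometricallyErgodic m κ)
    {s : ℕ → Ω → S} {a : ℕ → Ω → A} (htr : p.IsTrajectory P s a) {T : ℕ} (hT : 2 ≤ T)
    {W : Ω → ℕ} (hW : IsUniformIndex P T W (fun x t => (s t x, a t x))) {α β : ℝ}
    (hst : StepSizes b.ratioBound c₁ c₂ T α β) (θ₀ ω₀ : Param N) :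
    Integrable (fun x => ‖gradient p.J (p.iterates b α β θ₀ ω₀
      (fun t => (s t x, a t x, s (t + 1) x)) (W x)).1‖ ^ 2) P ∧
    ∫ x, ‖gradient p.J (p.iterates b α β θ₀ ω₀
      (fun t => (s t x, a t x, s (t + 1) x)) (W x)).1‖ ^ 2 ∂P ≤
      b.rateConst c₁ c₂ (b.markovConst c₂ m) * (1 / (-Real.log κ) + 1 / Real.log 2) *
        (Real.log T / √(T : ℝ)) := by
  obtain ⟨ℱ, hs, ha, hl⟩ := htr.markov
  have h : p.IsMarkov P ℱ s a := ⟨hs, ha, hl⟩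
  obtain ⟨hα, hβ⟩ := hst.pos hc₁ (by omega : 1 ≤ T)
  set O : ℕ → Ω → S × A × S := fun t x => (s t x, a t x, s (t + 1) x) with hO
  have hOm : ∀ t, Measurable (O t) := fun t =>
    (h.measurable_state t).prodMk ((h.measurable_action t).prodMk (h.measurable_state (t + 1)))
  -- The sample sequence is a measurable function of the state-action sequence, so it inherits the
  -- independence from W.
  have hWO : IsUniformIndex P T W (fun x t => O t x) := by
    refine hW.comp (g := fun y t => ((y t).1, (y t).2, (y (t + 1)).1))
      (measurable_pi_lambda _ fun t => ?_)
    have e1 : Measurable fun y : ℕ → S × A => y t := measurable_pi_apply t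
    have e2 : Measurable fun y : ℕ → S × A => y (t + 1) := measurable_pi_apply (t + 1)
    exact e1.fst.prodMk (e1.snd.prodMk e2.fst)
  set τ := mixingTime κ T with hτ
  have hτ0 : 0 < τ := mixingTime_pos h0 h1 hT
  obtain ⟨hτ1, hq⟩ := mixingTime_le h0 h1 hT
  set q := (1 / (-Real.log κ) + 1 / Real.log 2) * Real.log T with hqd
  have hpow := pow_mixingTime_le h0 h1 hT
  rw [← hτ] at hτ1 hpow
  have hB := b.noiseBound_nonneg
  have hK := b.K_pos
  set B := b.noiseBound with hBd
  have hT' : (1 : ℝ) ≤ T := by exact_mod_cast (by omega : 1 ≤ T)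
  set late := 2 * B * (τ * ((α + β) * b.K)) + 2 * B * (m * κ ^ τ) with hlate
  have hlate0 : 0 ≤ late := by positivity
  set η : ℕ → ℝ := fun t => if t ≤ τ then 2 * B else late with hηd
  have hη : ∀ t, 0 ≤ η t := fun t => by
    simp only [hηd]
    split_ifs
    · positivity
    · exact hlate0
  have noise : ∀ ψ : Param N × Param N → S × A × S → ℝ, Measurable (Function.uncurry ψ) →
      (∀ o, BddLip (b.region N) (fun x => ψ x o) B) → ∀ t, 1 ≤ t → p.NoiseLE P ψ
        (fun x => p.iterates b α β θ₀ ω₀ (fun t => O t x) t) (O t) (η t) := by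
    intro ψ hψ hψB t ht
    simp only [hηd]
    split_ifs with htτ
    · exact noiseLE_two_mul hψB (fun x => iterates_mem_region α β θ₀ ω₀ _ ht) (O t)
    -- For t = τ + u + 1 the comparison time is u + 1 ≥ 1, where the iterate is already in the
    -- region.
    · obtain ⟨u, rfl⟩ := Nat.exists_eq_add_of_lt (not_le.1 htτ)
      have := h.noiseLE hp herg hα.le hβ.le θ₀ ω₀ hψ hψB (t := u + 1) (by omega) hτ0
      rwa [show τ + u + 1 = u + 1 + τ by omega]
  have hsum : ∑ t ∈ Finset.range T, η t ≤ (τ + 1) * (2 * B) + T * late := by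
    calc ∑ t ∈ Finset.range T, η t
        ≤ ∑ t ∈ Finset.range T, ((if t ≤ τ then 2 * B else 0) + late) := by
          refine Finset.sum_le_sum fun t _ => ?_
          simp only [hηd]
          split_ifs <;> linarith
      _ = ∑ t ∈ Finset.range T, (if t ≤ τ then 2 * B else 0) + T * late := by
          rw [Finset.sum_add_distrib, Finset.sum_const, Finset.card_range, nsmul_eq_mul]
      _ ≤ (τ + 1) * (2 * B) + T * late := by
          refine add_le_add ?_ le_rfl
          rw [← Finset.sum_filter, Finset.sum_const, nsmul_eq_mul]
          refine mul_le_mul_of_nonneg_right ?_ (by positivity)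
          have : (Finset.range T).filter (· ≤ τ) ⊆ Finset.range (τ + 1) := fun t ht => by
            simp only [Finset.mem_filter, Finset.mem_range] at ht ⊢
            omega
          have := Finset.card_le_card this
          rw [Finset.card_range] at this
          exact_mod_cast this
  have hc20 : 0 < c₂ := hc₁.trans_le hc₂
  set r := √(T : ℝ) with hr
  have hr1 : 1 ≤ r := Real.one_le_sqrt.2 hT'
  have hr0 : 0 < r := zero_lt_one.trans_le hr1
  have hrT : (T : ℝ) = r ^ 2 := (Real.sq_sqrt (by linarith)).symm
  have hαβ : α + β ≤ 2 * c₂ / r := by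
    have := hst.α_le
    have := hst.β_le
    rw [two_mul, add_div]; linarith
  have hE : ∑ t ∈ Finset.range T, (α + β) * η t ≤ q * b.markovConst c₂ m := by
    rw [← Finset.mul_sum]
    -- T · τ(α + β) is of order τ√T, while T κ^τ ≤ 1 by the choice of τ.
    have hlate1 : T * late ≤ 4 * B * b.K * c₂ * τ * r + 2 * B * m := by
      have e1 : (α + β) * r ≤ 2 * c₂ := by rwa [le_div_iff₀ hr0] at hαβ
      have e2 : T * κ ^ τ ≤ 1 := by
        rwa [le_div_iff₀ (by linarith), mul_comm] at hpow
      have e3 := mul_le_mul_of_nonneg_left e1 (by positivity : 0 ≤ 2 * B * τ * b.K * r)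
      have e4 := mul_le_mul_of_nonneg_left e2 (by positivity : 0 ≤ 2 * B * m)
      calc T * late = 2 * B * τ * b.K * r * ((α + β) * r) + 2 * B * m * (T * κ ^ τ) := by
            rw [hlate, hrT]; ring
        _ ≤ _ := by linarith
    calc (α + β) * ∑ t ∈ Finset.range T, η t
        ≤ 2 * c₂ / r * ((τ + 1) * (2 * B) * r + (4 * B * b.K * c₂ * τ * r + 2 * B * m * r)) := by
          refine mul_le_mul hαβ (hsum.trans (add_le_add ?_ (hlate1.trans ?_)))
            (Finset.sum_nonneg fun t _ => hη t) (by positivity)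
          · exact le_mul_of_one_le_right (by positivity) hr1
          · have := le_mul_of_one_le_right (by positivity : 0 ≤ 2 * B * m) hr1
            linarith
      _ = 2 * c₂ * ((τ + 1) * (2 * B) + 4 * B * b.K * c₂ * τ + 2 * B * m) := by
          field_simp
          ring
      _ ≤ 2 * c₂ * ((q + q) * (2 * B) + 4 * B * b.K * c₂ * q + 2 * B * m * q) := by
          have := le_mul_of_one_le_right (by positivity : 0 ≤ 2 * B * m) hq
          gcongr
      _ = q * b.markovConst c₂ m := by
          unfold Bounds.markovConst
          ring
  obtain ⟨g1, g2⟩ := hp.integral_norm_gradient_sq_le hOm hc₁ (by omega) hWO hst θ₀ ω₀ hη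
    (noise _ hp.measurable_slowNoise hp.bddLip_slowNoise)
    (noise _ hp.measurable_fastNoise hp.bddLip_fastNoise) hE
  refine ⟨g1, g2.trans ?_⟩
  -- `rateConst` is affine in the noise with nonnegative constant part, so q ≥ 1 can be pulled out
  -- as a common factor.
  have hrate : b.rateConst c₁ c₂ (q * b.markovConst c₂ m) ≤
      q * b.rateConst c₁ c₂ (b.markovConst c₂ m) := by
    have hM := b.M_pos
    have hC := b.stepConst_nonneg
    have k1 : 0 ≤ (q - 1) * b.gradLip ^ 2 := mul_nonneg (by linarith) (sq_nonneg _)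
    have k2 : 0 ≤ (q - 1) * ((2 * (b.K * b.M + 4 * b.M ^ 2) + 2 * b.stepConst * c₂ ^ 2) * 4 / c₁) :=
      mul_nonneg (by linarith) (by positivity)
    unfold Bounds.rateConst
    have e : ∀ x y : ℝ, (x + y) * 4 / c₁ = x * 4 / c₁ + y * 4 / c₁ := fun x y => by ring
    rw [e, e]
    linear_combination k1 + k2
  calc _ ≤ q * b.rateConst c₁ c₂ (b.markovConst c₂ m) * (1 / r) :=
        mul_le_mul_of_nonneg_right hrate (by positivity)
    _ = _ := by rw [hqd]; ring

end Problem

end NonlinearTDC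

end

theorem mainTheorem2 (b : NonlinearTDC.Bounds) :
    ∃ c₀ : ℝ, 0 < c₀ ∧ ∀ c₁ c₂ R₀ : ℝ, 0 < c₁ → c₁ ≤ c₂ → 0 ≤ R₀ →
      -- i.i.d. sampling
      (∃ C : ℝ, ∀ (S : Type*) (A : Type*) [MeasurableSpace S] [MeasurableSpace A] (N : ℕ)
        (p : NonlinearTDC.Problem S A N), p.Assumptions b →
        Differentiable ℝ p.J ∧
        ∀ (Ω : Type*) [MeasurableSpace Ω] (P : Measure Ω) [IsProbabilityMeasure P]
          (O : ℕ → Ω → S × A × S) (T : ℕ) (W : Ω → ℕ) (α β : ℝ)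
          (θ₀ ω₀ : NonlinearTDC.Param N),
          p.IsIIDSample P O → 1 ≤ T →
          NonlinearTDC.IsUniformIndex P T W (fun x t => O t x) →
          NonlinearTDC.StepSizes c₀ c₁ c₂ T α β → ‖ω₀‖ ≤ R₀ →
          Integrable (fun x =>
            ‖gradient p.J (p.iterates b α β θ₀ ω₀ (fun t => O t x) (W x)).1‖ ^ 2) P ∧
          ∫ x, ‖gradient p.J (p.iterates b α β θ₀ ω₀ (fun t => O t x) (W x)).1‖ ^ 2 ∂P
            ≤ C * (1 / √(T : ℝ))) ∧
      -- Markovian sampling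
      (∀ m κ : ℝ, 0 < m → 0 < κ → κ < 1 →
        ∃ C : ℝ, ∀ (S : Type*) (A : Type*) [MeasurableSpace S] [MeasurableSpace A] (N : ℕ)
        (p : NonlinearTDC.Problem S A N), p.Assumptions b → p.GeometricallyErgodic m κ →
        Differentiable ℝ p.J ∧
        ∀ (Ω : Type*) [MeasurableSpace Ω] (P : Measure Ω) [IsProbabilityMeasure P]
          (s : ℕ → Ω → S) (a : ℕ → Ω → A) (T : ℕ) (W : Ω → ℕ) (α β : ℝ)
          (θ₀ ω₀ : NonlinearTDC.Param N),
          p.IsTrajectory P s a → 2 ≤ T →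
          NonlinearTDC.IsUniformIndex P T W (fun x t => (s t x, a t x)) →
          NonlinearTDC.StepSizes c₀ c₁ c₂ T α β → ‖ω₀‖ ≤ R₀ →
          Integrable (fun x => ‖gradient p.J (p.iterates b α β θ₀ ω₀
            (fun t => (s t x, a t x, s (t + 1) x)) (W x)).1‖ ^ 2) P ∧
          ∫ x, ‖gradient p.J (p.iterates b α β θ₀ ω₀
            (fun t => (s t x, a t x, s (t + 1) x)) (W x)).1‖ ^ 2 ∂P
            ≤ C * (Real.log T / √(T : ℝ))) := by
  -- The threshold for α/β is the largest ratio at which the drift estimate lets the fast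
  -- contraction absorb the coupling error.
  refine ⟨b.ratioBound, b.ratioBound_pos, fun c₁ c₂ R₀ hc₁ hc₂ _ =>
    ⟨⟨b.rateConst c₁ c₂ 0, ?_⟩, fun m κ hm h0 h1 =>
      ⟨b.rateConst c₁ c₂ (b.markovConst c₂ m) * (1 / (-Real.log κ) + 1 / Real.log 2), ?_⟩⟩⟩
  · intro S A _ _ N p hp
    exact ⟨hp.differentiable_J, fun Ω _ P _ O T W α β θ₀ ω₀ hO hT hW hst _ =>
      hp.iid_rate hc₁ hO hT hW hst θ₀ ω₀⟩
  · intro S A _ _ N p hp herg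
    exact ⟨hp.differentiable_J, fun Ω _ P _ s a T W α β θ₀ ω₀ htr hT hW hst _ =>
      hp.markov_rate hc₁ hc₂ hm h0 h1 herg htr hT hW hst θ₀ ω₀⟩
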